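/- Let $(\mathfrak g,\mathrm d,\{-,-\})$ be a differential graded Lie algebra, $\mathfrak g=\bigoplus_{k\in\mathbb Z}\mathfrak g_k$, $|\mathrm d|=1$, over a field of characteristic $0$, with $\mathfrak g_k$ finite-dimensional for $k<0$. Put $\mathfrak E=\bigoplus_{k\le 0}\mathfrak E_k$ with $\mathfrak E_k=\mathfrak g_{k-1}$, and let $\delta=\mathrm d|_{\mathfrak g_{-1}}$, extended by zero. The associated $h\mathcal Lie$-algebra structure on $\mathfrak E$ consists of $\varepsilon_1(x)=\mathrm dx$ for $|x|_{\mathfrak E}<0$ and $\varepsilon_1(x)=0$ for $|x|_{\mathfrak E}=0$, of $\varepsilon_2^0(x,y)=\{\delta x,y\}$, and of the alternator $\varepsilon_2^1(x,y)=(-1)^{|x|_{\mathfrak E}}\{x,y\}$. Its antisymmetrization is the $L_\infty$-algebra $(\mathfrak E,\mu_n)$ with $\mu_1=\varepsilon_1$ and, for $n\ge 2$, $$\mu_n(x_1,\dots,x_n)=\frac{(-1)^{n-1}B_{n-1}}{(n-1)!}\sum_{\sigma\in S_n}\chi(\sigma;x)\,\varepsilon_2^1(\dots\varepsilon_2^1(\varepsilon_2^1(\varepsilon_2^0(x_{\sigma(1)},x_{\sigma(2)}),x_{\sigma(3)}),x_{\sigma(4)})\dots,x_{\sigma(n)}),$$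 where $\chi$ is the antisymmetric Koszul sign with respect to the degrees in $\mathfrak E$ and $B_1=-\tfrac12,\ B_2=\tfrac16,\dots$ are the Bernoulli numbers. Let $(\tau_\alpha)$ be a homogeneous basis of $\mathfrak E$, and let $t^\alpha\in\mathfrak E[1]^*$ and $\hat t^\alpha\in\mathfrak E[2]^*$ be the dual generators, of degrees $|\alpha|:=1-|\tau_\alpha|_{\mathfrak E}\ge1$ and $|\alpha|+1$. Write $\mu_k(\tau_{\beta_1},\dots,\tau_{\beta_k})=m^\alpha_{\beta_1\dots\beta_k}\tau_\alpha$ (repeated indices are summed over). The Weil algebra is the free graded commutative algebra $\bigodot^\bullet(\mathfrak E[1]^*\oplus\mathfrak E[2]^*)$ with the derivation $Q_{\mathsf W}$ given by $Q_{\mathsf W}t^\alpha=Q_{\mathsf{CE}}t^\alpha+\hat t^\alpha$ and $Q_{\mathsf W}\hat t^\alpha=-\sigma(Q_{\mathsf{CE}}t^\alpha)$, where $\sigma$ is the derivation of degree $1$ with $\sigma t^\alpha=\hat t^\alpha$, $\sigma\hat t^\alpha=0$, and $$Q_{\mathsf{CE}}t^\alpha=-\sum_{k\ge1}\frac1{k!}(-1)^{k\sum_j|\beta_j|+\sum_{j<l}|\beta_l|(|\beta_j|-1)}\,m^\alpha_{\beta_1\dots\beta_k}\,t^{\beta_1}\cdots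 t^{\beta_k}.$$ A firmly adjusted Weil algebra is a differential graded commutative algebra obtained from it by an invertible coordinate change $t^\alpha\mapsto t^\alpha$, $\hat t^\alpha\mapsto\hat t'^\alpha=\hat t^\alpha+p^\alpha$, with $p^\alpha$ a polynomial of degree $|\alpha|+1$ each of whose monomials contains at least one $\hat t^\beta$, such that, when the differential is expressed in terms of the $t^\beta$ and $\hat t'^\beta$, every monomial in the image of each $\hat t'^\alpha$ contains at most one of the generators $t^\beta$, and only one with $|\beta|=1$. **Theorem.** Suppose that the $L_\infty$-algebra $(\mathfrak E,\mu_n)$ has at most ternary brackets, i.e. $\mu_n=0$ for $n\ge4$. Then $Q_{\mathsf W}$ has degree $1$ and $Q_{\mathsf W}^2=0$, so that the Weil algebra is a differential graded commutative algebra, and the $L_\infty$-algebra admits a firmly adjusted Weil algebra whose coordinate change is given by the alternator. Namely, let $\varepsilon_2^1(\tau_\beta,\tau_\gamma)=n^\alpha_{\beta\gamma}\tau_\alpha$, $s^\alpha_{\beta\gamma}=\tfrac12(-1)^{|\beta|(|\gamma|+1)}n^\alpha_{\beta\gamma}$, and let $S$ be the operator $(SX)^\alpha=s^\alpha_{\beta\gamma}X^\beta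 t^\gamma$ on families $X=(X^\alpha)$ of elements of the Weil algebra. Then the coordinate change $$\hat t^\alpha\ \mapsto\ \hat t'^\alpha=\hat t^\alpha+s^\alpha_{\beta\gamma}\,\hat t^\beta t^\gamma+\sum_{n=2}^{|\alpha|-1}\frac{2^n}{(n+1)!}\,(S^n\hat t)^\alpha$$ produces a firmly adjusted Weil algebra. In particular, if all nested alternators $\varepsilon_2^1(\varepsilon_2^1(x,y),z)$, $x,y,z\in\mathfrak E$, vanish, then the coordinate change is $\hat t^\alpha\mapsto\hat t^\alpha+s^\alpha_{\beta\gamma}\hat t^\beta t^\gamma$. -/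

import Mathlib

open scoped BigOperators

noncomputable section

/-! ### Free graded commutative algebras -/

namespace FreeGCA

/-- Graded commutativity of the generators `x j` of degree `p j`. -/
inductive Rel (K : Type*) [Field K] {J : Type*} (p : J → ℕ) :
    FreeAlgebra K J → FreeAlgebra K J → Prop
  | comm (i j : J) : Rel K p (FreeAlgebra.ι K i * FreeAlgebra.ι K j)
      ((-1 : K) ^ (p i * p j) • (FreeAlgebra.ι K j * FreeAlgebra.ι K i))

end FreeGCA

/-- The free graded commutative algebra on generators indexed by `J`, the generator `j` having
degree `p j` (over a field of characteristic zero odd generators then square to zero). -/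
def FreeGCA (K : Type*) [Field K] {J : Type*} (p : J → ℕ) : Type _ :=
  RingQuot (FreeGCA.Rel K p)

namespace FreeGCA

variable {K : Type*} [Field K] {J : Type*} (p : J → ℕ)

instance : Ring (FreeGCA K p) := inferInstanceAs (Ring (RingQuot (Rel K p)))

instance : Algebra K (FreeGCA K p) := inferInstanceAs (Algebra K (RingQuot (Rel K p)))

variable (K) in
/-- The quotient map from the free algebra. -/
def mk : FreeAlgebra K J →ₐ[K] FreeGCA K p := RingQuot.mkAlgHom K (Rel K p)

/-- The generators. -/
def gen (j : J) : FreeGCA K p :=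
  mk K p (FreeAlgebra.ι K j)

/-- The monomial given by a list of generators. -/
def mon (l : List J) : FreeGCA K p := (l.map (gen p)).prod

/-- The homogeneous part of degree `n`. -/
def homog (n : ℕ) : Submodule K (FreeGCA K p) :=
  Submodule.span K {w | ∃ l : List J, (l.map p).sum = n ∧ w = mon p l}

theorem gen_comm (i j : J) :
    (gen p i * gen p j : FreeGCA K p) = (-1 : K) ^ (p i * p j) • (gen p j * gen p i) := by
  have h : mk K p _ = mk K p _ := RingQuot.mkAlgHom_rel K (Rel.comm (K := K) (p := p) i j)
  simpa only [gen, map_mul, map_smul] using h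

/-- The universal property: extension of a map on generators to an algebra homomorphism. -/
def lift {A : Type*} [Ring A] [Algebra K A] (f : J → A)
    (hf : ∀ i j, f i * f j = (-1 : K) ^ (p i * p j) • (f j * f i)) : FreeGCA K p →ₐ[K] A :=
  RingQuot.liftAlgHom K ⟨FreeAlgebra.lift K f, by
    rintro _ _ ⟨i, j⟩
    simpa using hf i j⟩

@[simp] theorem lift_gen {A : Type*} [Ring A] [Algebra K A] (f : J → A)
    (hf : ∀ i j, f i * f j = (-1 : K) ^ (p i * p j) • (f j * f i)) (j : J) :
    lift p f hf (gen p j) = f j := by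
  exact (RingQuot.liftAlgHom_mkAlgHom_apply K _ _ _).trans (by simp)

theorem hom_ext {A : Type*} [Ring A] [Algebra K A] {f g : FreeGCA K p →ₐ[K] A}
    (h : ∀ j, f (gen p j) = g (gen p j)) : f = g := by
  apply RingQuot.ringQuot_ext'
  apply FreeAlgebra.hom_ext
  funext j
  exact h j

/-- The parity automorphism `w ↦ (-1)^{|w|} w`. -/
def parity : FreeGCA K p →ₐ[K] FreeGCA K p :=
  lift p (fun j => (-1 : K) ^ p j • gen p j) (by
    intro i j
    simp only [smul_mul_smul_comm]
    rw [gen_comm p i j, smul_smul, smul_smul]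
    congr 1
    ring)

@[simp] theorem parity_gen (j : J) :
    parity (K := K) p (gen p j) = (-1 : K) ^ p j • gen p j := by
  simp [parity]

/-- Iterated parity, `w ↦ (-1)^{n |w|} w`. -/
def parityPow (n : ℕ) : FreeGCA K p →ₐ[K] FreeGCA K p :=
  lift p (fun j => (-1 : K) ^ (n * p j) • gen p j) (by
    intro i j
    simp only [smul_mul_smul_comm]
    rw [gen_comm p i j, smul_smul, smul_smul]
    congr 1
    ring)

theorem induction {P : FreeGCA K p → Prop} (halg : ∀ r, P (algebraMap K _ r))
    (hgen : ∀ j, P (gen p j)) (hmul : ∀ a b, P a → P b → P (a * b))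
    (hadd : ∀ a b, P a → P b → P (a + b)) (w : FreeGCA K p) : P w := by
  obtain ⟨v, rfl⟩ : ∃ v, mk K p v = w := RingQuot.mkAlgHom_surjective K (Rel K p) w
  induction v using FreeAlgebra.induction with
  | grade0 r => simpa using halg r
  | grade1 j => exact hgen j
  | mul a b ha hb => rw [map_mul]; exact hmul _ _ ha hb
  | add a b ha hb => rw [map_add]; exact hadd _ _ ha hb

theorem gen_mul (j : J) (w : FreeGCA K p) : gen p j * w = parityPow p (p j) w * gen p j := by
  induction w using induction p with
  | halg r => simp [Algebra.commutes]
  | hgen i => simp [parityPow, gen_comm p j i]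
  | hmul a b ha hb => rw [map_mul, ← mul_assoc, ha, mul_assoc, hb, mul_assoc]
  | hadd a b ha hb => rw [map_add, mul_add, add_mul, ha, hb]

/-- `w` is homogeneous of the parity of `n`. -/
def HasParity (n : ℕ) (w : FreeGCA K p) : Prop := parity p w = (-1 : K) ^ n • w

theorem parityPow_of_hasParity {n : ℕ} {w : FreeGCA K p} (h : HasParity p n w) (m : ℕ) :
    parityPow p m w = (-1 : K) ^ (m * n) • w := by
  induction m with
  | zero =>
    have : parityPow (K := K) p 0 = AlgHom.id K _ := hom_ext p (by intro j; simp [parityPow])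
    simp [this]
  | succ m ih =>
    have : parityPow (K := K) p (m + 1) = (parityPow p m).comp (parity p) :=
      hom_ext p (by
        intro j
        simp only [parityPow, lift_gen, AlgHom.comp_apply, parity_gen, map_smul, smul_smul]
        congr 1
        ring)
    rw [this, AlgHom.comp_apply, h, map_smul, ih, smul_smul]
    congr 1
    ring

theorem HasParity.zero (n : ℕ) : HasParity (K := K) p n 0 := by simp [HasParity]

theorem HasParity.add {n : ℕ} {v w : FreeGCA K p} (hv : HasParity p n v)
    (hw : HasParity p n w) : HasParity p n (v + w) := by
  unfold HasParity at *
  rw [map_add, hv, hw, smul_add]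

theorem HasParity.neg {n : ℕ} {v : FreeGCA K p} (hv : HasParity p n v) :
    HasParity p n (-v) := by
  unfold HasParity at *
  rw [map_neg, hv, smul_neg]

theorem HasParity.smul {n : ℕ} {v : FreeGCA K p} (hv : HasParity p n v) (r : K) :
    HasParity p n (r • v) := by
  unfold HasParity at *
  rw [map_smul, hv, smul_comm]

theorem HasParity.sum {S : Type*} {n : ℕ} (s : Finset S) (f : S → FreeGCA K p)
    (h : ∀ i ∈ s, HasParity p n (f i)) : HasParity p n (∑ i ∈ s, f i) := by
  unfold HasParity at *
  rw [map_sum, Finset.smul_sum]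
  exact Finset.sum_congr rfl h

theorem HasParity.mon (l : List J) : HasParity (K := K) p (l.map p).sum (mon p l) := by
  unfold HasParity FreeGCA.mon
  induction l with
  | nil => simp
  | cons a l ih =>
    simp only [List.map_cons, List.prod_cons, List.sum_cons, map_mul, parity_gen, ih,
      smul_mul_smul_comm, pow_add]

theorem HasParity.gen (j : J) : HasParity (K := K) p (p j) (gen p j) := parity_gen p j

theorem HasParity.congr {n m : ℕ} {w : FreeGCA K p} (h : HasParity p n w)
    (hnm : (-1 : K) ^ n = (-1 : K) ^ m) : HasParity p m w := by
  unfold HasParity at *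
  rw [h, hnm]

/-- The homomorphism `w ↦ (parity w, D w; 0, w)` whose upper right entry is the odd derivation
`D` with prescribed values `q` on the generators. -/
def derAux (q : J → FreeGCA K p) (hq : ∀ j, HasParity p (p j + 1) (q j)) :
    FreeGCA K p →ₐ[K] Matrix (Fin 2) (Fin 2) (FreeGCA K p) :=
  lift p (fun j => !![(-1 : K) ^ p j • gen p j, q j; 0, gen p j]) (by
    intro i j
    have h1 : gen p i * q j = (-1 : K) ^ (p i * (p j + 1)) • (q j * gen p i) := by
      rw [gen_mul, parityPow_of_hasParity p (hq j), smul_mul_assoc]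
    have h2 : gen p j * q i = (-1 : K) ^ (p j * (p i + 1)) • (q i * gen p j) := by
      rw [gen_mul, parityPow_of_hasParity p (hq i), smul_mul_assoc]
    have e : ∀ n : ℕ, (-1 : K) ^ (n * 2) = 1 := fun n => by rw [mul_comm, pow_mul]; simp
    have e' : (-1 : K) ^ (p i * p j) * ((-1) ^ p j * (-1) ^ (p j * (p i + 1))) = 1 := by
      rw [← pow_add, ← pow_add]
      have : p i * p j + (p j + p j * (p i + 1)) = (p i * p j + p j) * 2 := by ring
      rw [this, e]
    have e'' : (-1 : K) ^ p i * (-1) ^ (p i * (p j + 1)) = (-1) ^ (p i * p j) := by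
      rw [← pow_add]
      have : p i + p i * (p j + 1) = p i * p j + p i * 2 := by ring
      rw [this, pow_add, e, mul_one]
    ext a b
    fin_cases a <;> fin_cases b
    · simp only [Matrix.mul_fin_two, Matrix.smul_apply]
      simp only [smul_mul_smul_comm, mul_zero, add_zero, gen_comm p i j, smul_smul,
        Matrix.of_apply, Matrix.cons_val', Matrix.cons_val_zero, Fin.zero_eta]
      congr 1
      ring
    · simp only [Matrix.mul_fin_two, Matrix.smul_apply]
      simp only [smul_mul_assoc, h1, h2, smul_smul, smul_add, e', e'', one_smul,
        Matrix.of_apply, Matrix.cons_val', Matrix.cons_val_zero, Matrix.cons_val_one,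
        Fin.zero_eta, Fin.mk_one]
      exact add_comm _ _
    · simp
    · simp [gen_comm p i j])

/-- The odd derivation `D` of the free graded commutative algebra with `D (gen j) = q j`, where
`q j` has parity opposite to `gen j`. -/
def der (q : J → FreeGCA K p) (hq : ∀ j, HasParity p (p j + 1) (q j)) :
    FreeGCA K p →ₗ[K] FreeGCA K p where
  toFun w := derAux p q hq w 0 1
  map_add' v w := by simp
  map_smul' r w := by simp

@[simp] theorem der_gen (q : J → FreeGCA K p) (hq : ∀ j, HasParity p (p j + 1) (q j)) (j : J) :
    der p q hq (gen p j) = q j := by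
  simp [der, derAux]

theorem derAux_diag (q : J → FreeGCA K p) (hq : ∀ j, HasParity p (p j + 1) (q j))
    (w : FreeGCA K p) :
    derAux p q hq w 0 0 = parity p w ∧ derAux p q hq w 1 0 = 0 ∧ derAux p q hq w 1 1 = w := by
  induction w using induction p with
  | halg r => simp [Matrix.algebraMap_matrix_apply]
  | hgen j => simp [derAux]
  | hmul a b ha hb =>
    simp [Matrix.mul_apply, Fin.sum_univ_two, ha.1, ha.2.1, ha.2.2, hb.1, hb.2.1, hb.2.2]
  | hadd a b ha hb => simp [ha.1, ha.2.1, ha.2.2, hb.1, hb.2.1, hb.2.2]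

/-- The graded Leibniz rule. -/
theorem der_mul (q : J → FreeGCA K p) (hq : ∀ j, HasParity p (p j + 1) (q j))
    (v w : FreeGCA K p) :
    der p q hq (v * w) = der p q hq v * w + parity p v * der p q hq w := by
  change derAux p q hq (v * w) 0 1 = derAux p q hq v 0 1 * w + _ * derAux p q hq w 0 1
  rw [map_mul, Matrix.mul_apply, Fin.sum_univ_two, (derAux_diag p q hq v).1,
    (derAux_diag p q hq w).2.2, add_comm]

/-- An odd derivation sends `v` of parity `n` to an element of parity `n + 1`. -/
theorem HasParity.der (q : J → FreeGCA K p) (hq : ∀ j, HasParity p (p j + 1) (q j)) {n : ℕ}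
    {v : FreeGCA K p} (hv : HasParity p n v) : HasParity p (n + 1) (der p q hq v) := by
  have key : ∀ w : FreeGCA K p, parity p (FreeGCA.der p q hq w) =
      -FreeGCA.der p q hq (parity p w) := by
    have hone : ∀ r : K, FreeGCA.der p q hq (algebraMap K _ r) = 0 := by
      intro r
      change derAux p q hq (algebraMap K _ r) 0 1 = 0
      rw [AlgHom.commutes, Matrix.algebraMap_matrix_apply]
      simp
    intro w
    induction w using induction p with
    | halg r => rw [hone, map_zero, AlgHom.commutes, hone, neg_zero]
    | hgen j =>
      rw [der_gen, hq j, parity_gen, map_smul, der_gen, pow_succ, ← neg_smul]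
      congr 1
      ring
    | hmul a b ha hb =>
      rw [der_mul, map_add, map_mul, map_mul, map_mul, der_mul, ha, hb]
      simp only [neg_mul, mul_neg, neg_add]
    | hadd a b ha hb => simp only [map_add, ha, hb, neg_add]
  unfold HasParity at *
  rw [key, hv, map_smul, pow_succ, ← neg_smul]
  congr 1
  ring

/-- `D` is a differential turning the free graded commutative algebra into a differential graded
commutative algebra: a derivation of degree one which squares to zero. -/
structure IsDifferential (D : FreeGCA K p →ₗ[K] FreeGCA K p) : Prop where
  degree : ∀ n, ∀ v ∈ homog p n, D v ∈ homog (K := K) p (n + 1)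
  leibniz : ∀ n, ∀ v ∈ homog p n, ∀ w, D (v * w) = D v * w + (-1 : K) ^ n • (v * D w)
  square : ∀ v, D (D v) = 0

end FreeGCA

/-! ### Differential graded Lie algebras and their hLie- and L∞-brackets -/

/-- A differential graded Lie algebra structure (differential of degree one) on the graded vector
space `G = ⨁ k, gr k`. -/
structure DGLie (K : Type*) [Field K] {G : Type*} [AddCommGroup G] [Module K G]
    (gr : ℤ → Submodule K G) where
  d : G →ₗ[K] G
  br : G →ₗ[K] G →ₗ[K] G
  d_mem : ∀ k, ∀ x ∈ gr k, d x ∈ gr (k + 1)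
  br_mem : ∀ i j, ∀ x ∈ gr i, ∀ y ∈ gr j, br x y ∈ gr (i + j)
  d_d : ∀ x, d (d x) = 0
  antisymm : ∀ i j, ∀ x ∈ gr i, ∀ y ∈ gr j, br x y = -((-1 : K) ^ (i * j) • br y x)
  jacobi : ∀ i j, ∀ x ∈ gr i, ∀ y ∈ gr j, ∀ z,
    br x (br y z) = br (br x y) z + (-1 : K) ^ (i * j) • br y (br x z)
  d_br : ∀ i, ∀ x ∈ gr i, ∀ y, d (br x y) = br (d x) y + (-1 : K) ^ i • br x (d y)

namespace DGLie

variable {K : Type*} [Field K] {G : Type*} [AddCommGroup G] [Module K G]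
  {gr : ℤ → Submodule K G} [DirectSum.Decomposition gr] (L : DGLie K gr)

/-- The linear endomorphism multiplying the component of degree `k` by the scalar `c k`. -/
def scale (gr : ℤ → Submodule K G) [DirectSum.Decomposition gr] (c : ℤ → K) : G →ₗ[K] G :=
  (DirectSum.toModule K ℤ G fun k => c k • (gr k).subtype) ∘ₗ
    (DirectSum.decomposeLinearEquiv gr).toLinearMap

/-- The restriction `δ` of the differential to degree `-1` (zero on all other degrees). -/
def delta : G →ₗ[K] G := L.d ∘ₗ scale gr fun k => if k = -1 then 1 else 0

/-! The graded vector space `E = ⨁_{k ≤ 0} E_k` with `E_k = gr (k - 1)` carries the following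
operations of an hLie-algebra.  They are written as operations on all of `G`, but only their values
on `E`, the part of `G` of negative degree, are used.  An element of `gr k` has `E`-degree
`k + 1`. -/

/-- `ε₁ x = d x` if `x` has negative `E`-degree, and `0` otherwise. -/
def eps1 : G →ₗ[K] G := L.d ∘ₗ scale gr fun k => if k + 1 < 0 then 1 else 0

/-- The binary product `ε₂⁰(x, y) = {δ x, y}`. -/
def eps20 : G →ₗ[K] G →ₗ[K] G := L.br ∘ₗ L.delta

/-- The alternator `ε₂¹(x, y) = (-1)^{|x|_E} {x, y}`. -/
def alternator : G →ₗ[K] G →ₗ[K] G := L.br ∘ₗ scale gr fun k => (-1) ^ (k + 1)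

/-- The nested product `ε₂¹(… ε₂¹(ε₂¹(ε₂⁰(x₁, x₂), x₃), x₄) …, xₙ)`. -/
def nested : List G → G
  | x :: y :: l => l.foldl (fun u v => L.alternator u v) (L.eps20 x y)
  | _ => 0

/-- The antisymmetric Koszul sign `χ(σ; x)` for elements `x j` of degree `e j`, defined by
`x₁ ∧ … ∧ xₙ = χ(σ; x) x_{σ(1)} ∧ … ∧ x_{σ(n)}` in the graded exterior algebra. -/
def chi {n : ℕ} (σ : Equiv.Perm (Fin n)) (e : Fin n → ℤ) : K :=
  ((Equiv.Perm.sign σ : ℤ) : K) *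
    ∏ i : Fin n, ∏ j : Fin n, if i < j ∧ σ j < σ i then (-1 : K) ^ (e (σ i) * e (σ j)) else 1

/-- The `n`-ary bracket `μₙ` of the L∞-algebra on `E` obtained by antisymmetrization, evaluated on
`x j ∈ E` of `E`-degree `e j`: `μ₁ = ε₁`, and for `n ≥ 2` the bracket `μₙ(x₁, …, xₙ)` is
`(-1)^{n-1} B_{n-1} / (n-1)! ∑_σ χ(σ; x) ε₂¹(… ε₂¹(ε₂⁰(x_{σ(1)}, x_{σ(2)}), x_{σ(3)}) …, x_{σ(n)})`
with the Bernoulli numbers `B₁ = -1/2, B₂ = 1/6, …`. -/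
def mu : (n : ℕ) → (Fin n → ℤ) → (Fin n → G) → G
  | 0, _, _ => 0
  | 1, _, x => L.eps1 (x 0)
  | n + 2, e, x =>
      ((-1 : K) ^ (n + 1) * ((bernoulli (n + 1) : ℚ) : K) / ((n + 1).factorial : K)) •
        ∑ σ : Equiv.Perm (Fin (n + 2)), (chi σ e : K) • L.nested (List.ofFn fun j => x (σ j))

/-- The L∞-algebra on `E` has at most ternary brackets. -/
def AtMostTernary : Prop :=
  ∀ n, 4 ≤ n → ∀ (e : Fin n → ℤ) (x : Fin n → G),
    (∀ j, e j ≤ 0 ∧ x j ∈ gr (e j - 1)) → L.mu n e x = 0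

/-! ### The Weil algebra

Fix bases of the degree-wise finite-dimensional spaces `gr (-(n + 1)) = E_{-n}`.  The basis vectors
`τ_α` of `E` are indexed by the sigma type `α ∈ Σ n, ι n`, and `Sum.inl α`, `Sum.inr α` stand for
the generators `t^α ∈ E[1]^*` and `t̂^α ∈ E[2]^*`. -/

variable {ι : ℕ → Type*} [∀ n, Fintype (ι n)]
  (b : ∀ n : ℕ, Module.Basis (ι n) K (gr (-((n : ℤ) + 1))))

/-- The degree `|α| ≥ 1` of the generator `t^α`; the basis vector `τ_α` has degree `-|α|` in `G`
and `1 - |α|` in `E`. -/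
def deg (α : Σ n, ι n) : ℕ := α.1 + 1

/-- The degrees of the generators of the Weil algebra. -/
def wdeg : (Σ n, ι n) ⊕ (Σ n, ι n) → ℕ :=
  Sum.elim (fun α => deg α) (fun α => deg α + 1)

variable (K ι) in
/-- The graded commutative algebra `⊙(E[1]^* ⊕ E[2]^*)` underlying the Weil algebra. -/
abbrev Weil : Type _ := FreeGCA K (wdeg (ι := ι))

variable (K) in
/-- The generator `t^α`. -/
def t (α : Σ n, ι n) : Weil K ι := FreeGCA.gen wdeg (Sum.inl α)

variable (K) in
/-- The generator `t̂^α`. -/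
def tHat (α : Σ n, ι n) : Weil K ι := FreeGCA.gen wdeg (Sum.inr α)

/-- The basis vector `τ_α`. -/
def tau (α : Σ n, ι n) : G := (b α.1 α.2 : G)

/-- The coefficient of `τ_α` in `x`. -/
def coef (α : Σ n, ι n) (x : G) : K :=
  (b α.1).repr (DirectSum.decompose gr x (-((α.1 : ℤ) + 1))) α.2

/-- The structure constant `m^α_{β₁ … β_k}` of `μ_k`. -/
def structConst (α : Σ n, ι n) {k : ℕ} (β : Fin k → Σ n, ι n) : K :=
  coef b α (L.mu k (fun j => 1 - (deg (β j) : ℤ)) fun j => tau b (β j))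

/-- The basis elements of degree at most `N`, as a finite set. -/
def upTo (ι : ℕ → Type*) [∀ n, Fintype (ι n)] (N : ℕ) : Finset (Σ n, ι n) :=
  (Finset.range N).sigma fun _ => Finset.univ

open Classical in
/-- The index tuples with `|β₁| + ⋯ + |β_k| = |α| + 1`; for degree reasons all other structure
constants `m^α_{β₁ … β_k}` vanish. -/
def tuples (α : Σ n, ι n) (k : ℕ) : Finset (Fin k → Σ n, ι n) :=
  (Fintype.piFinset fun _ : Fin k => upTo ι (deg α + 1)).filter
    fun β => ∑ j, deg (β j) = deg α + 1

/-- The sign exponent in `μ_k(t^{β₁} τ_{β₁}, …, t^{β_k} τ_{β_k}) = ± m^α_β t^{β₁} ⋯ t^{β_k} τ_α`: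
moving all `t`'s to the left gives `k ∑ |β_j| + ∑_{j < l} |β_l| (|β_j| - 1)`. -/
def signExp {k : ℕ} (β : Fin k → Σ n, ι n) : ℕ :=
  k * ∑ j, deg (β j) + ∑ l, ∑ j, if j < l then deg (β l) * (deg (β j) - 1) else 0

/-- The Chevalley–Eilenberg differential of the L∞-algebra on the generators,
`Q_CE t^α = - ∑_{k ≥ 1} 1/k! ∑_β ± m^α_{β₁ … β_k} t^{β₁} ⋯ t^{β_k}`.  Since all generators have
degree at least one, only `k ≤ |α| + 1` contributes. -/
def ceGen (α : Σ n, ι n) : Weil K ι :=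
  -∑ k ∈ Finset.Icc 1 (deg α + 1), ∑ β ∈ tuples α k,
    ((1 / (k.factorial : K)) * (-1) ^ signExp β * L.structConst b α β) •
      FreeGCA.mon wdeg (List.ofFn fun j => Sum.inl (β j))

theorem hasParity_ceGen (α : Σ n, ι n) :
    FreeGCA.HasParity wdeg (deg α + 1) (L.ceGen b α) := by
  refine FreeGCA.HasParity.neg _ (FreeGCA.HasParity.sum _ _ _ fun k _ =>
    FreeGCA.HasParity.sum _ _ _ fun β hβ => FreeGCA.HasParity.smul _ ?_ _)
  have h := (Finset.mem_filter.mp hβ).2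
  have h2 := FreeGCA.HasParity.mon (K := K) wdeg
    (List.ofFn fun j => (Sum.inl (β j) : (Σ n, ι n) ⊕ (Σ n, ι n)))
  rwa [List.map_ofFn, List.sum_ofFn,
    show (∑ i, (wdeg ∘ fun j => (Sum.inl (β j) : (Σ n, ι n) ⊕ (Σ n, ι n))) i) = deg α + 1 from h]
    at h2

variable (K ι) in
/-- The shift derivation `σ` with `σ t^α = t̂^α` and `σ t̂^α = 0`. -/
def shift : Weil K ι →ₗ[K] Weil K ι :=
  FreeGCA.der wdeg (Sum.elim (fun α => tHat K α) fun _ => 0) (by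
    rintro (α | α)
    · exact FreeGCA.HasParity.gen wdeg (Sum.inr α)
    · exact FreeGCA.HasParity.zero _ _)

/-- The Weil differential: the derivation `Q_W` with `Q_W t^α = Q_CE t^α + t̂^α` and
`Q_W t̂^α = -σ (Q_CE t^α)`. -/
def weilDiff : Weil K ι →ₗ[K] Weil K ι :=
  FreeGCA.der wdeg
    (Sum.elim (fun α => L.ceGen b α + tHat K α) fun α => -shift K ι (L.ceGen b α)) (by
    rintro (α | α)
    · exact FreeGCA.HasParity.add _ (L.hasParity_ceGen b α)
        (FreeGCA.HasParity.gen wdeg (Sum.inr α))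
    · exact FreeGCA.HasParity.neg _ (FreeGCA.HasParity.der _ _ _ (L.hasParity_ceGen b α)))

/-! ### Firm adjustment -/

/-- A coordinate change of the Weil algebra: an algebra automorphism fixing the `t^α` and sending
`t̂^α` to `t̂^α` plus a polynomial of degree `|α| + 1` all of whose monomials contain at least one
generator `t̂^β`. -/
structure IsCoordinateChange (Φ : Weil K ι ≃ₐ[K] Weil K ι) : Prop where
  map_t : ∀ α, Φ (t K α) = t K α
  map_tHat : ∀ α, Φ (tHat K α) - tHat K α ∈ Submodule.span K
    {w | ∃ l : List ((Σ n, ι n) ⊕ (Σ n, ι n)), (l.map wdeg).sum = deg α + 1 ∧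
      (∃ β, Sum.inr β ∈ l) ∧ w = FreeGCA.mon wdeg l}

/-- The differential `Q` expressed in the new coordinates `(t^α, t̂'^α)`, where `t̂'^α = Φ(t̂^α)`:
if `Q t̂'^α` is a polynomial in the `t^β` and `t̂'^β`, then `transport Q Φ` sends `t̂^α` to the same
polynomial in the `t^β` and `t̂^β`. -/
def transport (Q : Weil K ι →ₗ[K] Weil K ι) (Φ : Weil K ι ≃ₐ[K] Weil K ι) :
    Weil K ι →ₗ[K] Weil K ι :=
  Φ.symm.toLinearMap ∘ₗ Q ∘ₗ Φ.toLinearMap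

/-- A differential on `⊙(E[1]^* ⊕ E[2]^*)` is firm if the monomials in the image of each generator
`t̂^α` contain at most one generator of `E[1]^*`, and only one of degree one. -/
def IsFirm (Q : Weil K ι →ₗ[K] Weil K ι) : Prop :=
  ∀ α, Q (tHat K α) ∈ Submodule.span K
    {w | ∃ l : List ((Σ n, ι n) ⊕ (Σ n, ι n)), (l.filter Sum.isLeft).length ≤ 1 ∧
      (∀ β, Sum.inl β ∈ l → deg β = 1) ∧ w = FreeGCA.mon wdeg l}

/-- `(⊙(E[1]^* ⊕ E[2]^*), Q')` is a firmly adjusted Weil algebra of the L∞-algebra `E`, obtained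
from the Weil algebra by the coordinate change `Φ`. -/
structure IsFirmlyAdjusted (Q' : Weil K ι →ₗ[K] Weil K ι) (Φ : Weil K ι ≃ₐ[K] Weil K ι) :
    Prop where
  coordinateChange : IsCoordinateChange Φ
  eq_transport : Q' = transport (L.weilDiff b) Φ
  isDifferential : FreeGCA.IsDifferential wdeg Q'
  firm : IsFirm Q'

/-- The adjustment data `s^α_{βγ} = 1/2 (-1)^{|β|(|γ|+1)} n^α_{βγ}`, where `n^α_{βγ}` are the
structure constants of the alternator, `ε₂¹(τ_β, τ_γ) = n^α_{βγ} τ_α`. -/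
def adjData (α β γ : Σ n, ι n) : K :=
  1 / 2 * (-1) ^ (deg β * (deg γ + 1)) * coef b α (L.alternator (tau b β) (tau b γ))

/-- The operator `X^α ↦ ∑_{β,γ} s^α_{βγ} X^β t^γ`; the `s^α_{βγ}` vanish for `|β| + |γ| ≠ |α|`,
so the sum is finite. -/
def adjOp (X : (Σ n, ι n) → Weil K ι) (α : Σ n, ι n) : Weil K ι :=
  ∑ β ∈ upTo ι (deg α), ∑ γ ∈ upTo ι (deg α), L.adjData b α β γ • (X β * t K γ)

end DGLie

end

noncomputable section

open Finset.HasAntidiagonal (antidiagonal mem_antidiagonal)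
open scoped TensorProduct

set_option linter.unusedSectionVars false

namespace FreeGCA

variable {K : Type*} [Field K] {J : Type*} (p : J → ℕ)

/-! ### Graded commutativity and derivations -/

/-! Let W be the Weil algebra. The bracket of G extends to a Lie superalgebra W ⊗ G with an odd
differential d, and every odd derivation Q of W acts on W ⊗ G by an odd derivation anticommuting
with d. Let T = ∑ t^α ⊗ τ_α be the universal element, δT the image under d of its part of degree -1,
A = -[-, T], and D = d + uQ. The formal variable u records degrees: the part of T of degree -n in G
is placed in order n.

Two computations carry the proof. (1) The Koszul signs make all permutations contribute equally to
Q_CE, and each alternator becomes a bracket with T. The Bernoulli coefficients then add up to the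
series x/(e^x - 1) (`sum_structConst`, `sum_nestedTau`, `ceGen_eq`). Hence Q t = Q_CE t + s gives DT
= A/(e^A - 1) δT + u s (`totalDiff_tSeq`). (2) The connection Θ = ((e^A - 1)/A) DT is the pure gauge
connection generated by T. Its curvature DΘ - ½[Θ, Θ] is ((e^A - 1)/A) D²T (`curvature_succ`,
`curvature_act`), and D²T = u²Q²T.

The two series are mutually inverse, so Θ = δT + u ((e^A - 1)/A) s.

For s = 0, Θ = δT is flat by a direct check. Therefore Q_CE² = 0 on the t^α (`der_ceGen_eq_zero`),
and Q_W² = 0 follows by splitting Q_W into Q_CE and σ.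

For s = t̂, the identity A = 2S (`toSeq_adjLin`) shows that Θ = δT + u t̂', where t̂' = ((e^{2S} -
1)/(2S)) t̂ is exactly the coordinate change; the inverse series inverts it. Flatness DΘ = ½[Θ, Θ]
now expresses Q t̂' through d t̂', [δT, t̂'] and [t̂', t̂']. The only t's left are those in δT, of
degree one and occurring at most once per monomial; [δT, δT] lies in too low an order to contribute.
This is firmness (`weilDiff_adjEquiv_tHat_mem`). If nested alternators vanish then S² = 0, and only
the linear term in S survives. -/

theorem HasParity.mul_comm_parityPow {m : ℕ} {w : FreeGCA K p} (hw : HasParity p m w)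
    (v : FreeGCA K p) : v * w = w * parityPow p m v := by
  induction v using induction p with
  | halg r => rw [AlgHom.commutes, Algebra.commutes]
  | hgen j =>
    rw [gen_mul, parityPow_of_hasParity p hw, smul_mul_assoc, parityPow, lift_gen, mul_smul_comm,
      mul_comm m]
  | hmul a b ha hb => rw [mul_assoc, hb, ← mul_assoc, ha, mul_assoc, map_mul]
  | hadd a b ha hb => rw [add_mul, ha, hb, map_add, mul_add]

/-- Graded commutativity of homogeneous elements. -/
theorem HasParity.mul_comm {n m : ℕ} {v w : FreeGCA K p} (hv : HasParity p n v)
    (hw : HasParity p m w) : v * w = (-1 : K) ^ (n * m) • (w * v) := by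
  rw [hw.mul_comm_parityPow, parityPow_of_hasParity p hv, mul_smul_comm, Nat.mul_comm]

theorem HasParity.mul {n m : ℕ} {v w : FreeGCA K p} (hv : HasParity p n v)
    (hw : HasParity p m w) : HasParity p (n + m) (v * w) := by
  unfold HasParity at *
  rw [map_mul, hv, hw, smul_mul_smul_comm, pow_add]

@[simp] theorem parity_parity (w : FreeGCA K p) : parity p (parity p w) = w := by
  have : (parity (K := K) p).comp (parity p) = AlgHom.id K _ := hom_ext p (by
    intro j
    simp [smul_smul, ← mul_pow])
  exact DFunLike.congr_fun this w

section der

variable (q : J → FreeGCA K p) (hq : ∀ j, HasParity p (p j + 1) (q j))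

@[simp] theorem der_algebraMap (r : K) : der p q hq (algebraMap K _ r) = 0 := by
  change derAux p q hq (algebraMap K _ r) 0 1 = 0
  rw [AlgHom.commutes, Matrix.algebraMap_matrix_apply]
  simp

theorem parity_der (w : FreeGCA K p) : parity p (der p q hq w) = -der p q hq (parity p w) := by
  induction w using induction p with
  | halg r => rw [der_algebraMap, map_zero, AlgHom.commutes, der_algebraMap, neg_zero]
  | hgen j =>
    rw [der_gen, hq j, parity_gen, map_smul, der_gen, pow_succ, ← neg_smul]
    congr 1
    ring
  | hmul a b ha hb =>
    rw [der_mul, map_add, map_mul, map_mul, map_mul, der_mul, ha, hb]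
    simp only [neg_mul, mul_neg, neg_add]
  | hadd a b ha hb => simp only [map_add, ha, hb, neg_add]

/-- The anticommutator of two odd derivations vanishes if it vanishes on the generators. -/
theorem der_der_add_eq_zero (q' : J → FreeGCA K p) (hq' : ∀ j, HasParity p (p j + 1) (q' j))
    (h : ∀ j, der p q hq (q' j) + der p q' hq' (q j) = 0) (w : FreeGCA K p) :
    der p q hq (der p q' hq' w) + der p q' hq' (der p q hq w) = 0 := by
  induction w using induction p with
  | halg r => simp
  | hgen j => simpa using h j
  | hmul a b ha hb =>
    -- The anticommutator of two odd derivations is an even derivation: the mixed terms cancel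
    -- because each derivation anticommutes with the parity automorphism.
    have h1 := eq_neg_of_add_eq_zero_left ha
    have h2 := eq_neg_of_add_eq_zero_left hb
    simp only [der_mul, map_add, parity_der, neg_mul, parity_parity, h1, h2, mul_neg]
    abel
  | hadd a b ha hb =>
    simp only [map_add]
    rw [add_add_add_comm, ha, hb, add_zero]

/-- The anticommutator of D with itself is 2D², and 2 is invertible. -/
theorem der_der_eq_zero [CharZero K] (h : ∀ j, der p q hq (q j) = 0) (w : FreeGCA K p) :
    der p q hq (der p q hq w) = 0 := by
  have := der_der_add_eq_zero p q hq q hq (fun j => by rw [h, add_zero]) w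
  rw [← two_smul K] at this
  exact (smul_eq_zero.mp this).resolve_left two_ne_zero

end der

/-! ### Homogeneous components -/

theorem mon_append (l l' : List J) : (mon p (l ++ l') : FreeGCA K p) = mon p l * mon p l' := by
  simp [mon]

theorem mon_mem_homog (l : List J) : (mon p l : FreeGCA K p) ∈ homog p (l.map p).sum :=
  Submodule.subset_span ⟨l, rfl, rfl⟩

theorem gen_mem_homog (j : J) : (gen p j : FreeGCA K p) ∈ homog p (p j) := by
  simpa [mon] using mon_mem_homog (K := K) p [j]

theorem one_mem_homog : (1 : FreeGCA K p) ∈ homog p 0 := by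
  simpa [mon] using mon_mem_homog (K := K) p []

theorem mul_mem_homog {m n : ℕ} {v w : FreeGCA K p} (hv : v ∈ homog p m) (hw : w ∈ homog p n) :
    v * w ∈ homog p (m + n) := by
  refine Submodule.span_induction₂ (p := fun v w _ _ => v * w ∈ homog p (m + n)) ?_ ?_ ?_ ?_ ?_
    ?_ ?_ hv hw
  · rintro _ _ ⟨l, rfl, rfl⟩ ⟨l', rfl, rfl⟩
    rw [← mon_append, ← List.sum_append, ← List.map_append]
    exact mon_mem_homog p _
  · intro y _; simp
  · intro y _; simp
  · intro x y z _ _ _ hx hy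
    rw [add_mul]; exact add_mem hx hy
  · intro x y z _ _ _ hx hy
    rw [mul_add]; exact add_mem hx hy
  · intro r x y _ _ h
    rw [smul_mul_assoc]; exact Submodule.smul_mem _ _ h
  · intro r x y _ _ h
    rw [mul_smul_comm]; exact Submodule.smul_mem _ _ h

theorem hasParity_of_mem_homog {n : ℕ} {v : FreeGCA K p} (hv : v ∈ homog p n) :
    HasParity p n v := by
  induction hv using Submodule.span_induction with
  | mem v h => obtain ⟨l, rfl, rfl⟩ := h; exact HasParity.mon p l
  | zero => exact HasParity.zero p n
  | add v w _ _ hv hw => exact hv.add p hw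
  | smul r v _ hv => exact hv.smul p r

theorem algHom_mem_homog (φ : FreeGCA K p →ₐ[K] FreeGCA K p)
    (h : ∀ j, φ (gen p j) ∈ homog p (p j)) {n : ℕ} {v : FreeGCA K p} (hv : v ∈ homog p n) :
    φ v ∈ homog p n := by
  induction hv using Submodule.span_induction with
  | mem v hv =>
    obtain ⟨l, rfl, rfl⟩ := hv
    induction l with
    | nil => simpa [mon] using one_mem_homog (K := K) p
    | cons j l ih => simpa [mon] using mul_mem_homog p (h j) ih
  | zero => simp
  | add v w _ _ hv hw => rw [map_add]; exact add_mem hv hw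
  | smul r v _ hv => rw [map_smul]; exact Submodule.smul_mem _ _ hv

theorem der_mem_homog (q : J → FreeGCA K p) (hq : ∀ j, HasParity p (p j + 1) (q j))
    (h : ∀ j, q j ∈ homog p (p j + 1)) {n : ℕ} {v : FreeGCA K p} (hv : v ∈ homog p n) :
    der p q hq v ∈ homog p (n + 1) := by
  induction hv using Submodule.span_induction with
  | mem v hv =>
    obtain ⟨l, rfl, rfl⟩ := hv
    induction l with
    | nil =>
      have : der p q hq (1 : FreeGCA K p) = 0 := by
        simpa using der_algebraMap p q hq 1
      simp [mon, this]
    | cons j l ih =>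
      simp only [List.map_cons, List.sum_cons, mon, List.prod_cons] at ih ⊢
      rw [der_mul, der_gen, parity_gen, smul_mul_assoc]
      refine add_mem ?_ (Submodule.smul_mem _ _ ?_)
      · rw [add_right_comm]
        exact mul_mem_homog p (h j) (mon_mem_homog p l)
      · rw [add_assoc]
        exact mul_mem_homog p (gen_mem_homog p j) ih
  | zero => simp
  | add v w _ _ hv hw => rw [map_add]; exact add_mem hv hw
  | smul r v _ hv => rw [map_smul]; exact Submodule.smul_mem _ _ hv

theorem isDifferential_der [CharZero K] (q : J → FreeGCA K p)
    (hq : ∀ j, HasParity p (p j + 1) (q j)) (h : ∀ j, q j ∈ homog p (p j + 1))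
    (h2 : ∀ j, der p q hq (q j) = 0) : IsDifferential p (der p q hq) where
  degree n v hv := der_mem_homog p q hq h hv
  leibniz n v hv w := by
    rw [der_mul, hasParity_of_mem_homog p hv, smul_mul_assoc]
  square := der_der_eq_zero p q hq h2

/-- Conjugation of a differential with a degree-preserving automorphism. -/
theorem IsDifferential.conj {D : FreeGCA K p →ₗ[K] FreeGCA K p} (hD : IsDifferential p D)
    (Φ : FreeGCA K p ≃ₐ[K] FreeGCA K p) (h : ∀ j, Φ (gen p j) ∈ homog p (p j))
    (h' : ∀ j, Φ.symm (gen p j) ∈ homog p (p j)) :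
    IsDifferential p (Φ.symm.toLinearMap ∘ₗ D ∘ₗ Φ.toLinearMap) where
  degree n v hv := algHom_mem_homog p Φ.symm.toAlgHom h'
    (hD.degree n _ (algHom_mem_homog p Φ.toAlgHom h hv))
  leibniz n v hv w := by
    have := hD.leibniz n _ (algHom_mem_homog p Φ.toAlgHom h hv) (Φ w)
    simp only [LinearMap.comp_apply, AlgEquiv.toLinearMap_apply, map_mul]
    erw [this]
    simp
  square v := by simp [hD.square]

end FreeGCA

/-! ### Values of the operations on homogeneous elements -/

namespace DGLie

variable {K : Type*} [Field K] {G : Type*} [AddCommGroup G] [Module K G]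
  {gr : ℤ → Submodule K G} [DirectSum.Decomposition gr] (L : DGLie K gr)

theorem scale_apply (c : ℤ → K) {k : ℤ} {x : G} (hx : x ∈ gr k) : scale gr c x = c k • x := by
  rw [scale, LinearMap.comp_apply, LinearEquiv.coe_coe, DirectSum.decomposeLinearEquiv_apply,
    DirectSum.decompose_of_mem gr hx]
  exact DirectSum.toModule_lof K (φ := fun k => c k • (gr k).subtype) k (⟨x, hx⟩ : gr k)

theorem delta_apply {k : ℤ} {x : G} (hx : x ∈ gr k) :
    L.delta x = if k = -1 then L.d x else 0 := by
  rw [delta, LinearMap.comp_apply, scale_apply _ hx]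
  split_ifs <;> simp

theorem eps1_apply {k : ℤ} {x : G} (hx : x ∈ gr k) :
    L.eps1 x = if k + 1 < 0 then L.d x else 0 := by
  rw [eps1, LinearMap.comp_apply, scale_apply _ hx]
  split_ifs <;> simp

theorem alternator_apply {k : ℤ} {x : G} (hx : x ∈ gr k) (y : G) :
    L.alternator x y = (-1 : K) ^ (k + 1) • L.br x y := by
  rw [alternator, LinearMap.comp_apply, scale_apply _ hx, map_smul, LinearMap.smul_apply]

variable {J : Type*} (p : J → ℕ)

/-! ### The Lie superalgebra with coefficients in a free graded commutative algebra -/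

/-- The graded Lie bracket `[a ⊗ x, b ⊗ y] = (-1)^{|x| |b|} a b ⊗ {x, y}`. -/
def tbr : (FreeGCA K p ⊗[K] G) →ₗ[K] (FreeGCA K p ⊗[K] G) →ₗ[K] (FreeGCA K p ⊗[K] G) :=
  -- The sign depends on |x| only modulo two. Splitting x into its even and odd parts gives a
  -- definition without homogeneity assumptions; the odd part twists b by the parity automorphism.
  TensorProduct.map₂ (LinearMap.mul K (FreeGCA K p))
      (L.br ∘ₗ scale gr fun k => if Even k then 1 else 0) +
    TensorProduct.map₂ ((LinearMap.mul K (FreeGCA K p)).compl₂ (FreeGCA.parity p).toLinearMap)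
      (L.br ∘ₗ scale gr fun k => if Even k then 0 else 1)

/-- The differential `a ⊗ x ↦ (-1)^{|a|} a ⊗ d x`. -/
def td : (FreeGCA K p ⊗[K] G) →ₗ[K] (FreeGCA K p ⊗[K] G) :=
  TensorProduct.map (FreeGCA.parity p).toLinearMap L.d

/-- The span of the elements `a ⊗ x` of total degree congruent to `r` modulo two. -/
def par (gr : ℤ → Submodule K G) (r : ℤ) : Submodule K (FreeGCA K p ⊗[K] G) :=
  Submodule.span K {X | ∃ (m : ℕ) (k : ℤ) (a : FreeGCA K p) (x : G),
    FreeGCA.HasParity p m a ∧ x ∈ gr k ∧ Even ((m : ℤ) + k - r) ∧ X = a ⊗ₜ x}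

theorem tmul_mem_par {m : ℕ} {k r : ℤ} {a : FreeGCA K p} {x : G}
    (ha : FreeGCA.HasParity p m a) (hx : x ∈ gr k) (h : Even ((m : ℤ) + k - r)) :
    a ⊗ₜ[K] x ∈ par p gr r :=
  Submodule.subset_span ⟨m, k, a, x, ha, hx, h, rfl⟩

@[elab_as_elim]
theorem par_induction {r : ℤ} {P : FreeGCA K p ⊗[K] G → Prop}
    (h : ∀ (m : ℕ) (k : ℤ) (a : FreeGCA K p) (x : G), FreeGCA.HasParity p m a → x ∈ gr k →
      Even ((m : ℤ) + k - r) → P (a ⊗ₜ x)) (h0 : P 0) (hadd : ∀ X Y, P X → P Y → P (X + Y))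
    (hsmul : ∀ (c : K) X, P X → P (c • X)) {X : FreeGCA K p ⊗[K] G} (hX : X ∈ par p gr r) :
    P X := by
  induction hX using Submodule.span_induction with
  | mem X hX =>
    obtain ⟨m, k, a, x, ha, hx, hm, rfl⟩ := hX
    exact h m k a x ha hx hm
  | zero => exact h0
  | add X Y _ _ hX hY => exact hadd X Y hX hY
  | smul c X _ hX => exact hsmul c X hX

theorem tbr_tmul {m : ℕ} {k : ℤ} {b : FreeGCA K p} {x : G} (hb : FreeGCA.HasParity p m b)
    (hx : x ∈ gr k) (a : FreeGCA K p) (y : G) :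
    L.tbr p (a ⊗ₜ x) (b ⊗ₜ y) = (-1 : K) ^ (k * m) • ((a * b) ⊗ₜ[K] L.br x y) := by
  simp only [tbr, LinearMap.add_apply, TensorProduct.map₂_apply_tmul, LinearMap.comp_apply,
    scale_apply _ hx, map_smul]
  have hb' : FreeGCA.parity p b = (-1 : K) ^ m • b := hb
  rcases Int.even_or_odd k with hk | hk
  · rw [if_pos hk, if_pos hk, (hk.mul_right _).neg_one_zpow]
    simp
  · have hk' := Int.not_even_iff_odd.mpr hk
    simp [hk', zpow_mul, hk.neg_one_zpow, zpow_natCast, hb', TensorProduct.smul_tmul']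

theorem td_tmul {m : ℕ} {a : FreeGCA K p} (ha : FreeGCA.HasParity p m a) (x : G) :
    L.td p (a ⊗ₜ x) = (-1 : K) ^ m • (a ⊗ₜ[K] L.d x) := by
  have ha' : FreeGCA.parity p a = (-1 : K) ^ m • a := ha
  rw [td, TensorProduct.map_tmul, AlgHom.toLinearMap_apply, ha', TensorProduct.smul_tmul']

theorem td_td (X : FreeGCA K p ⊗[K] G) : L.td p (L.td p X) = 0 := by
  induction X using TensorProduct.induction_on with
  | zero => simp
  | tmul a x => simp [td, L.d_d]
  | add X Y hX hY => rw [map_add, map_add, hX, hY, add_zero]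

/-- The sign (-1)^{|a|} in d changes when Q raises |a| by one, so the two operators anticommute.
Together with d² = 0 this leaves only u²Q² in (d + uQ)². -/
theorem td_rTensor_der (q : J → FreeGCA K p) (hq : ∀ j, FreeGCA.HasParity p (p j + 1) (q j))
    (X : FreeGCA K p ⊗[K] G) :
    L.td p ((FreeGCA.der p q hq).rTensor G X) = -(FreeGCA.der p q hq).rTensor G (L.td p X) := by
  induction X using TensorProduct.induction_on with
  | zero => simp
  | tmul a x => simp [td, FreeGCA.parity_der, TensorProduct.neg_tmul]
  | add X Y hX hY => simp only [map_add, hX, hY, neg_add]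

theorem tbr_mem_par {r s : ℤ} {X Y : FreeGCA K p ⊗[K] G} (hX : X ∈ par p gr r)
    (hY : Y ∈ par p gr s) : L.tbr p X Y ∈ par p gr (r + s) := by
  refine par_induction p ?_ (by simp) (fun X Y hX hY => ?_) (fun c X hX => ?_) hX
  · intro m k a x ha hx hm
    refine par_induction p ?_ (by simp) (fun X Y hX hY => ?_) (fun c X hX => ?_) hY
    · intro n l b y hb hy hn
      rw [L.tbr_tmul p hb hx]
      refine Submodule.smul_mem _ _ (tmul_mem_par p (ha.mul p hb) (L.br_mem k l x hx y hy) ?_)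
      rw [show (((m + n : ℕ) : ℤ) + (k + l) - (r + s)) = (m + k - r) + (n + l - s) by
        push_cast; ring]
      exact hm.add hn
    · rw [map_add]; exact add_mem hX hY
    · rw [map_smul]; exact Submodule.smul_mem _ _ hX
  · rw [map_add]; exact add_mem hX hY
  · rw [map_smul]; exact Submodule.smul_mem _ _ hX

theorem td_mem_par {r : ℤ} {X : FreeGCA K p ⊗[K] G} (hX : X ∈ par p gr r) :
    L.td p X ∈ par p gr (r + 1) := by
  refine par_induction p ?_ (by simp) (fun X Y hX hY => ?_) (fun c X hX => ?_) hX
  · intro m k a x ha hx hm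
    rw [L.td_tmul p ha]
    refine Submodule.smul_mem _ _ (tmul_mem_par p ha (L.d_mem k x hx) ?_)
    convert hm using 1
    ring
  · rw [map_add]; exact add_mem hX hY
  · rw [map_smul]; exact Submodule.smul_mem _ _ hX

theorem rTensor_der_mem_par (q : J → FreeGCA K p)
    (hq : ∀ j, FreeGCA.HasParity p (p j + 1) (q j)) {r : ℤ} {X : FreeGCA K p ⊗[K] G}
    (hX : X ∈ par p gr r) : (FreeGCA.der p q hq).rTensor G X ∈ par p gr (r + 1) := by
  refine par_induction p ?_ (by simp) (fun X Y hX hY => ?_) (fun c X hX => ?_) hX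
  · intro m k a x ha hx hm
    refine tmul_mem_par p (ha.der p q hq) hx ?_
    convert hm using 1
    push_cast
    ring
  · rw [map_add]; exact add_mem hX hY
  · rw [map_smul]; exact Submodule.smul_mem _ _ hX

theorem neg_one_zpow_congr {i j : ℤ} (h : Even (i - j)) : (-1 : K) ^ i = (-1 : K) ^ j := by
  rcases Int.even_or_odd j with hj | hj
  · have hi : Even i := by simpa using h.add hj
    rw [hi.neg_one_zpow, hj.neg_one_zpow]
  · have hi : Odd i := by simpa using h.add_odd hj
    rw [hi.neg_one_zpow, hj.neg_one_zpow]

theorem tbr_antisymm {r s : ℤ} {X Y : FreeGCA K p ⊗[K] G} (hX : X ∈ par p gr r)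
    (hY : Y ∈ par p gr s) : L.tbr p X Y = -((-1 : K) ^ (r * s) • L.tbr p Y X) := by
  refine par_induction p ?_ (by simp) (fun X Y hX hY => ?_) (fun c X hX => ?_) hX
  · intro m k a x ha hx hm
    refine par_induction p ?_ (by simp) (fun X Y hX hY => ?_) (fun c X hX => ?_) hY
    · intro n l b y hb hy hn
      rw [L.tbr_tmul p hb hx, L.tbr_tmul p ha hy, L.antisymm k l x hx y hy, ha.mul_comm p hb,
        TensorProduct.tmul_neg, TensorProduct.tmul_smul, ← TensorProduct.smul_tmul', smul_neg,
        smul_smul, smul_smul, smul_smul, ← zpow_natCast, ← zpow_add₀ (by simp),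
        ← zpow_add₀ (by simp), ← zpow_add₀ (by simp)]
      congr 2
      apply neg_one_zpow_congr
      push_cast
      obtain ⟨u, hu⟩ := hm
      obtain ⟨v, hv⟩ := hn
      obtain rfl : k = r + u + u - m := by linarith
      obtain rfl : l = s + v + v - n := by linarith
      -- Half of the difference of the two exponents.
      refine ⟨r * v + s * u + 2 * u * v - m * s - m * v * 2 + m * n, ?_⟩
      ring
    · simp only [map_add, LinearMap.add_apply, hX, hY, smul_add, neg_add]
    · simp only [map_smul, LinearMap.smul_apply, hX, smul_neg, smul_comm c]
  · simp only [map_add, LinearMap.add_apply, hX, hY, smul_add, neg_add]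
  · simp only [map_smul, LinearMap.smul_apply, hX, smul_neg, smul_comm c]

theorem tbr_jacobi {r s : ℤ} {X Y : FreeGCA K p ⊗[K] G} (hX : X ∈ par p gr r)
    (hY : Y ∈ par p gr s) {v : ℤ} {Z : FreeGCA K p ⊗[K] G} (hZ : Z ∈ par p gr v) :
    L.tbr p X (L.tbr p Y Z) =
      L.tbr p (L.tbr p X Y) Z + (-1 : K) ^ (r * s) • L.tbr p Y (L.tbr p X Z) := by
  refine par_induction p ?_ (by simp) (fun X Y hX hY => ?_) (fun c X hX => ?_) hX
  · intro m k a x ha hx hm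
    refine par_induction p ?_ (by simp) (fun X Y hX hY => ?_) (fun c X hX => ?_) hY
    · intro n l b y hb hy hn
      refine par_induction p ?_ (by simp) (fun X Y hX hY => ?_) (fun c X hX => ?_) hZ
      · intro n' l' c z hc hz _
        rw [L.tbr_tmul p hc hy, L.tbr_tmul p hb hx, L.tbr_tmul p hc hx, map_smul, map_smul,
          map_smul, LinearMap.smul_apply, L.tbr_tmul p (hb.mul p hc) hx,
          L.tbr_tmul p hc (L.br_mem k l x hx y hy),
          L.tbr_tmul p (ha.mul p hc) hy, L.jacobi k l x hx y hy, ← mul_assoc, ← mul_assoc,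
          ha.mul_comm p hb, TensorProduct.tmul_add, TensorProduct.tmul_smul]
        simp only [smul_mul_assoc, ← TensorProduct.smul_tmul', smul_add, smul_smul]
        simp only [← zpow_natCast, ← zpow_add₀ (neg_ne_zero.mpr (one_ne_zero (α := K)))]
        obtain ⟨u, hu⟩ := hm
        obtain ⟨v, hv⟩ := hn
        obtain rfl : k = r + u + u - m := by linarith
        obtain rfl : l = s + v + v - n := by linarith
        congr 2 <;> apply neg_one_zpow_congr <;> push_cast <;> ring_nf <;>
          simp [parity_simps, show Even (4 : ℤ) from ⟨2, rfl⟩]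
      · simp only [map_add, hX, hY, smul_add]
        abel
      · simp only [map_smul, hX, smul_add, smul_comm c]
    · simp only [map_add, LinearMap.add_apply, hX, hY, smul_add]
      abel
    · simp only [map_smul, LinearMap.smul_apply, hX, smul_add, smul_comm c]
  · simp only [map_add, LinearMap.add_apply, hX, hY, smul_add]
    abel
  · simp only [map_smul, LinearMap.smul_apply, hX, smul_add, smul_comm c]

theorem td_tbr {r : ℤ} {X : FreeGCA K p ⊗[K] G} (hX : X ∈ par p gr r) {s : ℤ}
    {Y : FreeGCA K p ⊗[K] G} (hY : Y ∈ par p gr s) :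
    L.td p (L.tbr p X Y) = L.tbr p (L.td p X) Y + (-1 : K) ^ r • L.tbr p X (L.td p Y) := by
  refine par_induction p ?_ (by simp) (fun X Y hX hY => ?_) (fun c X hX => ?_) hX
  · intro m k a x ha hx hm
    refine par_induction p ?_ (by simp) (fun X Y hX hY => ?_) (fun c X hX => ?_) hY
    · intro n l b y hb hy hn
      rw [L.tbr_tmul p hb hx, map_smul, L.td_tmul p (ha.mul p hb), L.td_tmul p ha,
        L.td_tmul p hb, map_smul, map_smul, LinearMap.smul_apply, L.tbr_tmul p hb hx,
        L.tbr_tmul p hb (L.d_mem k x hx), L.d_br k x hx, TensorProduct.tmul_add,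
        TensorProduct.tmul_smul]
      simp only [smul_add, smul_smul]
      simp only [← zpow_natCast, ← zpow_add₀ (neg_ne_zero.mpr (one_ne_zero (α := K)))]
      obtain ⟨u, hu⟩ := hm
      obtain rfl : k = r + u + u - m := by linarith
      congr 2 <;> apply neg_one_zpow_congr <;> push_cast <;> ring_nf <;> simp [parity_simps]
    · simp only [map_add, hX, hY, smul_add]
      abel
    · simp only [map_smul, hX, smul_add, smul_comm c]
  · simp only [map_add, LinearMap.add_apply, hX, hY, smul_add]
    abel
  · simp only [map_smul, LinearMap.smul_apply, hX, smul_add, smul_comm c]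

theorem rTensor_der_tbr (q : J → FreeGCA K p) (hq : ∀ j, FreeGCA.HasParity p (p j + 1) (q j))
    {r : ℤ} {X : FreeGCA K p ⊗[K] G} (hX : X ∈ par p gr r) {s : ℤ}
    {Y : FreeGCA K p ⊗[K] G} (hY : Y ∈ par p gr s) :
    (FreeGCA.der p q hq).rTensor G (L.tbr p X Y) =
      L.tbr p ((FreeGCA.der p q hq).rTensor G X) Y +
        (-1 : K) ^ r • L.tbr p X ((FreeGCA.der p q hq).rTensor G Y) := by
  refine par_induction p ?_ (by simp) (fun X Y hX hY => ?_) (fun c X hX => ?_) hX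
  · intro m k a x ha hx hm
    refine par_induction p ?_ (by simp) (fun X Y hX hY => ?_) (fun c X hX => ?_) hY
    · intro n l b y hb hy hn
      have ha' : FreeGCA.parity p a = (-1 : K) ^ m • a := ha
      rw [L.tbr_tmul p hb hx, map_smul, LinearMap.rTensor_tmul, LinearMap.rTensor_tmul,
        LinearMap.rTensor_tmul, L.tbr_tmul p hb hx, L.tbr_tmul p (hb.der p q hq) hx,
        FreeGCA.der_mul, ha', TensorProduct.add_tmul, smul_mul_assoc,
        ← TensorProduct.smul_tmul']
      simp only [smul_add, smul_smul]
      simp only [← zpow_natCast, ← zpow_add₀ (neg_ne_zero.mpr (one_ne_zero (α := K)))]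
      obtain ⟨u, hu⟩ := hm
      obtain rfl : k = r + u + u - m := by linarith
      congr 2; apply neg_one_zpow_congr; push_cast; ring_nf; simp [parity_simps]
    · simp only [map_add, hX, hY, smul_add]
      abel
    · simp only [map_smul, hX, smul_add, smul_comm c]
  · simp only [map_add, LinearMap.add_apply, hX, hY, smul_add]
    abel
  · simp only [map_smul, LinearMap.smul_apply, hX, smul_add, smul_comm c]

end DGLie

/-! ### Power series in lowering operators -/

/-- The terms of the square beyond the triangle i + j ≤ N vanish. In this form Cauchy products of
truncated series can be compared with products of truncations. -/
theorem Finset.sum_range_sum_antidiagonal {M : Type*} [AddCommMonoid M] (N : ℕ) (h : ℕ → ℕ → M)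
    (h0 : ∀ i j, i ≤ N → j ≤ N → N < i + j → h i j = 0) :
    ∑ n ∈ Finset.range (N + 1), ∑ x ∈ antidiagonal n, h x.1 x.2 =
      ∑ i ∈ Finset.range (N + 1), ∑ j ∈ Finset.range (N + 1), h i j := by
  classical
  rw [← Finset.sum_product', ← Finset.sum_filter_of_ne
    (s := Finset.range (N + 1) ×ˢ Finset.range (N + 1)) (p := fun x => x.1 + x.2 ≤ N)]
  · rw [← Finset.sum_fiberwise_of_maps_to
      (s := (Finset.range (N + 1) ×ˢ Finset.range (N + 1)).filter fun x => x.1 + x.2 ≤ N)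
      (t := Finset.range (N + 1)) (g := fun x => x.1 + x.2)]
    · refine Finset.sum_congr rfl fun n hn => Finset.sum_congr ?_ fun _ _ => rfl
      ext ⟨i, j⟩
      simp only [Finset.mem_range, Finset.HasAntidiagonal.mem_antidiagonal, Finset.mem_filter,
        Finset.mem_product] at hn ⊢
      omega
    · rintro ⟨i, j⟩ hx
      simp only [Finset.mem_range, Finset.mem_filter, Finset.mem_product] at hx ⊢
      omega
  · rintro ⟨i, j⟩ hx hne
    simp only [Finset.mem_range, Finset.mem_product] at hx
    by_contra hlt
    exact hne (h0 i j (by omega) (by omega) (by omega))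

section Lowering

variable {K : Type*} [Field K] {M : Type*} [AddCommGroup M] [Module K M] {I : Type*}

/-- The operator `A` on families is lowering for the weights `w` if the component of weight `n` of
`A X` depends only on the components of `X` of weight less than `n`. -/
def IsLowering (w : I → ℕ) (A : (I → M) →ₗ[K] (I → M)) : Prop :=
  ∀ X i, (∀ j, w j < w i → X j = 0) → A X i = 0

/-- The operator `f(A)` for a power series `f` and a lowering operator `A`. -/
def act (w : I → ℕ) (A : (I → M) →ₗ[K] (I → M)) (f : PowerSeries K) : (I → M) →ₗ[K] (I → M) where
  -- For a lowering operator all powers above `w i` vanish in the component `i`, so the cut-off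
  -- loses nothing.
  toFun X i := ∑ n ∈ Finset.range (w i + 1), PowerSeries.coeff n f • (A ^ n) X i
  map_add' X Y := by
    ext i
    simp [Finset.sum_add_distrib]
  map_smul' r X := by
    ext i
    simp [Finset.smul_sum, smul_comm r]

variable {w : I → ℕ} {A : (I → M) →ₗ[K] (I → M)}

namespace IsLowering

/-- Each application of A raises the lowest weight that can carry a nonzero component by at least
one. -/
theorem pow_apply_eq_zero (hA : IsLowering w A) {m : ℕ} {X : I → M}
    (hX : ∀ j, w j < m → X j = 0) (n : ℕ) {i : I} (hi : w i < m + n) : (A ^ n) X i = 0 := by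
  induction n generalizing i with
  | zero => exact hX i hi
  | succ n ih =>
    rw [pow_succ', Module.End.mul_apply]
    exact hA _ _ fun j hj => ih (by omega)

theorem pow_apply_congr (hA : IsLowering w A) {X Y : I → M} {i : I}
    (h : ∀ j, w j ≤ w i → X j = Y j) (n : ℕ) : (A ^ n) X i = (A ^ n) Y i := by
  rw [← sub_eq_zero, ← Pi.sub_apply, ← map_sub]
  refine hA.pow_apply_eq_zero (m := w i + 1) (fun j hj => ?_) n (by omega)
  rw [Pi.sub_apply, h j (by omega), sub_self]

theorem act_eq_sum (hA : IsLowering w A) (f : PowerSeries K) (X : I → M) {i : I} {N : ℕ}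
    (hN : w i ≤ N) :
    act w A f X i = ∑ n ∈ Finset.range (N + 1), PowerSeries.coeff n f • (A ^ n) X i := by
  change ∑ n ∈ Finset.range (w i + 1), PowerSeries.coeff n f • (A ^ n) X i = _
  refine Finset.sum_subset (fun n hn => ?_) fun n _ hn => ?_
  · simp only [Finset.mem_range] at hn ⊢
    omega
  · rw [hA.pow_apply_eq_zero (m := 0) (by simp) n (by simpa using hn), smul_zero]

theorem act_mul (hA : IsLowering w A) (f g : PowerSeries K) (X : I → M) :
    act w A (f * g) X = act w A f (act w A g X) := by
  ext i
  have h1 : ∀ n, (A ^ n) (act w A g X) i =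
      (A ^ n) (∑ k ∈ Finset.range (w i + 1), PowerSeries.coeff k g • (A ^ k) X) i := fun n =>
    hA.pow_apply_congr (fun j hj => by
      rw [hA.act_eq_sum g X hj, Finset.sum_apply]; rfl) n
  have h2 := Finset.sum_range_sum_antidiagonal (w i)
    (fun m n => (PowerSeries.coeff m f * PowerSeries.coeff n g) • (A ^ (m + n)) X i)
    fun m n _ _ h => by
      rw [hA.pow_apply_eq_zero (m := 0) (by simp) _ (by simpa using h), smul_zero]
  change ∑ n ∈ Finset.range _, _ = ∑ n ∈ Finset.range _, _
  simp only [h1, PowerSeries.coeff_mul, Finset.sum_smul, map_sum, map_smul, Finset.sum_apply,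
    Pi.smul_apply, Finset.smul_sum, smul_smul, ← Module.End.mul_apply, ← pow_add]
  rw [← h2]
  refine Finset.sum_congr rfl fun n _ => Finset.sum_congr rfl fun x hx => ?_
  rw [mem_antidiagonal.mp hx]

theorem act_one (w : I → ℕ) (A : (I → M) →ₗ[K] (I → M)) (X : I → M) : act w A 1 X = X := by
  ext i
  change ∑ n ∈ Finset.range _, _ = _
  rw [Finset.sum_eq_single 0]
  · simp
  · intro n _ hn
    simp [PowerSeries.coeff_one, hn]
  · simp

theorem act_act_of_mul_eq_one (hA : IsLowering w A) {f g : PowerSeries K} (h : f * g = 1)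
    (X : I → M) : act w A f (act w A g X) = X := by
  rw [← hA.act_mul, h, act_one]

end IsLowering

/-- Operators intertwined by a linear map which respects the weights. -/
theorem act_comm_of_comm {M' : Type*} [AddCommGroup M'] [Module K M'] {A : (I → M) →ₗ[K] (I → M)}
    {A' : (I → M') →ₗ[K] (I → M')} (φ : M →ₗ[K] M')
    (h : ∀ X : I → M, (fun i => φ (A X i)) = A' fun i => φ (X i)) (f : PowerSeries K) (X : I → M) :
    (fun i => φ (act w A f X i)) = act w A' f fun i => φ (X i) := by
  have hn : ∀ n, (fun i => φ ((A ^ n) X i)) = (A' ^ n) fun i => φ (X i) := by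
    intro n
    induction n with
    | zero => rfl
    | succ n ih => rw [pow_succ', pow_succ', Module.End.mul_apply, Module.End.mul_apply, h, ih]
  ext i
  change φ (∑ n ∈ Finset.range _, _) = ∑ n ∈ Finset.range _, _
  rw [map_sum]
  refine Finset.sum_congr rfl fun n _ => ?_
  rw [map_smul, ← hn]

end Lowering

/-- The power series `(exp x - 1) / x`. -/
def expSeries (K : Type*) [Field K] : PowerSeries K :=
  PowerSeries.mk fun n => 1 / ((n + 1).factorial : K)

/-- The power series `x / (exp x - 1)`. -/
def bernSeries (K : Type*) [Field K] : PowerSeries K :=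
  PowerSeries.mk fun n => ((bernoulli n : ℚ) : K) / (n.factorial : K)

/-- Cancel one factor x in (x/(e^x - 1)) · (e^x - 1) = x. -/
theorem bernSeries_mul_expSeries (K : Type*) [Field K] [CharZero K] :
    bernSeries K * expSeries K = 1 := by
  have h := bernoulliPowerSeries_mul_exp_sub_one K
  have h1 : PowerSeries.exp K - 1 = PowerSeries.X * expSeries K := by
    ext n
    cases n with
    | zero => simp
    | succ n => simp [PowerSeries.coeff_succ_X_mul, expSeries, PowerSeries.coeff_exp,
        PowerSeries.coeff_one]
  have h2 : bernoulliPowerSeries K = bernSeries K := by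
    ext n
    simp [bernoulliPowerSeries, bernSeries]
  rw [h1, h2, mul_left_comm] at h
  exact mul_left_cancel₀ PowerSeries.X_ne_zero (h.trans (mul_one _).symm)

theorem expSeries_mul_bernSeries (K : Type*) [Field K] [CharZero K] :
    expSeries K * bernSeries K = 1 := by
  rw [mul_comm, bernSeries_mul_expSeries]

/-! ### Gauge transformations of a flat connection -/

section Flat

variable {K : Type*} [Field K] [CharZero K] {M : Type*} [AddCommGroup M] [Module K M]

theorem sum_antidiagonal_symm (br : M →ₗ[K] M →ₗ[K] M) {odd : Submodule K M}
    (hsymm : ∀ X ∈ odd, ∀ Y ∈ odd, br X Y = br Y X) {Θ Ξ : ℕ → M} (hΘ : ∀ n, Θ n ∈ odd)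
    (hΞ : ∀ n, Ξ n ∈ odd) (n : ℕ) :
    ∑ x ∈ antidiagonal n, br (Θ x.1) (Ξ x.2) =
      ∑ x ∈ antidiagonal n, br (Ξ x.1) (Θ x.2) := by
  rw [← Finset.Nat.sum_antidiagonal_swap]
  exact Finset.sum_congr rfl fun x _ => hsymm _ (hΘ _) _ (hΞ _)

/-- The curvature of the connection `Θ = ∑ n, A ^ n Y / (n + 1)!`, order by order in `A`. -/
theorem curvature_succ (br : M →ₗ[K] M →ₗ[K] M) (A D : M →ₗ[K] M) (odd : Submodule K M) (Y : M)
    (hY : Y ∈ odd) (hA : ∀ X ∈ odd, A X ∈ odd)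
    (hsymm : ∀ X ∈ odd, ∀ Y ∈ odd, br X Y = br Y X)
    (hder : ∀ X ∈ odd, ∀ Z ∈ odd, A (br X Z) = br (A X) Z + br X (A Z))
    (hD : ∀ X ∈ odd, D (A X) = A (D X) + br X Y) {Θ : ℕ → M} (h0 : Θ 0 = 0)
    (hs : ∀ n, Θ (n + 1) = (1 / ((n + 1).factorial : K)) • (A ^ n) Y) (n : ℕ) :
    D (Θ (n + 1)) - (1 / 2 : K) • ∑ x ∈ antidiagonal (n + 1), br (Θ x.1) (Θ x.2) =
      (1 / ((n + 1).factorial : K)) • (A ^ n) (D Y) := by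
  have hodd' : ∀ n, (A ^ n) Y ∈ odd := by
    intro n
    induction n with
    | zero => exact hY
    | succ n ih => rw [pow_succ', Module.End.mul_apply]; exact hA _ ih
  have hodd : ∀ n, Θ n ∈ odd := by
    intro n
    cases n with
    | zero => rw [h0]; exact zero_mem _
    | succ n => rw [hs]; exact Submodule.smul_mem _ _ (hodd' n)
  -- Coefficients of the differential equation Θ' = Y + AΘ for Θ(s) = ∑ sⁿ Θ n.
  have hrec : ∀ n : ℕ, ((n + 1 : ℕ) : K) • Θ (n + 1) = (if n = 0 then Y else 0) + A (Θ n) := by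
    intro n
    cases n with
    | zero => simp [hs, h0]
    | succ n =>
      have : ((n + 1 + 1 : ℕ) : K) ≠ 0 := Nat.cast_ne_zero.mpr (by omega)
      rw [hs, hs, map_smul, ← Module.End.mul_apply, ← pow_succ', smul_smul, if_neg (by omega),
        zero_add, Nat.factorial_succ (n + 1)]
      congr 1
      push_cast at this ⊢
      field_simp
  have hAodd : ∀ n, A (Θ n) ∈ odd := fun n => hA _ (hodd n)
  -- the recursion satisfied by the curvature
  have key : ∀ n : ℕ, ((n + 1 : ℕ) : K) • (D (Θ (n + 1)) -
      (1 / 2 : K) • ∑ x ∈ antidiagonal (n + 1), br (Θ x.1) (Θ x.2)) =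
      (if n = 0 then D Y else 0) + A (D (Θ n) -
        (1 / 2 : K) • ∑ x ∈ antidiagonal n, br (Θ x.1) (Θ x.2)) := by
    intro n
    -- Coefficientwise, F = DΘ - ½[Θ, Θ] satisfies F' = DY + AF. The term [Θ, Y] from moving D past
    -- A cancels the term [Y, Θ] from differentiating the square, where [Θ, Θ]' = 2[Θ', Θ] by
    -- symmetry of the bracket on odd elements.
    have e1 : ((n + 1 : ℕ) : K) • D (Θ (n + 1)) =
        (if n = 0 then D Y else 0) + A (D (Θ n)) + br (Θ n) Y := by
      rw [← map_smul, hrec, map_add, hD _ (hodd n), add_assoc]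
      split_ifs <;> simp
    have e2 : ((n + 1 : ℕ) : K) • ∑ x ∈ antidiagonal (n + 1), br (Θ x.1) (Θ x.2) =
        (2 : K) • ∑ x ∈ antidiagonal (n + 1), (x.1 : K) • br (Θ x.1) (Θ x.2) := by
      have s : ∑ x ∈ antidiagonal (n + 1), (x.2 : K) • br (Θ x.1) (Θ x.2) =
          ∑ x ∈ antidiagonal (n + 1), (x.1 : K) • br (Θ x.1) (Θ x.2) := by
        rw [← Finset.Nat.sum_antidiagonal_swap]
        exact Finset.sum_congr rfl fun x _ => by
          simp only [Prod.snd_swap, Prod.fst_swap, hsymm _ (hodd x.2) _ (hodd x.1)]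
      rw [two_smul]
      nth_rw 2 [← s]
      rw [Finset.smul_sum, ← Finset.sum_add_distrib]
      refine Finset.sum_congr rfl fun x hx => ?_
      rw [← mem_antidiagonal.mp hx, ← add_smul, Nat.cast_add]
    have e3 : ∑ x ∈ antidiagonal (n + 1), (x.1 : K) • br (Θ x.1) (Θ x.2) =
        br Y (Θ n) + ∑ x ∈ antidiagonal n, br (A (Θ x.1)) (Θ x.2) := by
      rw [Finset.Nat.sum_antidiagonal_succ]
      simp only [Nat.cast_zero, zero_smul, zero_add]
      have : ∀ x : ℕ × ℕ, ((x.1 + 1 : ℕ) : K) • br (Θ (x.1 + 1)) (Θ x.2) =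
          (if x.1 = 0 then br Y (Θ x.2) else 0) + br (A (Θ x.1)) (Θ x.2) := by
        intro x
        rw [← LinearMap.smul_apply, ← map_smul, hrec, map_add, LinearMap.add_apply]
        split_ifs <;> simp
      rw [Finset.sum_congr rfl fun x _ => this x, Finset.sum_add_distrib]
      congr 1
      rw [Finset.sum_eq_single (0, n)]
      · simp
      · rintro ⟨i, j⟩ hx hne
        refine if_neg fun hi => hne ?_
        have := mem_antidiagonal.mp hx
        simp only at hi this
        ext <;> simp <;> omega
      · simp
    have e4 : A (∑ x ∈ antidiagonal n, br (Θ x.1) (Θ x.2)) =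
        (2 : K) • ∑ x ∈ antidiagonal n, br (A (Θ x.1)) (Θ x.2) := by
      rw [map_sum, two_smul]
      nth_rw 2 [sum_antidiagonal_symm br hsymm hAodd hodd]
      rw [← Finset.sum_add_distrib]
      exact Finset.sum_congr rfl fun x _ => hder _ (hodd _) _ (hodd _)
    rw [smul_sub, e1, smul_comm _ (1 / 2 : K), e2, e3, map_sub, map_smul, e4,
      hsymm _ (hodd n) _ hY]
    simp only [smul_smul, smul_add]
    norm_num
    abel
  induction n with
  | zero => simpa [h0] using key 0
  | succ n ih =>
    have h := key (n + 1)
    have hne : ((n + 1 + 1 : ℕ) : K) ≠ 0 := Nat.cast_ne_zero.mpr (by omega)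
    rw [ih, if_neg (by omega), zero_add, map_smul, ← Module.End.mul_apply, ← pow_succ'] at h
    rw [← inv_smul_smul₀ hne (D (Θ (n + 1 + 1)) - _), h, smul_smul, Nat.factorial_succ (n + 1)]
    congr 1
    push_cast at hne ⊢
    field_simp

end Flat

/-! ### Sequences in a Lie superalgebra -/

section Sequences

variable {K : Type*} [Field K] {M : Type*} [AddCommGroup M] [Module K M]

/-- The convolution of sequences induced by a bilinear operation. -/
def conv (br : M →ₗ[K] M →ₗ[K] M) : (ℕ → M) →ₗ[K] (ℕ → M) →ₗ[K] (ℕ → M) :=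
  LinearMap.mk₂ K (fun X Y n => ∑ x ∈ antidiagonal n, br (X x.1) (Y x.2))
    (fun X X' Y => by ext n; simp [Finset.sum_add_distrib])
    (fun c X Y => by ext n; simp [Finset.smul_sum])
    (fun X Y Y' => by ext n; simp [Finset.sum_add_distrib])
    (fun c X Y => by ext n; simp [Finset.smul_sum])

theorem conv_apply (br : M →ₗ[K] M →ₗ[K] M) (X Y : ℕ → M) (n : ℕ) :
    conv br X Y n = ∑ x ∈ antidiagonal n, br (X x.1) (Y x.2) := rfl

/-- The operator `d + u Q` on sequences, regarded as power series in `u`. -/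
def shiftedDiff (d Q : M →ₗ[K] M) : (ℕ → M) →ₗ[K] (ℕ → M) where
  -- In the application the component of order n has degree c - n in G. Since Q preserves this
  -- degree and d raises it by one, shifting Q by one order makes both terms change c to c + 1.
  toFun X n := d (X n) + if n = 0 then 0 else Q (X (n - 1))
  map_add' X Y := by
    ext n
    by_cases hn : n = 0
    · simp [hn]
    · simp [hn]; abel
  map_smul' c X := by
    ext n
    by_cases hn : n = 0 <;> simp [hn]

theorem shiftedDiff_zero (d Q : M →ₗ[K] M) (X : ℕ → M) : shiftedDiff d Q X 0 = d (X 0) := by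
  simp [shiftedDiff]

theorem shiftedDiff_succ (d Q : M →ₗ[K] M) (X : ℕ → M) (n : ℕ) :
    shiftedDiff d Q X (n + 1) = d (X (n + 1)) + Q (X n) := by
  simp [shiftedDiff]

theorem shiftedDiff_shiftedDiff_succ_succ {d Q : M →ₗ[K] M} (hd : ∀ X, d (d X) = 0)
    (hdQ : ∀ X, d (Q X) = -Q (d X)) (X : ℕ → M) (n : ℕ) :
    shiftedDiff d Q (shiftedDiff d Q X) (n + 2) = Q (Q (X n)) := by
  simp only [shiftedDiff_succ, map_add, hd, hdQ]
  abel

theorem shiftedDiff_shiftedDiff_zero {d Q : M →ₗ[K] M} (hd : ∀ X, d (d X) = 0) (X : ℕ → M) :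
    shiftedDiff d Q (shiftedDiff d Q X) 0 = 0 := by
  simp only [shiftedDiff_zero, hd]

theorem shiftedDiff_shiftedDiff_one {d Q : M →ₗ[K] M} (hd : ∀ X, d (d X) = 0)
    (hdQ : ∀ X, d (Q X) = -Q (d X)) (X : ℕ → M) :
    shiftedDiff d Q (shiftedDiff d Q X) 1 = 0 := by
  simp only [shiftedDiff_succ, shiftedDiff_zero, map_add, hd, hdQ]
  abel

/-- The Leibniz rule passes from d and Q to d + uQ; the minus sign is the one for odd first
arguments. -/
theorem shiftedDiff_conv {d Q : M →ₗ[K] M} (br : M →ₗ[K] M →ₗ[K] M) {X Y : ℕ → M}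
    (hd : ∀ i j, d (br (X i) (Y j)) = br (d (X i)) (Y j) - br (X i) (d (Y j)))
    (hQ : ∀ i j, Q (br (X i) (Y j)) = br (Q (X i)) (Y j) - br (X i) (Q (Y j))) :
    shiftedDiff d Q (conv br X Y) =
      conv br (shiftedDiff d Q X) Y - conv br X (shiftedDiff d Q Y) := by
  have hd' : ∀ n, d (conv br X Y n) = ∑ x ∈ antidiagonal n, br (d (X x.1)) (Y x.2) -
      ∑ x ∈ antidiagonal n, br (X x.1) (d (Y x.2)) := by
    intro n
    simp only [conv_apply, map_sum, hd, Finset.sum_sub_distrib]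
  have hQ' : ∀ n, Q (conv br X Y n) = ∑ x ∈ antidiagonal n, br (Q (X x.1)) (Y x.2) -
      ∑ x ∈ antidiagonal n, br (X x.1) (Q (Y x.2)) := by
    intro n
    simp only [conv_apply, map_sum, hQ, Finset.sum_sub_distrib]
  ext n
  rw [Pi.sub_apply, conv_apply, conv_apply]
  cases n with
  | zero =>
    rw [shiftedDiff_zero, hd']
    simp [shiftedDiff_zero]
  | succ n =>
    rw [shiftedDiff_succ, hd', hQ', Finset.Nat.sum_antidiagonal_succ (f := fun x =>
      br (shiftedDiff d Q X x.1) (Y x.2)), Finset.Nat.sum_antidiagonal_succ' (f := fun x =>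
      br (X x.1) (shiftedDiff d Q Y x.2)), Finset.Nat.sum_antidiagonal_succ,
      Finset.Nat.sum_antidiagonal_succ' (f := fun x => br (X x.1) (d (Y x.2)))]
    simp only [shiftedDiff_zero, shiftedDiff_succ, map_add, LinearMap.add_apply,
      Finset.sum_add_distrib]
    abel

theorem conv_conv_left (br : M →ₗ[K] M →ₗ[K] M) (X Y Z : ℕ → M) (n : ℕ) :
    conv br (conv br X Y) Z n = ∑ x ∈ antidiagonal n, ∑ y ∈ antidiagonal x.2,
      br (br (X x.1) (Y y.1)) (Z y.2) := by
  simp only [conv_apply, map_sum, LinearMap.sum_apply]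
  rw [Finset.sum_sigma', Finset.sum_sigma']
  refine Finset.sum_nbij' (fun x => ⟨(x.2.1, x.2.2 + x.1.2), (x.2.2, x.1.2)⟩)
    (fun x => ⟨(x.1.1 + x.2.1, x.2.2), (x.1.1, x.2.1)⟩) ?_ ?_ ?_ ?_ ?_ <;>
  · rintro ⟨⟨i, j⟩, ⟨k, l⟩⟩ h
    simp only [Finset.mem_sigma, mem_antidiagonal] at h
    obtain ⟨h1, h2⟩ := h
    subst h1 h2
    simp [add_assoc]

theorem conv_conv_right (br : M →ₗ[K] M →ₗ[K] M) (X Y Z : ℕ → M) (n : ℕ) :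
    conv br X (conv br Y Z) n = ∑ x ∈ antidiagonal n, ∑ y ∈ antidiagonal x.2,
      br (X x.1) (br (Y y.1) (Z y.2)) := by
  simp only [conv_apply, map_sum]

theorem sum_antidiagonal_right_comm (f : ℕ → ℕ → ℕ → M) (n : ℕ) :
    ∑ x ∈ antidiagonal n, ∑ y ∈ antidiagonal x.2, f x.1 y.1 y.2 =
      ∑ x ∈ antidiagonal n, ∑ y ∈ antidiagonal x.2, f x.1 y.2 y.1 :=
  Finset.sum_congr rfl fun x _ => (Finset.Nat.sum_antidiagonal_swap (f := fun y => f x.1 y.1 y.2)).symm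

theorem conv_jacobi (br : M →ₗ[K] M →ₗ[K] M) {X Y Z : ℕ → M}
    (h : ∀ i j k, br (br (X i) (Y j)) (Z k) =
      br (X i) (br (Y j) (Z k)) + br (br (X i) (Z k)) (Y j)) :
    conv br (conv br X Y) Z = conv br X (conv br Y Z) + conv br (conv br X Z) Y := by
  ext n
  rw [Pi.add_apply, conv_conv_left, conv_conv_right, conv_conv_left,
    sum_antidiagonal_right_comm (fun i j k => br (br (X i) (Z j)) (Y k)),
    ← Finset.sum_add_distrib]
  refine Finset.sum_congr rfl fun x _ => ?_
  rw [← Finset.sum_add_distrib]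
  exact Finset.sum_congr rfl fun y _ => h _ _ _

theorem conv_apply_eq_zero (br : M →ₗ[K] M →ₗ[K] M) {X Y : ℕ → M} {a b n : ℕ}
    (hX : ∀ i < a, X i = 0) (hY : ∀ i < b, Y i = 0) (hn : n < a + b) : conv br X Y n = 0 := by
  rw [conv_apply]
  refine Finset.sum_eq_zero fun x hx => ?_
  have := mem_antidiagonal.mp hx
  rcases lt_or_ge x.1 a with h | h
  · rw [hX _ h, map_zero, LinearMap.zero_apply]
  · rw [hY x.2 (by omega), map_zero]

/-- The operator `X ↦ -[X, T]`. -/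
def negAd (br : M →ₗ[K] M →ₗ[K] M) (T : ℕ → M) : (ℕ → M) →ₗ[K] (ℕ → M) := -(conv br).flip T

theorem negAd_apply (br : M →ₗ[K] M →ₗ[K] M) (T X : ℕ → M) : negAd br T X = -conv br X T := rfl

/-- Since T starts in order one, a bracket with T raises the order. -/
theorem isLowering_negAd (br : M →ₗ[K] M →ₗ[K] M) {T : ℕ → M} (hT : T 0 = 0) :
    IsLowering id (negAd br T) := by
  intro X n hX
  rw [negAd_apply, Pi.neg_apply, conv_apply_eq_zero br (a := n) (b := 1) hX (by simpa using hT)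
    (by simp), neg_zero]

/-- Let `Y = D T` for an odd derivation `D = d + u Q` of the sequences in a Lie superalgebra and an
even sequence `T`.  The connection `Θ = ((exp A - 1) / A) Y` with `A = -[-, T]` is gauge equivalent
to the trivial one, and its curvature is `((exp A - 1) / A) (D Y)`. -/
theorem curvature_act [CharZero K] (br : M →ₗ[K] M →ₗ[K] M) (d Q : M →ₗ[K] M)
    (odd : Submodule K M) (T : ℕ → M) (hT : T 0 = 0)
    (hYodd : ∀ n, shiftedDiff d Q T n ∈ odd)
    (hodd : ∀ X ∈ odd, ∀ n, br X (T n) ∈ odd)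
    (hsymm : ∀ X ∈ odd, ∀ Y ∈ odd, br X Y = br Y X)
    (hjac : ∀ X ∈ odd, ∀ Z ∈ odd, ∀ n,
      br (br X Z) (T n) = br X (br Z (T n)) + br (br X (T n)) Z)
    (hd : ∀ X ∈ odd, ∀ n, d (br X (T n)) = br (d X) (T n) - br X (d (T n)))
    (hQ : ∀ X ∈ odd, ∀ n, Q (br X (T n)) = br (Q X) (T n) - br X (Q (T n))) :
    shiftedDiff d Q (act id (negAd br T) (expSeries K) (shiftedDiff d Q T)) -
        (1 / 2 : K) • conv br (act id (negAd br T) (expSeries K) (shiftedDiff d Q T))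
          (act id (negAd br T) (expSeries K) (shiftedDiff d Q T)) =
      act id (negAd br T) (expSeries K) (shiftedDiff d Q (shiftedDiff d Q T)) := by
  have hlow := isLowering_negAd br hT
  set A := negAd br T with hA
  set D := shiftedDiff d Q with hD
  set Y := D T with hY
  let Odd : Submodule K (ℕ → M) := Submodule.pi Set.univ fun _ => odd
  have memOdd : ∀ {X : ℕ → M}, X ∈ Odd ↔ ∀ n, X n ∈ odd := by
    intro X
    simp [Odd, Submodule.mem_pi]
  have hY0 : ∀ j < 1, Y j = 0 := by
    intro j hj
    obtain rfl : j = 0 := by omega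
    rw [hY, hD, shiftedDiff_zero, hT, map_zero]
  -- The outer index counts applications of A, shifted by one; the inner index is the order in u.
  let Θ : ℕ → ℕ → M := fun n => if n = 0 then 0 else
    (1 / (n.factorial : K)) • (A ^ (n - 1)) Y
  -- Y starts in order one and each A raises the order, so `Θ n` starts in order n. Only finitely
  -- many terms are visible in a given order.
  have hΘlow : ∀ n m, m < n → Θ n m = 0 := by
    intro n m hmn
    obtain ⟨n, rfl⟩ : ∃ k, n = k + 1 := ⟨n - 1, by omega⟩
    simp only [Θ, if_neg (Nat.succ_ne_zero n), Pi.smul_apply, Nat.add_sub_cancel]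
    rw [hlow.pow_apply_eq_zero (m := 1) hY0 n (by simp; omega), smul_zero]
  have key := curvature_succ (conv br) A D Odd Y (memOdd.mpr hYodd)
    (fun X hX => memOdd.mpr fun n => by
      rw [hA, negAd_apply, Pi.neg_apply, conv_apply]
      exact neg_mem (sum_mem fun x _ => hodd _ (memOdd.mp hX _) _))
    (fun X hX Z hZ => by
      ext n
      exact sum_antidiagonal_symm br hsymm (memOdd.mp hX) (memOdd.mp hZ) n)
    (fun X hX Z hZ => by
      simp only [hA, negAd_apply]
      rw [conv_jacobi br fun i j k => hjac _ (memOdd.mp hX i) _ (memOdd.mp hZ j) k, map_neg,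
        map_neg, LinearMap.neg_apply, neg_add]
      abel)
    (fun X hX => by
      simp only [hA, negAd_apply]
      rw [map_neg, hD, shiftedDiff_conv br (fun i j => hd _ (memOdd.mp hX i) j)
        (fun i j => hQ _ (memOdd.mp hX i) j), ← hD, ← hY]
      abel) (Θ := Θ) (by simp [Θ]) (fun n => by simp [Θ])
  ext m
  -- truncation of the connection
  let S : ℕ → M := ∑ n ∈ Finset.range (m + 2), Θ n
  have hS : ∀ j ≤ m, act id A (expSeries K) Y j = S j := by
    intro j hj
    rw [hlow.act_eq_sum (expSeries K) Y (N := m) (by simpa using hj)]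
    simp only [S, Finset.sum_apply]
    rw [Finset.sum_range_succ' (fun n => Θ n j)]
    simp [Θ, expSeries]
  have hconv : conv br (act id A (expSeries K) Y) (act id A (expSeries K) Y) m =
      conv br S S m := by
    rw [conv_apply, conv_apply]
    refine Finset.sum_congr rfl fun x hx => ?_
    have := mem_antidiagonal.mp hx
    rw [hS _ (by omega), hS _ (by omega)]
  have hDS : D (act id A (expSeries K) Y) m = D S m := by
    rw [hD]
    cases m with
    | zero => rw [shiftedDiff_zero, shiftedDiff_zero, hS _ le_rfl]
    | succ m => rw [shiftedDiff_succ, shiftedDiff_succ, hS _ le_rfl, hS _ (by omega)]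
  have hSS : conv br S S = ∑ i ∈ Finset.range (m + 2), ∑ j ∈ Finset.range (m + 2),
      conv br (Θ i) (Θ j) := by
    simp only [S, map_sum, LinearMap.sum_apply]
    exact Finset.sum_comm
  -- The bracket of `Θ i` and `Θ j` starts in order i + j, so pairs with i + j > m + 1 are invisible
  -- in order m.
  have hsum := Finset.sum_range_sum_antidiagonal (m + 1) (fun i j => conv br (Θ i) (Θ j) m)
    fun i j _ _ h => conv_apply_eq_zero br (hΘlow i) (hΘlow j) (by omega)
  rw [Pi.sub_apply, Pi.smul_apply, hDS, hconv, hSS, Finset.sum_apply]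
  simp only [Finset.sum_apply]
  rw [← hsum, hlow.act_eq_sum (expSeries K) (D Y) (N := m) le_rfl]
  have : D S m = ∑ n ∈ Finset.range (m + 2), D (Θ n) m := by
    simp only [S, map_sum, Finset.sum_apply]
  rw [this, Finset.smul_sum, ← Finset.sum_sub_distrib, Finset.sum_range_succ']
  have h0 : Θ 0 = 0 := by simp [Θ]
  simp only [h0, Finset.Nat.antidiagonal_zero, Finset.sum_singleton, map_zero, Pi.zero_apply,
    smul_zero, sub_zero, add_zero]
  refine Finset.sum_congr rfl fun n _ => ?_
  have := congrFun (key n) m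
  simp only [Pi.sub_apply, Pi.smul_apply, Finset.sum_apply] at this
  rw [this]
  simp [expSeries]

end Sequences

/-! ### Koszul signs -/

/-- The product of `H i j` over all pairs `i < j`. -/
def pairProd {R : Type*} [CommMonoid R] {n : ℕ} (H : Fin n → Fin n → R) : R :=
  ∏ i, ∏ j, if i < j then H i j else 1

theorem pairProd_mul {R : Type*} [CommMonoid R] {n : ℕ} (H H' : Fin n → Fin n → R) :
    (pairProd fun i j => H i j * H' i j) = pairProd H * pairProd H' := by
  simp only [pairProd, ← Finset.prod_mul_distrib]
  refine Finset.prod_congr rfl fun i _ => Finset.prod_congr rfl fun j _ => ?_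
  split_ifs <;> simp

theorem pairProd_congr {R : Type*} [CommMonoid R] {n : ℕ} {H H' : Fin n → Fin n → R}
    (h : ∀ i j, i < j → H i j = H' i j) : pairProd H = pairProd H' :=
  Finset.prod_congr rfl fun i _ => Finset.prod_congr rfl fun j _ =>
    ite_congr rfl (h i j) fun _ => rfl

theorem pairProd_eq_one {R : Type*} [CommMonoid R] {n : ℕ} {H : Fin n → Fin n → R}
    (h : ∀ i j, i < j → H i j = 1) : pairProd H = 1 :=
  (pairProd_congr h).trans (by simp [pairProd])

theorem pairProd_eq_prod_filter {R : Type*} [CommMonoid R] {n : ℕ} (H : Fin n → Fin n → R) :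
    pairProd H = ∏ x : Fin n × Fin n with x.1 < x.2, H x.1 x.2 := by
  rw [pairProd, Finset.prod_filter, Fintype.prod_prod_type]

/-- An adjacent transposition reverses the order of the transposed pair and of no other. -/
theorem swap_castSucc_succ_lt {n : ℕ} (i : Fin n) {j l : Fin (n + 1)} (h : j < l)
    (hne : (j, l) ≠ (i.castSucc, i.succ)) :
    Equiv.swap i.castSucc i.succ j < Equiv.swap i.castSucc i.succ l := by
  simp only [Equiv.swap_apply_def]
  simp only [ne_eq, Prod.mk.injEq, Fin.ext_iff, Fin.lt_def, Fin.val_castSucc, Fin.val_succ]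
    at h hne ⊢
  split_ifs <;> simp <;> omega

/-- The two pair products differ only in the factor of the transposed pair. Multiplying crosswise
avoids division in a monoid. -/
theorem pairProd_comp_swap {R : Type*} [CommMonoid R] {n : ℕ} (H : Fin (n + 1) → Fin (n + 1) → R)
    (i : Fin n) :
    (pairProd fun j l => H (Equiv.swap i.castSucc i.succ j) (Equiv.swap i.castSucc i.succ l)) *
      H i.castSucc i.succ = pairProd H * H i.succ i.castSucc := by
  classical
  have hmem : (i.castSucc, i.succ) ∈
      Finset.univ.filter fun x : Fin (n + 1) × Fin (n + 1) => x.1 < x.2 := by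
    simp
  rw [pairProd_eq_prod_filter, pairProd_eq_prod_filter, ← Finset.mul_prod_erase _ _ hmem,
    ← Finset.mul_prod_erase _ (fun x => H x.1 x.2) hmem, Equiv.swap_apply_left,
    Equiv.swap_apply_right, mul_right_comm, mul_comm (H i.succ i.castSucc),
    mul_right_comm (H i.castSucc i.succ)]
  congr 2
  refine Finset.prod_nbij' (fun x => (Equiv.swap i.castSucc i.succ x.1,
    Equiv.swap i.castSucc i.succ x.2)) (fun x => (Equiv.swap i.castSucc i.succ x.1,
    Equiv.swap i.castSucc i.succ x.2)) ?_ ?_ (by simp) (by simp) (by simp)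
  all_goals
    rintro ⟨j, l⟩ h
    simp only [Finset.mem_erase, Finset.mem_filter, Finset.mem_univ, true_and] at h ⊢
    refine ⟨fun he => ?_, swap_castSucc_succ_lt i h.2 h.1⟩
    simp only [Prod.mk.injEq] at he
    have h1 := congrArg (Equiv.swap i.castSucc i.succ) he.1
    have h2 := congrArg (Equiv.swap i.castSucc i.succ) he.2
    simp only [Equiv.swap_apply_self, Equiv.swap_apply_left, Equiv.swap_apply_right] at h1 h2
    rw [h1, h2] at h
    exact absurd h.2 (by simp [Fin.castSucc_lt_succ.le])

theorem List.prod_ofFn_swap {K : Type*} [Field K] {A : Type*} [Ring A] [Algebra K A] {n : ℕ}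
    (a : Fin (n + 1) → A) (i : Fin n) {c : K}
    (h : a i.succ * a i.castSucc = c • (a i.castSucc * a i.succ)) :
    (List.ofFn (a ∘ Equiv.swap i.castSucc i.succ)).prod = c • (List.ofFn a).prod := by
  induction n with
  | zero => exact i.elim0
  | succ n ih =>
    cases i using Fin.cases with
    | zero =>
      have e : ∀ j : Fin n, (a ∘ Equiv.swap (0 : Fin (n + 1)).castSucc (0 : Fin (n + 1)).succ)
          j.succ.succ = a j.succ.succ := by
        intro j
        rw [Function.comp_apply, Equiv.swap_apply_of_ne_of_ne]
        · simp [Fin.ext_iff]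
        · simp [Fin.ext_iff]
      rw [List.ofFn_succ, List.ofFn_succ, List.ofFn_succ (f := a),
        List.ofFn_succ (f := fun i => a i.succ), List.prod_cons, List.prod_cons, List.prod_cons,
        List.prod_cons]
      simp only [e]
      rw [← mul_assoc, ← mul_assoc, ← smul_mul_assoc]
      congr 1
    | succ i =>
      have e : ∀ j : Fin (n + 1), (a ∘ Equiv.swap i.succ.castSucc i.succ.succ) j.succ =
          ((fun j => a (Fin.succ j)) ∘ Equiv.swap i.castSucc i.succ) j := by
        intro j
        simp only [Function.comp_apply]
        congr 1
        rw [Fin.castSucc_succ i]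
        exact (Fin.succ_injective _).swap_apply _ _ _
      have e0 : (a ∘ Equiv.swap i.succ.castSucc i.succ.succ) 0 = a 0 := by
        rw [Function.comp_apply, Equiv.swap_apply_of_ne_of_ne]
        · simp [Fin.ext_iff]
        · simp [Fin.ext_iff]
      rw [List.ofFn_succ, List.ofFn_succ (f := a), List.prod_cons, List.prod_cons, e0]
      simp only [e]
      rw [ih (fun j => a (Fin.succ j)) i (by simpa using h), mul_smul_comm]

/-- Reordering a product of graded commuting elements. -/
theorem pairProd_smul_prod_ofFn_comp {K : Type*} [Field K] {A : Type*} [Ring A] [Algebra K A]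
    {n : ℕ} (a : Fin n → A) (d : Fin n → ℕ) (H : Fin n → Fin n → K)
    (ha : ∀ x y, a x * a y = (-1 : K) ^ (d x * d y) • (a y * a x)) (hne : ∀ x y, H x y ≠ 0)
    (hH : ∀ x y, x ≠ y → H x y = (-1 : K) ^ (d x * d y) * H y x) (σ : Equiv.Perm (Fin n)) :
    (pairProd fun j l => H (σ j) (σ l)) • (List.ofFn (a ∘ σ)).prod =
      pairProd H • (List.ofFn a).prod := by
  cases n with
  | zero =>
    obtain rfl : σ = 1 := Subsingleton.elim _ _
    rfl
  | succ n =>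
    -- Adjacent transpositions generate the symmetric group. For one of them, the exchange sign of
    -- the two elements `a` is compensated by the single factor of `H` that changes.
    have hσ : σ ∈ Submonoid.closure (Set.range fun i : Fin n => Equiv.swap i.castSucc i.succ) := by
      rw [Equiv.Perm.mclosure_swap_castSucc_succ]
      trivial
    induction hσ using Submonoid.closure_induction_right with
    | one => rfl
    | mul_right σ _ s hs ih =>
      obtain ⟨i, rfl⟩ := hs
      have h1 := pairProd_comp_swap (fun j l => H (σ j) (σ l)) i
      have h2 := List.prod_ofFn_swap (a ∘ σ) i (ha (σ i.succ) (σ i.castSucc))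
      have h3 := hH (σ i.succ) (σ i.castSucc)
        (by simp [Fin.ext_iff])
      rw [← ih]
      simp only [Equiv.Perm.coe_mul, Function.comp_apply, ← Function.comp_assoc]
      rw [h2, smul_smul]
      congr 1
      rw [h3] at h1
      refine mul_right_cancel₀ (hne (σ i.castSucc) (σ i.succ)) ?_
      have hsq : (-1 : K) ^ (d (σ i.succ) * d (σ i.castSucc)) *
          (-1 : K) ^ (d (σ i.succ) * d (σ i.castSucc)) = 1 := by
        rw [← mul_pow]
        simp
      rw [mul_right_comm, h1]
      linear_combination
        ((pairProd fun j l => H (σ j) (σ l)) * H (σ i.castSucc) (σ i.succ)) * hsq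

/-! ### Koszul signs of the monomials in the t^α -/

namespace DGLie

/-- The sign of a permutation is the product of -1 over its inversions, so χ is a product over
inversions as well. -/
theorem chi_eq_pairProd {K : Type*} [Field K] {n : ℕ} (σ : Equiv.Perm (Fin n)) (e : Fin n → ℤ) :
    (chi σ e : K) = pairProd fun i j =>
      if σ j < σ i then -(-1 : K) ^ (e (σ i) * e (σ j)) else 1 := by
  have hs : ((Equiv.Perm.sign σ : ℤ) : K) =
      ∏ i : Fin n, ∏ j : Fin n, if i < j ∧ σ j < σ i then (-1 : K) else 1 := by
    rw [Equiv.Perm.sign_eq_prod_prod_Ioi]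
    push_cast
    refine Finset.prod_congr rfl fun i _ => ?_
    rw [← Finset.prod_subset (Finset.subset_univ (Finset.Ioi i))]
    · refine Finset.prod_congr rfl fun j hj => ?_
      have hij := Finset.mem_Ioi.mp hj
      have hne : σ i ≠ σ j := fun h => hij.ne (σ.injective h)
      rcases lt_or_gt_of_ne hne with h | h
      · simp [h, h.not_gt]
      · simp [h, h.not_gt, hij]
    · intro j _ hj
      rw [if_neg fun h => hj (Finset.mem_Ioi.mpr h.1)]
  rw [chi, hs, pairProd, ← Finset.prod_mul_distrib]
  refine Finset.prod_congr rfl fun i _ => ?_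
  rw [← Finset.prod_mul_distrib]
  refine Finset.prod_congr rfl fun j _ => ?_
  by_cases h1 : i < j <;> by_cases h2 : σ j < σ i <;> simp [h1, h2]

theorem chi_mul_self {K : Type*} [Field K] {n : ℕ} (σ : Equiv.Perm (Fin n)) (e : Fin n → ℤ) :
    (chi σ e : K) * chi σ e = 1 := by
  rw [chi_eq_pairProd, ← pairProd_mul]
  refine pairProd_eq_one fun i j _ => ?_
  split_ifs
  · rw [neg_mul_neg, ← mul_zpow]
    simp
  · simp

variable {K : Type*} [Field K] {ι : ℕ → Type*} [∀ n, Fintype (ι n)]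

theorem neg_one_pow_signExp {k : ℕ} (β : Fin k → Σ n, ι n) :
    (-1 : K) ^ signExp β = (-1 : K) ^ (k * ∑ j, deg (β j)) *
      pairProd fun j l => (-1 : K) ^ (deg (β l) * (deg (β j) - 1)) := by
  rw [signExp, pow_add, ← Finset.prod_pow_eq_pow_sum, pairProd, Finset.prod_comm]
  congr 1
  refine Finset.prod_congr rfl fun l _ => ?_
  rw [← Finset.prod_pow_eq_pow_sum]
  refine Finset.prod_congr rfl fun j _ => ?_
  split_ifs <;> simp

/-- The Koszul signs of the Chevalley–Eilenberg differential are compatible with permutations. -/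
theorem chi_smul_mon {k : ℕ} (β : Fin k → Σ n, ι n) (σ : Equiv.Perm (Fin k)) :
    ((-1 : K) ^ signExp β * chi σ fun j => 1 - (deg (β j) : ℤ)) •
        (FreeGCA.mon wdeg (List.ofFn fun j => Sum.inl (β j)) : Weil K ι) =
      (-1 : K) ^ signExp (β ∘ σ) • FreeGCA.mon wdeg (List.ofFn fun j => Sum.inl (β (σ j))) := by
  set S : Fin k → Fin k → K := fun j l => (-1 : K) ^ (deg (β l) * (deg (β j) - 1)) with hS
  -- C is trivial on increasing pairs, so its pair product is 1, while the pair product of its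
  -- pullback along σ is χ(σ).
  set C : Fin k → Fin k → K := fun x y =>
    if y < x then -(-1 : K) ^ ((1 - (deg (β x) : ℤ)) * (1 - (deg (β y) : ℤ))) else 1 with hC
  -- The product S · C has exactly the exchange sign of the generators t: the exponents |β_y|(|β_x|
  -- - 1) and |β_x|(|β_y| - 1), together with the antisymmetric sign in the shifted degrees, leave
  -- |β_x||β_y| modulo two.
  have hlt : ∀ x y : Fin k, x < y →
      S x y * C x y = (-1 : K) ^ (deg (β x) * deg (β y)) * (S y x * C y x) := by
    intro x y hxy
    have e1 : ((deg (β x) - 1 : ℕ) : ℤ) = deg (β x) - 1 := by simp [deg]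
    have e2 : ((deg (β y) - 1 : ℕ) : ℤ) = deg (β y) - 1 := by simp [deg]
    simp only [hS, hC, if_pos hxy, if_neg hxy.not_gt, mul_one]
    have e3 : ∀ z : ℤ, -(-1 : K) ^ z = (-1 : K) ^ (z + 1) := fun z => by
      rw [zpow_add_one₀ (neg_ne_zero.mpr one_ne_zero), mul_neg_one]
    simp only [e3, ← zpow_natCast, ← zpow_add₀ (neg_ne_zero.mpr (one_ne_zero (α := K)))]
    apply neg_one_zpow_congr
    push_cast [e1, e2]
    refine ⟨deg (β x) - 1 - deg (β x) * deg (β y), ?_⟩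
    ring
  have hmain := pairProd_smul_prod_ofFn_comp
    (fun j => (FreeGCA.gen wdeg (Sum.inl (β j)) : Weil K ι)) (fun j => deg (β j))
    (fun x y => S x y * C x y) (fun x y => FreeGCA.gen_comm wdeg _ _)
    (fun x y => by
      simp only [hS, hC]
      split_ifs <;> simp [zpow_ne_zero])
    (fun x y hxy => by
      rcases lt_or_gt_of_ne hxy with h | h
      · exact hlt x y h
      · rw [hlt y x h, ← mul_assoc, mul_comm (deg (β y)), ← mul_pow]
        simp) σ
  have hC1 : pairProd C = 1 := pairProd_eq_one fun i j h => by simp [hC, h.not_gt]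
  have hCσ : (pairProd fun j l => C (σ j) (σ l)) = chi σ fun j => 1 - (deg (β j) : ℤ) := by
    rw [chi_eq_pairProd]
  have hL : (pairProd fun j l => S (σ j) (σ l) * C (σ j) (σ l)) =
      (pairProd fun j l => S (σ j) (σ l)) * chi σ fun j => 1 - (deg (β j) : ℤ) := by
    rw [← hCσ]
    exact pairProd_mul (fun j l => S (σ j) (σ l)) fun j l => C (σ j) (σ l)
  have hR : (pairProd fun j l => S j l * C j l) = pairProd S := by
    rw [← mul_one (pairProd S), ← hC1]
    exact pairProd_mul S C
  rw [hR] at hmain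
  rw [hL] at hmain
  have hmon : ∀ γ : Fin k → Σ n, ι n,
      (FreeGCA.mon wdeg (List.ofFn fun j => Sum.inl (γ j)) : Weil K ι) =
        (List.ofFn fun j => (FreeGCA.gen wdeg (Sum.inl (γ j)) : Weil K ι)).prod := by
    intro γ
    rw [FreeGCA.mon, List.map_ofFn]
    rfl
  have hsum : ∑ j, deg ((β ∘ σ) j) = ∑ j, deg (β j) := Equiv.sum_comp σ fun j => deg (β j)
  have hS' : (pairProd fun j l => (-1 : K) ^ (deg ((β ∘ σ) l) * (deg ((β ∘ σ) j) - 1))) =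
      pairProd fun j l => S (σ j) (σ l) := rfl
  have hS1 : (pairProd fun j l => (-1 : K) ^ (deg (β l) * (deg (β j) - 1))) = pairProd S := rfl
  have hl : (List.ofFn ((fun j => (FreeGCA.gen wdeg (Sum.inl (β j)) : Weil K ι)) ∘ σ)) =
      List.ofFn fun j => (FreeGCA.gen wdeg (Sum.inl (β (σ j))) : Weil K ι) := rfl
  rw [hl] at hmain
  rw [hmon, hmon (fun j => β (σ j)), neg_one_pow_signExp, neg_one_pow_signExp, hsum, hS', hS1,
    mul_right_comm, mul_smul, ← hmain, smul_smul]
  congr 1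
  rw [mul_assoc, mul_left_comm (chi σ _), chi_mul_self, mul_one]

end DGLie

namespace DGLie

variable {K : Type*} [Field K] {G : Type*} [AddCommGroup G] [Module K G]
  {gr : ℤ → Submodule K G} [DirectSum.Decomposition gr] (L : DGLie K gr)
  {ι : ℕ → Type*} [∀ n, Fintype (ι n)]
  (b : ∀ n : ℕ, Module.Basis (ι n) K (gr (-((n : ℤ) + 1))))

/-! ### Index sets -/

/-- The basis elements of degree `n`. -/
def lvl (ι : ℕ → Type*) [∀ n, Fintype (ι n)] (n : ℕ) : Finset (Σ n, ι n) :=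
  ((Finset.range n).filter fun m => m + 1 = n).sigma fun _ => Finset.univ

theorem mem_lvl {n : ℕ} {α : Σ n, ι n} : α ∈ lvl ι n ↔ deg α = n := by
  simp only [lvl, Finset.mem_sigma, Finset.mem_filter, Finset.mem_range, Finset.mem_univ, and_true,
    deg]
  omega

theorem mem_upTo {n : ℕ} {α : Σ n, ι n} : α ∈ upTo ι n ↔ deg α ≤ n := by
  simp only [upTo, Finset.mem_sigma, Finset.mem_range, Finset.mem_univ, and_true, deg]
  omega

theorem deg_pos (α : Σ n, ι n) : 0 < deg α := Nat.succ_pos _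

theorem lvl_zero : lvl ι 0 = ∅ := by
  ext α
  simp [mem_lvl, (deg_pos α).ne']

theorem sum_lvl_succ {M : Type*} [AddCommMonoid M] (m : ℕ) (f : (Σ n, ι n) → M) :
    ∑ α ∈ lvl ι (m + 1), f α = ∑ i : ι m, f ⟨m, i⟩ := by
  have : ((Finset.range (m + 1)).filter fun k => k + 1 = m + 1) = {m} := by
    ext k
    simp only [Finset.mem_filter, Finset.mem_range, Finset.mem_singleton]
    omega
  rw [lvl, Finset.sum_sigma, this, Finset.sum_singleton]

theorem sum_upTo_upTo {M : Type*} [AddCommMonoid M] (n : ℕ) (f : (Σ n, ι n) → (Σ n, ι n) → M)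
    (hf : ∀ β γ, deg β + deg γ ≠ n → f β γ = 0) :
    ∑ β ∈ upTo ι n, ∑ γ ∈ upTo ι n, f β γ =
      ∑ x ∈ antidiagonal n, ∑ β ∈ lvl ι x.1, ∑ γ ∈ lvl ι x.2, f β γ := by
  classical
  rw [← Finset.sum_product', Finset.sum_congr rfl fun x _ => (Finset.sum_product' _ _ _).symm,
    Finset.sum_sigma']
  symm
  refine Finset.sum_of_injOn (fun x => x.2) ?_ ?_ ?_ ?_
  · rintro ⟨⟨i, j⟩, ⟨β, γ⟩⟩ h ⟨⟨i', j'⟩, ⟨β', γ'⟩⟩ h' e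
    simp only [Finset.coe_sigma, Set.mem_sigma_iff, Finset.mem_coe, Finset.mem_product,
      mem_lvl] at h h'
    obtain ⟨-, rfl, rfl⟩ := h
    obtain ⟨-, rfl, rfl⟩ := h'
    simp only [Prod.mk.injEq] at e
    obtain ⟨rfl, rfl⟩ := e
    rfl
  · rintro ⟨⟨i, j⟩, ⟨β, γ⟩⟩ h
    simp only [Finset.coe_sigma, Set.mem_sigma_iff, Finset.mem_coe, Finset.mem_product,
      mem_lvl, mem_antidiagonal, mem_upTo] at h ⊢
    omega
  · rintro ⟨β, γ⟩ _ h
    apply hf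
    intro e
    apply h
    refine ⟨⟨(deg β, deg γ), (β, γ)⟩, ?_, rfl⟩
    simp [mem_lvl, e]
  · intros
    rfl

/-! ### Coefficients -/

theorem tau_mem (α : Σ n, ι n) : tau b α ∈ gr (-(deg α : ℤ)) := by
  have := (b α.1 α.2).2
  simpa [tau, deg] using this

/-- The coefficient of `τ_α`, as a linear map. -/
def coefLin (α : Σ n, ι n) : G →ₗ[K] K where
  toFun := coef b α
  map_add' x y := by simp [coef, DirectSum.decompose_add]
  map_smul' r x := by simp [coef, DirectSum.decompose_smul, DirectSum.smul_apply]

theorem coefLin_apply (α : Σ n, ι n) (x : G) : coefLin b α x = coef b α x := rfl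

theorem coef_eq_zero {α : Σ n, ι n} {k : ℤ} {x : G} (hx : x ∈ gr k) (h : k ≠ -(deg α : ℤ)) :
    coef b α x = 0 := by
  rw [coef, DirectSum.decompose_of_mem gr hx, DirectSum.of_eq_of_ne, map_zero, Finsupp.zero_apply]
  intro e
  apply h
  rw [← e, deg]
  push_cast
  rfl

theorem coef_tau (α : Σ n, ι n) : coef b α (tau b α) = 1 := by
  classical
  rw [coef, tau, DirectSum.decompose_of_mem gr (b α.1 α.2).2, DirectSum.of_eq_same]
  simp

theorem coef_tau_ne {α β : Σ n, ι n} (h : α ≠ β) : coef b α (tau b β) = 0 := by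
  classical
  by_cases hd : deg α = deg β
  · obtain ⟨n, i⟩ := α
    obtain ⟨m, j⟩ := β
    obtain rfl : n = m := by simpa [deg] using hd
    rw [coef, tau, DirectSum.decompose_of_mem gr (b n j).2, DirectSum.of_eq_same]
    have : j ≠ i := fun e => h (by rw [e])
    simp [this]
  · exact coef_eq_zero b (tau_mem b β) (by simpa using fun e => hd e.symm)

theorem sum_coef_smul_tau {n : ℕ} (hn : 0 < n) {x : G} (hx : x ∈ gr (-(n : ℤ))) :
    ∑ α ∈ lvl ι n, coef b α x • tau b α = x := by
  obtain ⟨m, rfl⟩ : ∃ m, n = m + 1 := ⟨n - 1, by omega⟩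
  rw [sum_lvl_succ]
  have hx' : x ∈ gr (-((m : ℤ) + 1)) := by simpa using hx
  have : ∀ i : ι m, coef b ⟨m, i⟩ x = (b m).repr ⟨x, hx'⟩ i := by
    intro i
    rw [coef, DirectSum.decompose_of_mem gr hx', DirectSum.of_eq_same]
  simp only [this, tau]
  have h2 := congrArg Subtype.val ((b m).sum_repr ⟨x, hx'⟩)
  rw [AddSubmonoidClass.coe_finsetSum] at h2
  exact h2

/-- The component `W ⊗ G → W` along `τ_α`. -/
def component (W : Type*) [AddCommGroup W] [Module K W] (α : Σ n, ι n) : W ⊗[K] G →ₗ[K] W :=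
  (TensorProduct.rid K W).toLinearMap ∘ₗ (coefLin b α).lTensor W

/-! ### Components of tensors along the basis τ -/

section component

variable {W : Type*} [AddCommGroup W] [Module K W]

theorem component_tmul (α : Σ n, ι n) (w : W) (x : G) :
    component b W α (w ⊗ₜ x) = coef b α x • w := by
  simp [component, coefLin_apply]

/-- The elements of degree `k`. -/
def gpart (W : Type*) [AddCommGroup W] [Module K W] (gr : ℤ → Submodule K G) (k : ℤ) :
    Submodule K (W ⊗[K] G) :=
  Submodule.span K {X | ∃ (w : W) (x : G), x ∈ gr k ∧ X = w ⊗ₜ x}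

theorem tmul_mem_gpart {k : ℤ} {x : G} (hx : x ∈ gr k) (w : W) : w ⊗ₜ[K] x ∈ gpart W gr k :=
  Submodule.subset_span ⟨w, x, hx, rfl⟩

/-- The sequence with components `∑ α, X α ⊗ τ_α`, the sum being over the `α` of degree `n`. -/
def toSeq : ((Σ n, ι n) → W) →ₗ[K] (ℕ → W ⊗[K] G) where
  toFun X n := ∑ α ∈ lvl ι n, X α ⊗ₜ tau b α
  map_add' X Y := by
    ext n
    simp [TensorProduct.add_tmul, Finset.sum_add_distrib]
  map_smul' r X := by
    ext n
    simp [TensorProduct.smul_tmul', Finset.smul_sum]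

theorem toSeq_apply (X : (Σ n, ι n) → W) (n : ℕ) :
    toSeq b X n = ∑ α ∈ lvl ι n, X α ⊗ₜ tau b α := rfl

theorem toSeq_zero_apply (X : (Σ n, ι n) → W) : toSeq b X 0 = 0 := by
  rw [toSeq_apply, lvl_zero, Finset.sum_empty]

theorem toSeq_mem_gpart (X : (Σ n, ι n) → W) (n : ℕ) :
    toSeq b X n ∈ gpart W gr (-(n : ℤ)) := by
  refine sum_mem fun α hα => ?_
  rw [← mem_lvl.mp hα]
  exact tmul_mem_gpart (tau_mem b α) _

theorem component_toSeq (X : (Σ n, ι n) → W) (α : Σ n, ι n) :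
    component b W α (toSeq b X (deg α)) = X α := by
  rw [toSeq_apply, map_sum, Finset.sum_eq_single α]
  · rw [component_tmul, coef_tau, one_smul]
  · intro β _ hβ
    rw [component_tmul, coef_tau_ne b hβ.symm, zero_smul]
  · intro h
    exact absurd (mem_lvl.mpr rfl) h

theorem toSeq_component {n : ℕ} (hn : 0 < n) {Y : W ⊗[K] G} (hY : Y ∈ gpart W gr (-(n : ℤ))) :
    ∑ α ∈ lvl ι n, component b W α Y ⊗ₜ[K] tau b α = Y := by
  induction hY using Submodule.span_induction with
  | mem Y hY =>
    obtain ⟨w, x, hx, rfl⟩ := hY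
    conv_rhs => rw [← sum_coef_smul_tau b hn hx, TensorProduct.tmul_sum]
    refine Finset.sum_congr rfl fun α _ => ?_
    rw [component_tmul, TensorProduct.smul_tmul]
  | zero => simp
  | add Y Z _ _ hY hZ =>
    simp only [map_add, TensorProduct.add_tmul, Finset.sum_add_distrib, hY, hZ]
  | smul r Y _ hY =>
    simp only [map_smul, ← TensorProduct.smul_tmul', ← Finset.smul_sum, hY]

/-- For n > 0 the τ_α with |α| = n form a basis of the degree -n part of G. Degree zero is excluded
because the basis covers only negative degrees. -/
theorem gpart_ext {n : ℕ} (hn : 0 < n) {Y Z : W ⊗[K] G} (hY : Y ∈ gpart W gr (-(n : ℤ)))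
    (hZ : Z ∈ gpart W gr (-(n : ℤ)))
    (h : ∀ α : Σ n, ι n, deg α = n → component b W α Y = component b W α Z) : Y = Z := by
  rw [← toSeq_component b hn hY, ← toSeq_component b hn hZ]
  exact Finset.sum_congr rfl fun α hα => by rw [h α (mem_lvl.mp hα)]

theorem rTensor_toSeq (f : W →ₗ[K] W) (X : (Σ n, ι n) → W) (n : ℕ) :
    f.rTensor G (toSeq b X n) = toSeq b (fun α => f (X α)) n := by
  simp [toSeq_apply]

end component

/-! ### Degrees of differentials, brackets and power series in A -/

section gpart

variable {J : Type*} (p : J → ℕ)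

theorem td_mem_gpart {k : ℤ} {X : FreeGCA K p ⊗[K] G} (hX : X ∈ gpart (FreeGCA K p) gr k) :
    L.td p X ∈ gpart (FreeGCA K p) gr (k + 1) := by
  induction hX using Submodule.span_induction with
  | mem X hX =>
    obtain ⟨w, x, hx, rfl⟩ := hX
    exact tmul_mem_gpart (L.d_mem k x hx) _
  | zero => simp
  | add X Y _ _ hX hY => rw [map_add]; exact add_mem hX hY
  | smul r X _ hX => rw [map_smul]; exact Submodule.smul_mem _ _ hX

theorem tbr_mem_gpart {k l : ℤ} {X Y : FreeGCA K p ⊗[K] G}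
    (hX : X ∈ gpart (FreeGCA K p) gr k) (hY : Y ∈ gpart (FreeGCA K p) gr l) :
    L.tbr p X Y ∈ gpart (FreeGCA K p) gr (k + l) := by
  refine Submodule.span_induction₂
    (p := fun X Y _ _ => L.tbr p X Y ∈ gpart (FreeGCA K p) gr (k + l)) ?_ ?_ ?_ ?_ ?_ ?_ ?_ hX hY
  · rintro _ _ ⟨v, x, hx, rfl⟩ ⟨w, y, hy, rfl⟩
    have h := L.br_mem k l x hx y hy
    simp only [tbr, LinearMap.add_apply, TensorProduct.map₂_apply_tmul, LinearMap.comp_apply,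
      scale_apply _ hx, map_smul, TensorProduct.map_tmul, LinearMap.smul_apply]
    exact add_mem (tmul_mem_gpart (Submodule.smul_mem _ _ h) _)
      (tmul_mem_gpart (Submodule.smul_mem _ _ h) _)
  · intro Y _; simp
  · intro X _; simp
  · intro X Y Z _ _ _ hX hY
    rw [map_add, LinearMap.add_apply]; exact add_mem hX hY
  · intro X Y Z _ _ _ hX hY
    rw [map_add]; exact add_mem hX hY
  · intro r X Y _ _ h
    rw [map_smul, LinearMap.smul_apply]; exact Submodule.smul_mem _ _ h
  · intro r X Y _ _ h
    rw [map_smul]; exact Submodule.smul_mem _ _ h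

/-- Sequences whose `n`-th component has degree `c - n` are preserved by `-[-, T]`. -/
theorem negAd_mem_gpart {T : ℕ → FreeGCA K p ⊗[K] G}
    (hT : ∀ n : ℕ, T n ∈ gpart (FreeGCA K p) gr (-(n : ℤ))) {c : ℤ} {X : ℕ → FreeGCA K p ⊗[K] G}
    (hX : ∀ n : ℕ, X n ∈ gpart (FreeGCA K p) gr (c - n)) (n : ℕ) :
    negAd (L.tbr p) T X n ∈ gpart (FreeGCA K p) gr (c - n) := by
  rw [negAd_apply, Pi.neg_apply, conv_apply]
  refine neg_mem (sum_mem fun x hx => ?_)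
  have h := L.tbr_mem_gpart p (hX x.1) (hT x.2)
  rw [← mem_antidiagonal.mp hx]
  rw [show c - ((x.1 + x.2 : ℕ) : ℤ) = c - x.1 + -(x.2 : ℤ) by push_cast; ring]
  exact h

theorem act_mem_gpart {T : ℕ → FreeGCA K p ⊗[K] G}
    (hT : ∀ n : ℕ, T n ∈ gpart (FreeGCA K p) gr (-(n : ℤ))) {c : ℤ} {X : ℕ → FreeGCA K p ⊗[K] G}
    (hX : ∀ n : ℕ, X n ∈ gpart (FreeGCA K p) gr (c - n)) (f : PowerSeries K) (n : ℕ) :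
    act id (negAd (L.tbr p) T) f X n ∈ gpart (FreeGCA K p) gr (c - n) := by
  change ∑ k ∈ Finset.range (n + 1), _ ∈ _
  refine sum_mem fun k _ => Submodule.smul_mem _ _ ?_
  have : ∀ k n : ℕ, (negAd (L.tbr p) T ^ k) X n ∈ gpart (FreeGCA K p) gr (c - n) := by
    intro k
    induction k with
    | zero => exact hX
    | succ k ih =>
      intro n
      rw [pow_succ', Module.End.mul_apply]
      exact L.negAd_mem_gpart p hT ih n
  exact this k n

end gpart

/-! ### The universal element and the adjustment operator -/

/-- The universal element `∑ α, t^α ⊗ τ_α`. -/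
abbrev tSeq : ℕ → Weil K ι ⊗[K] G := toSeq b (t K)

theorem hasParity_t (α : Σ n, ι n) : FreeGCA.HasParity wdeg (deg α) (t K α) :=
  FreeGCA.HasParity.gen wdeg (Sum.inl α)

theorem toSeq_mem_par {m : ℤ} {X : (Σ n, ι n) → Weil K ι} {c : ℕ}
    (hX : ∀ α, FreeGCA.HasParity wdeg (deg α + c) (X α)) (hc : Even (c - m)) (n : ℕ) :
    toSeq b X n ∈ par wdeg gr m := by
  refine sum_mem fun α _ => tmul_mem_par wdeg (hX α) (tau_mem b α) ?_
  convert hc using 1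
  push_cast
  ring

theorem tSeq_mem_par (n : ℕ) : tSeq b n ∈ par wdeg gr 0 :=
  toSeq_mem_par b (m := 0) (c := 0) hasParity_t (by simp) n

theorem negAd_toSeq_apply (X : (Σ n, ι n) → Weil K ι) (n : ℕ) :
    negAd (L.tbr wdeg) (tSeq b) (toSeq b X) n = -∑ x ∈ antidiagonal n, ∑ β ∈ lvl ι x.1,
      ∑ γ ∈ lvl ι x.2, (-1 : K) ^ (deg β * deg γ) •
        ((X β * t K γ) ⊗ₜ[K] L.br (tau b β) (tau b γ)) := by
  rw [negAd_apply, Pi.neg_apply, conv_apply]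
  congr 1
  refine Finset.sum_congr rfl fun x _ => ?_
  rw [toSeq_apply, map_sum, LinearMap.sum_apply]
  refine Finset.sum_congr rfl fun β _ => ?_
  rw [tSeq, toSeq_apply, map_sum]
  refine Finset.sum_congr rfl fun γ _ => ?_
  rw [L.tbr_tmul wdeg (hasParity_t γ) (tau_mem b β)]
  congr 1
  rw [← zpow_natCast]
  apply neg_one_zpow_congr
  push_cast
  exact ⟨-(deg β * deg γ : ℤ), by ring⟩

theorem br_tau_mem (β γ : Σ n, ι n) :
    L.br (tau b β) (tau b γ) ∈ gr (-((deg β + deg γ : ℕ) : ℤ)) := by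
  have := L.br_mem _ _ _ (tau_mem b β) _ (tau_mem b γ)
  convert this using 2
  push_cast
  ring

theorem neg_neg_one_zpow (z : ℤ) : -(-1 : K) ^ z = (-1 : K) ^ (z + 1) := by
  rw [zpow_add_one₀ (neg_ne_zero.mpr one_ne_zero), mul_neg_one]

/-- The alternator sign (-1)^{1-|β|} turns (-1)^{|β|(|γ|+1)} into minus the Koszul sign
(-1)^{|β||γ|} of a bracket with T. This is what makes 2S equal to -[-, T]. -/
theorem adjData_eq (α β γ : Σ n, ι n) :
    L.adjData b α β γ =
      -(1 / 2 * ((-1 : K) ^ (deg β * deg γ) * coef b α (L.br (tau b β) (tau b γ)))) := by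
  rw [adjData, L.alternator_apply (tau_mem b β), ← coefLin_apply, map_smul, coefLin_apply,
    smul_eq_mul, mul_assoc, ← mul_assoc (_ ^ _), ← mul_neg, ← neg_mul]
  congr 2
  rw [← zpow_natCast, ← zpow_natCast, neg_neg_one_zpow, ← zpow_add₀ (by simp)]
  apply neg_one_zpow_congr
  push_cast
  exact ⟨0, by ring⟩

theorem adjData_eq_zero {α β γ : Σ n, ι n} (h : deg β + deg γ ≠ deg α) :
    L.adjData b α β γ = 0 := by
  rw [adjData_eq, coef_eq_zero b (L.br_tau_mem b β γ), mul_zero, mul_zero, neg_zero]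
  omega

/-- The adjustment operator as a linear map. -/
def adjLin : ((Σ n, ι n) → Weil K ι) →ₗ[K] ((Σ n, ι n) → Weil K ι) where
  toFun := L.adjOp b
  map_add' X Y := by
    ext α
    simp [adjOp, add_mul, Finset.sum_add_distrib]
  map_smul' r X := by
    ext α
    simp [adjOp, Finset.smul_sum, smul_comm r]

theorem adjLin_apply (X : (Σ n, ι n) → Weil K ι) : L.adjLin b X = L.adjOp b X := rfl

/-- The factor t^γ has positive degree, so S only uses components of smaller degree. The weight of α
is |α| - 1, which is the last power of S in the coordinate change. -/
theorem isLowering_adjLin (c : K) : IsLowering Sigma.fst (c • L.adjLin b) := by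
  intro X α hX
  rw [LinearMap.smul_apply, Pi.smul_apply, adjLin_apply, adjOp, Finset.sum_eq_zero, smul_zero]
  refine fun β _ => Finset.sum_eq_zero fun γ _ => ?_
  by_cases h : deg β + deg γ = deg α
  · rw [hX β, zero_mul, smul_zero]
    simp only [deg] at h
    omega
  · rw [L.adjData_eq_zero b h, zero_smul]

/-- The adjustment operator is half of the operator `-[-, T]`. -/
theorem toSeq_adjLin [CharZero K] (X : (Σ n, ι n) → Weil K ι) :
    toSeq b (((2 : K) • L.adjLin b) X) = negAd (L.tbr wdeg) (tSeq b) (toSeq b X) := by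
  ext n
  rcases Nat.eq_zero_or_pos n with rfl | hn
  · rw [toSeq_zero_apply, negAd_toSeq_apply]
    simp [lvl_zero]
  · have hmem : negAd (L.tbr wdeg) (tSeq b) (toSeq b X) n ∈ gpart (Weil K ι) gr (-(n : ℤ)) := by
      have := L.negAd_mem_gpart wdeg (toSeq_mem_gpart b (t K)) (c := 0) (X := toSeq b X)
        (fun n => by simpa using toSeq_mem_gpart b X n) n
      simpa using this
    refine gpart_ext b hn (toSeq_mem_gpart b _ n) hmem fun α hα => ?_
    subst hα
    rw [component_toSeq, negAd_toSeq_apply, LinearMap.smul_apply, Pi.smul_apply, adjLin_apply,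
      adjOp, sum_upTo_upTo _ _ fun β γ h => by rw [L.adjData_eq_zero b h, zero_smul]]
    simp only [map_neg, map_sum, Finset.smul_sum, ← Finset.sum_neg_distrib]
    refine Finset.sum_congr rfl fun x _ => Finset.sum_congr rfl fun β _ =>
      Finset.sum_congr rfl fun γ _ => ?_
    rw [map_smul, component_tmul, adjData_eq, smul_smul, smul_smul, ← neg_smul]
    congr 1
    ring

theorem toSeq_adjLin_pow [CharZero K] (X : (Σ n, ι n) → Weil K ι) (n : ℕ) :
    toSeq b ((((2 : K) • L.adjLin b) ^ n) X) =
      (negAd (L.tbr wdeg) (tSeq b) ^ n) (toSeq b X) := by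
  induction n with
  | zero => rfl
  | succ n ih =>
    rw [pow_succ', pow_succ', Module.End.mul_apply, Module.End.mul_apply, toSeq_adjLin, ih]

theorem toSeq_act [CharZero K] (f : PowerSeries K) (X : (Σ n, ι n) → Weil K ι) :
    toSeq b (act Sigma.fst ((2 : K) • L.adjLin b) f X) =
      act id (negAd (L.tbr wdeg) (tSeq b)) f (toSeq b X) := by
  ext n
  have h : ∀ α ∈ lvl ι n, act Sigma.fst ((2 : K) • L.adjLin b) f X α =
      ∑ k ∈ Finset.range (n + 1),
        PowerSeries.coeff k f • (((2 : K) • L.adjLin b) ^ k) X α := by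
    intro α hα
    refine (L.isLowering_adjLin b 2).act_eq_sum f X ?_
    have := mem_lvl.mp hα
    simp only [deg] at this
    omega
  rw [toSeq_apply]
  have h' := Finset.sum_congr rfl fun α hα => congrArg (· ⊗ₜ[K] tau b α) (h α hα)
  refine h'.trans ?_
  change _ = ∑ k ∈ Finset.range (n + 1), _
  simp only [← toSeq_adjLin_pow, toSeq_apply, TensorProduct.sum_tmul, Finset.smul_sum,
    TensorProduct.smul_tmul']
  exact Finset.sum_comm

end DGLie

namespace DGLie

variable {K : Type*} [Field K] {G : Type*} [AddCommGroup G] [Module K G]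
  {gr : ℤ → Submodule K G} [DirectSum.Decomposition gr] (L : DGLie K gr)
  {ι : ℕ → Type*} [∀ n, Fintype (ι n)]
  (b : ∀ n : ℕ, Module.Basis (ι n) K (gr (-((n : ℤ) + 1))))

/-! ### Sums over index tuples -/

open Classical in
/-- The index tuples of total degree `n`. -/
def tup (ι : ℕ → Type*) [∀ n, Fintype (ι n)] (k n : ℕ) : Finset (Fin k → Σ n, ι n) :=
  (Fintype.piFinset fun _ : Fin k => upTo ι n).filter fun β => ∑ j, deg (β j) = n

theorem tuples_eq (α : Σ n, ι n) (k : ℕ) : tuples α k = tup ι k (deg α + 1) := rfl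

theorem mem_tup {k n : ℕ} {β : Fin k → Σ n, ι n} : β ∈ tup ι k n ↔ ∑ j, deg (β j) = n := by
  rw [tup, Finset.mem_filter, Fintype.mem_piFinset, and_iff_right_iff_imp]
  rintro rfl j
  rw [mem_upTo]
  exact Finset.single_le_sum (f := fun j => deg (β j)) (fun _ _ => Nat.zero_le _)
    (Finset.mem_univ j)

theorem sum_tup_succ {M : Type*} [AddCommMonoid M] (k n : ℕ)
    (f : (Fin (k + 1) → Σ n, ι n) → M) :
    ∑ β ∈ tup ι (k + 1) n, f β = ∑ x ∈ antidiagonal n, ∑ β ∈ tup ι k x.1, ∑ γ ∈ lvl ι x.2,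
      f (Fin.snoc (α := fun _ => Σ n, ι n) β γ) := by
  rw [Finset.sum_congr rfl fun x _ => (Finset.sum_product' _ _ _).symm, Finset.sum_sigma']
  symm
  refine Finset.sum_nbij' (fun x => Fin.snoc (α := fun _ => Σ n, ι n) x.2.1 x.2.2)
    (fun β => ⟨(∑ j, deg (Fin.init β j), deg (β (Fin.last k))),
      (Fin.init β, β (Fin.last k))⟩) ?_ ?_ ?_ ?_ ?_
  · rintro ⟨⟨i, j⟩, ⟨β, γ⟩⟩ h
    simp only [Finset.mem_sigma, mem_antidiagonal, Finset.mem_product, mem_tup, mem_lvl] at h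
    obtain ⟨rfl, rfl, rfl⟩ := h
    rw [mem_tup, Fin.sum_univ_castSucc]
    simp
  · intro β h
    rw [mem_tup, Fin.sum_univ_castSucc] at h
    simp only [Finset.mem_sigma, mem_antidiagonal, Finset.mem_product, mem_tup, mem_lvl, and_true]
    exact h
  · rintro ⟨⟨i, j⟩, ⟨β, γ⟩⟩ h
    simp only [Finset.mem_sigma, mem_antidiagonal, Finset.mem_product, mem_tup, mem_lvl] at h
    obtain ⟨-, rfl, rfl⟩ := h
    simp
  · intro β _
    simp
  · intro x _
    rfl

theorem sum_tup_one {M : Type*} [AddCommMonoid M] (n : ℕ) (f : (Fin 1 → Σ n, ι n) → M) :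
    ∑ β ∈ tup ι 1 n, f β = ∑ γ ∈ lvl ι n, f fun _ => γ := by
  refine Finset.sum_nbij' (fun β => β 0) (fun γ _ => γ) ?_ ?_ ?_ ?_ ?_
  · intro β h
    simpa [mem_tup, mem_lvl] using h
  · intro γ h
    simpa [mem_tup, mem_lvl] using h
  · intro β _
    ext j
    · rw [Subsingleton.elim j 0]
    · rw [Subsingleton.elim j 0]
  · intro γ _
    rfl
  · intro β _
    congr 1
    funext j
    rw [Subsingleton.elim j 0]

/-! ### Nested products -/

theorem delta_tau (β : Σ n, ι n) :
    L.delta (tau b β) = if deg β = 1 then L.d (tau b β) else 0 := by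
  rw [L.delta_apply (tau_mem b β)]
  congr 1
  simp only [neg_inj, Nat.cast_eq_one]

theorem nested_append {l : List G} (hl : 2 ≤ l.length) (z : G) :
    L.nested (l ++ [z]) = L.alternator (L.nested l) z := by
  match l, hl with
  | x :: y :: l, _ => simp [nested, List.foldl_append]

/-- The nested product of basis vectors. -/
def nestedTau {k : ℕ} (β : Fin k → Σ n, ι n) : G := L.nested (List.ofFn fun j => tau b (β j))

theorem nestedTau_snoc {k : ℕ} (β : Fin (k + 2) → Σ n, ι n) (γ : Σ n, ι n) :
    L.nestedTau b (Fin.snoc (α := fun _ => Σ n, ι n) β γ) =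
      L.alternator (L.nestedTau b β) (tau b γ) := by
  rw [nestedTau, List.ofFn_succ', List.concat_eq_append, nested_append _ (by simp)]
  simp [nestedTau]

theorem nestedTau_two (β γ : Σ n, ι n) :
    L.nestedTau b (Fin.snoc (α := fun _ => Σ n, ι n) (fun _ : Fin 1 => β) γ) =
      L.br (L.delta (tau b β)) (tau b γ) := by
  have h : List.ofFn (fun j => tau b (Fin.snoc (α := fun _ => Σ n, ι n) (fun _ : Fin 1 => β) γ j)) =
      [tau b β, tau b γ] := by
    rw [List.ofFn_succ', List.ofFn_succ, List.ofFn_zero, Fin.snoc_last, Fin.snoc_castSucc]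
    rfl
  rw [nestedTau, h]
  rfl

theorem nestedTau_mem {k : ℕ} (β : Fin (k + 2) → Σ n, ι n) :
    L.nestedTau b β ∈ gr (1 - ((∑ j, deg (β j) : ℕ) : ℤ)) := by
  induction k with
  | zero =>
    obtain ⟨β, γ, rfl⟩ : ∃ β' γ', β = Fin.snoc (α := fun _ => Σ n, ι n) (fun _ : Fin 1 => β') γ' :=
      ⟨β 0, β 1, by funext j; fin_cases j <;> rfl⟩
    rw [nestedTau_two, delta_tau, Fin.sum_univ_castSucc]
    split_ifs with h
    · have := L.br_mem _ _ _ (L.d_mem _ _ (tau_mem b β)) _ (tau_mem b γ)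
      convert this using 2
      simp only [Fin.snoc_castSucc, Fin.snoc_last, Finset.univ_unique, Finset.sum_singleton]
      push_cast
      ring
    · simp
  | succ k ih =>
    obtain ⟨β, γ, rfl⟩ : ∃ β' γ', β = Fin.snoc (α := fun _ => Σ n, ι n) β' γ' :=
      ⟨Fin.init β, β (Fin.last _), (Fin.snoc_init_self β).symm⟩
    rw [nestedTau_snoc, L.alternator_apply (ih β), Fin.sum_univ_castSucc]
    refine Submodule.smul_mem _ _ ?_
    have := L.br_mem _ _ _ (ih β) _ (tau_mem b γ)
    convert this using 2
    simp
    ring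

/-- The induction over nested products appends one index at a time; this is the change of the
exponent. The identity is stated in ℤ so that the truncated differences |β_j| - 1 become genuine
ones. -/
theorem signExp_snoc {k : ℕ} (β : Fin k → Σ n, ι n) (γ : Σ n, ι n) :
    ((signExp (Fin.snoc (α := fun _ => Σ n, ι n) β γ) : ℕ) : ℤ) =
      signExp β + (∑ j, deg (β j) : ℕ) + deg γ + (∑ j, deg (β j) : ℕ) * deg γ := by
  have h : ∀ j, ((deg (β j) - 1 : ℕ) : ℤ) = deg (β j) - 1 := fun j => by simp [deg]
  simp only [signExp, Fin.sum_univ_castSucc, Fin.snoc_castSucc, Fin.snoc_last,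
    Fin.castSucc_lt_castSucc_iff, Fin.castSucc_lt_last, if_true, (Fin.castSucc_lt_last _).not_gt,
    lt_irrefl, if_false, add_zero, ← Finset.mul_sum]
  push_cast [h]
  simp only [Finset.sum_sub_distrib, Finset.sum_const, Finset.card_univ, Fintype.card_fin,
    nsmul_eq_mul, mul_one]
  ring

/-! ### The Chevalley–Eilenberg differential -/

/-- The monomial `t^{β₁} ⋯ t^{β_k}`. -/
def tMon (K : Type*) [Field K] {k : ℕ} (β : Fin k → Σ n, ι n) : Weil K ι :=
  FreeGCA.mon wdeg (List.ofFn fun j => Sum.inl (β j))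

theorem tMon_snoc {k : ℕ} (β : Fin k → Σ n, ι n) (γ : Σ n, ι n) :
    tMon K (Fin.snoc (α := fun _ => Σ n, ι n) β γ) = tMon K β * t K γ := by
  rw [tMon, List.ofFn_succ', List.concat_eq_append, FreeGCA.mon_append]
  simp [tMon, FreeGCA.mon, t]

theorem tMon_one (β : Σ n, ι n) : tMon K (fun _ : Fin 1 => β) = t K β := by
  simp [tMon, FreeGCA.mon, t]

/-- The sequence whose only nonzero component is `δ T` in degree one. -/
def dSeq : ℕ → Weil K ι ⊗[K] G := fun n => if n = 1 then L.td wdeg (tSeq b 1) else 0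

theorem dSeq_one : L.dSeq b 1 = L.td wdeg (tSeq b 1) := rfl

theorem dSeq_of_ne {n : ℕ} (hn : n ≠ 1) : L.dSeq b n = 0 := if_neg hn

theorem dSeq_eq (n : ℕ) : L.dSeq b n = -∑ β ∈ lvl ι n, t K β ⊗ₜ[K] L.delta (tau b β) := by
  by_cases hn : n = 1
  · subst hn
    rw [dSeq_one, tSeq, toSeq_apply, map_sum, ← Finset.sum_neg_distrib]
    refine Finset.sum_congr rfl fun β hβ => ?_
    rw [L.td_tmul wdeg (hasParity_t β), delta_tau, if_pos (mem_lvl.mp hβ), mem_lvl.mp hβ, pow_one]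
    exact neg_one_smul K (t K β ⊗ₜ[K] L.d (tau b β))
  · rw [dSeq_of_ne _ _ hn, Finset.sum_eq_zero, neg_zero]
    intro β hβ
    rw [delta_tau, if_neg (by rw [mem_lvl.mp hβ]; exact hn), TensorProduct.tmul_zero]

theorem sum_nestedTau_two (n : ℕ) :
    ∑ β ∈ tup ι 2 n, (-1 : K) ^ signExp β • (tMon K β ⊗ₜ[K] L.nestedTau b β) =
      negAd (L.tbr wdeg) (tSeq b) (L.dSeq b) n := by
  rw [sum_tup_succ, negAd_apply, Pi.neg_apply, conv_apply, ← Finset.sum_neg_distrib]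
  refine Finset.sum_congr rfl fun x _ => ?_
  rw [sum_tup_one, dSeq_eq, map_neg, LinearMap.neg_apply, neg_neg, map_sum, LinearMap.sum_apply]
  refine Finset.sum_congr rfl fun β _ => ?_
  rw [tSeq, toSeq_apply, map_sum]
  refine Finset.sum_congr rfl fun γ _ => ?_
  rw [nestedTau_two, tMon_snoc, tMon_one, delta_tau]
  split_ifs with h
  · have h0 : L.d (tau b β) ∈ gr 0 := by
      have := L.d_mem _ _ (tau_mem b β)
      rwa [h, show -((1 : ℕ) : ℤ) + 1 = 0 by norm_num] at this
    rw [L.tbr_tmul wdeg (hasParity_t γ) h0, ← zpow_natCast]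
    congr 1
    apply neg_one_zpow_congr
    rw [signExp_snoc]
    simp only [signExp, Finset.univ_unique, Finset.sum_singleton, h, lt_irrefl, if_false]
    push_cast
    exact ⟨1 + deg γ, by ring⟩
  · simp

/-- A product with k + 2 slots contains k + 1 brackets with T: the one in ε₂⁰, applied to δT, and
one for each of the k alternators. In each alternator its sign, the Koszul sign and the change of
`signExp` combine to +[-, T] = -A, whence (-1)^k. -/
theorem sum_nestedTau (k n : ℕ) :
    ∑ β ∈ tup ι (k + 2) n, (-1 : K) ^ signExp β • (tMon K β ⊗ₜ[K] L.nestedTau b β) =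
      (-1 : K) ^ k • (negAd (L.tbr wdeg) (tSeq b) ^ (k + 1)) (L.dSeq b) n := by
  induction k generalizing n with
  | zero => simpa using L.sum_nestedTau_two b n
  | succ k ih =>
    rw [sum_tup_succ, pow_succ' _ (k + 1), Module.End.mul_apply, negAd_apply, Pi.neg_apply,
      conv_apply, pow_succ, mul_neg_one, neg_smul_neg, Finset.smul_sum]
    refine Finset.sum_congr rfl fun x _ => ?_
    rw [← LinearMap.smul_apply, ← map_smul, ← ih, map_sum, LinearMap.sum_apply]
    refine Finset.sum_congr rfl fun β hβ => ?_
    rw [tSeq, toSeq_apply, map_sum]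
    refine Finset.sum_congr rfl fun γ _ => ?_
    rw [nestedTau_snoc, tMon_snoc, L.alternator_apply (L.nestedTau_mem b β),
      TensorProduct.tmul_smul, smul_smul, map_smul, LinearMap.smul_apply,
      L.tbr_tmul wdeg (hasParity_t γ) (L.nestedTau_mem b β), smul_smul, ← zpow_natCast,
      ← zpow_natCast, ← zpow_add₀ (by simp), ← zpow_add₀ (by simp)]
    congr 1
    apply neg_one_zpow_congr
    rw [signExp_snoc]
    exact ⟨1 + (∑ j, deg (β j) : ℕ) * deg γ, by ring⟩

theorem structConst_add_two {k : ℕ} (α : Σ n, ι n) (β : Fin (k + 2) → Σ n, ι n) :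
    L.structConst b α β =
      ((-1 : K) ^ (k + 1) * ((bernoulli (k + 1) : ℚ) : K) / ((k + 1).factorial : K)) *
        ∑ σ : Equiv.Perm (Fin (k + 2)),
          (chi σ fun j => 1 - (deg (β j) : ℤ)) * coef b α (L.nestedTau b (β ∘ σ)) := by
  rw [structConst, mu, ← coefLin_apply, map_smul, map_sum, smul_eq_mul]
  congr 1
  refine Finset.sum_congr rfl fun σ _ => ?_
  rw [map_smul, smul_eq_mul]
  rfl

theorem sum_tup_comp {M : Type*} [AddCommMonoid M] {k n : ℕ} (σ : Equiv.Perm (Fin k))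
    (f : (Fin k → Σ n, ι n) → M) : ∑ β ∈ tup ι k n, f (β ∘ σ) = ∑ β ∈ tup ι k n, f β := by
  refine Finset.sum_nbij' (fun β => β ∘ σ) (fun β => β ∘ σ.symm) ?_ ?_ ?_ ?_ ?_
  · intro β h
    rw [mem_tup] at h ⊢
    rw [← h]
    exact Equiv.sum_comp σ fun j => deg (β j)
  · intro β h
    rw [mem_tup] at h ⊢
    rw [← h]
    exact Equiv.sum_comp σ.symm fun j => deg (β j)
  · intro β _
    funext j
    simp
  · intro β _
    funext j
    simp
  · intro β _
    rfl

/-- By `chi_smul_mon` the summand of σ at β is the summand of the identity at β ∘ σ. After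
relabelling, all (k + 2)! permutations give the same sum, which cancels the factorial in Q_CE. -/
theorem sum_structConst [CharZero K] (k n : ℕ) (α : Σ n, ι n) :
    ∑ β ∈ tup ι (k + 2) n,
        ((1 / ((k + 2).factorial : K)) * (-1) ^ signExp β * L.structConst b α β) • tMon K β =
      ((-1 : K) ^ (k + 1) * ((bernoulli (k + 1) : ℚ) : K) / ((k + 1).factorial : K)) •
        ∑ β ∈ tup ι (k + 2) n, ((-1 : K) ^ signExp β * coef b α (L.nestedTau b β)) • tMon K β := by
  set c : K := (-1 : K) ^ (k + 1) * ((bernoulli (k + 1) : ℚ) : K) / ((k + 1).factorial : K)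
  have h1 : ∀ β : Fin (k + 2) → Σ n, ι n,
      ((1 / ((k + 2).factorial : K)) * (-1) ^ signExp β * L.structConst b α β) • tMon K β =
        (c * (1 / ((k + 2).factorial : K))) • ∑ σ : Equiv.Perm (Fin (k + 2)),
          ((-1 : K) ^ signExp (β ∘ σ) * coef b α (L.nestedTau b (β ∘ σ))) • tMon K (β ∘ σ) := by
    intro β
    have h2 : ∀ σ : Equiv.Perm (Fin (k + 2)),
        ((-1 : K) ^ signExp (β ∘ σ) * coef b α (L.nestedTau b (β ∘ σ))) • tMon K (β ∘ σ) =
          (coef b α (L.nestedTau b (β ∘ σ)) *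
            ((-1 : K) ^ signExp β * chi σ fun j => 1 - (deg (β j) : ℤ))) • tMon K β := by
      intro σ
      have := chi_smul_mon (K := K) β σ
      rw [mul_smul (coef b α _), mul_comm, mul_smul]
      exact congrArg _ this.symm
    rw [Finset.sum_congr rfl fun σ _ => h2 σ, ← Finset.sum_smul, smul_smul, structConst_add_two]
    congr 1
    rw [Finset.mul_sum, Finset.mul_sum, Finset.mul_sum]
    refine Finset.sum_congr rfl fun σ _ => ?_
    ring
  rw [Finset.sum_congr rfl fun β _ => h1 β, ← Finset.smul_sum, Finset.sum_comm,
    Finset.sum_congr rfl fun σ _ => sum_tup_comp σ fun β =>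
      ((-1 : K) ^ signExp β * coef b α (L.nestedTau b β)) • tMon K β, Finset.sum_const,
    Finset.card_univ, Fintype.card_perm, Fintype.card_fin, ← Nat.cast_smul_eq_nsmul K, smul_smul]
  congr 1
  have : (((k + 2).factorial : ℕ) : K) ≠ 0 := Nat.cast_ne_zero.mpr (Nat.factorial_ne_zero _)
  field_simp

/-- The Chevalley–Eilenberg differential of the antisymmetrization in closed form. -/
theorem ceGen_eq [CharZero K] (α : Σ n, ι n) :
    L.ceGen b α = component b (Weil K ι) α
      (act id (negAd (L.tbr wdeg) (tSeq b)) (bernSeries K) (L.dSeq b) (deg α + 1) -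
        L.td wdeg (tSeq b (deg α + 1))) := by
  have hterm : ∀ k, ∑ β ∈ tup ι (k + 2) (deg α + 1),
      ((1 / ((k + 2).factorial : K)) * (-1) ^ signExp β * L.structConst b α β) • tMon K β =
        -component b (Weil K ι) α (PowerSeries.coeff (k + 1) (bernSeries K) •
          (negAd (L.tbr wdeg) (tSeq b) ^ (k + 1)) (L.dSeq b) (deg α + 1)) := by
    intro k
    have h1 : ∑ β ∈ tup ι (k + 2) (deg α + 1),
        ((-1 : K) ^ signExp β * coef b α (L.nestedTau b β)) • tMon K β =
          component b (Weil K ι) α ((-1 : K) ^ k •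
            (negAd (L.tbr wdeg) (tSeq b) ^ (k + 1)) (L.dSeq b) (deg α + 1)) := by
      rw [← sum_nestedTau, map_sum]
      refine Finset.sum_congr rfl fun β _ => ?_
      rw [map_smul, component_tmul, smul_smul]
    rw [sum_structConst, h1, map_smul, map_smul, smul_smul, ← neg_smul]
    congr 1
    rw [bernSeries, PowerSeries.coeff_mk]
    -- The sign in front of the Bernoulli number meets the sign of `sum_nestedTau`. The remaining
    -- minus cancels the overall minus of Q_CE, leaving the plain coefficient of x/(e^x - 1).
    have : (-1 : K) ^ (k + 1) * (-1 : K) ^ k = -1 := by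
      rw [← pow_add]
      exact Odd.neg_one_pow ⟨k, by ring⟩
    linear_combination ((bernoulli (k + 1) : ℚ) : K) / ((k + 1).factorial : K) * this
  -- Here |β| = |α| + 1 ≥ 2, so τ_β has negative degree in E and ε₁ is the full differential.
  have hone : ∑ β ∈ tup ι 1 (deg α + 1),
      ((1 / ((1 : ℕ).factorial : K)) * (-1) ^ signExp β * L.structConst b α β) • tMon K β =
        component b (Weil K ι) α (L.td wdeg (tSeq b (deg α + 1))) := by
    rw [sum_tup_one, tSeq, toSeq_apply, map_sum, map_sum]
    refine Finset.sum_congr rfl fun β hβ => ?_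
    rw [L.td_tmul wdeg (hasParity_t β), map_smul, component_tmul, tMon_one, smul_smul, structConst,
      mu, L.eps1_apply (tau_mem b β), if_pos]
    · simp [signExp]
    · have := mem_lvl.mp hβ
      have := deg_pos α
      omega
  -- The constant term of the series drops out because δT lives in order one and |α| + 1 ≥ 2. The
  -- last power drops out because A^k δT starts in order k + 1.
  have hact : act id (negAd (L.tbr wdeg) (tSeq b)) (bernSeries K) (L.dSeq b) (deg α + 1) =
      ∑ k ∈ Finset.range (deg α), PowerSeries.coeff (k + 1) (bernSeries K) •
        (negAd (L.tbr wdeg) (tSeq b) ^ (k + 1)) (L.dSeq b) (deg α + 1) := by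
    change ∑ k ∈ Finset.range (deg α + 1 + 1), _ = _
    have hd : ∀ j < 1, L.dSeq b j = 0 := fun j hj => L.dSeq_of_ne b (by omega)
    rw [Finset.sum_range_succ,
      (isLowering_negAd (L.tbr wdeg) (toSeq_zero_apply b (t K))).pow_apply_eq_zero hd _
        (by simp), smul_zero, add_zero, Finset.sum_range_succ', pow_zero, Module.End.one_apply,
      L.dSeq_of_ne b (by have := deg_pos α; omega), smul_zero, add_zero]
  have hIcc : Finset.Icc 1 (deg α + 1) = Finset.Ico 1 (deg α + 2) := by
    ext
    simp only [Finset.mem_Icc, Finset.mem_Ico]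
    omega
  rw [ceGen, hIcc, Finset.sum_Ico_eq_sum_range, show deg α + 2 - 1 = deg α + 1 from rfl,
    Finset.sum_range_succ', map_sub, hact, map_sum, neg_add, sub_eq_add_neg,
    ← Finset.sum_neg_distrib]
  refine congrArg₂ (· + ·) (Finset.sum_congr rfl fun k _ => ?_) (congrArg Neg.neg hone)
  rw [neg_eq_iff_eq_neg]
  refine Eq.trans ?_ (hterm k)
  rw [show 1 + (k + 1) = k + 2 by ring]
  rfl

end DGLie

/-! ### Multiplication by the formal variable u -/

section MulU

variable {K : Type*} [Field K] {M : Type*} [AddCommGroup M] [Module K M]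

/-- Multiplication of sequences, regarded as power series in `u`, with `u`. -/
def mulU (X : ℕ → M) : ℕ → M := fun n => if n = 0 then 0 else X (n - 1)

theorem mulU_zero (X : ℕ → M) : mulU X 0 = 0 := rfl

theorem mulU_succ (X : ℕ → M) (n : ℕ) : mulU X (n + 1) = X n := by simp [mulU]

theorem negAd_mulU (br : M →ₗ[K] M →ₗ[K] M) (T X : ℕ → M) :
    negAd br T (mulU X) = mulU (negAd br T X) := by
  ext n
  cases n with
  | zero => simp [negAd_apply, conv_apply, mulU_zero]
  | succ n =>
    rw [mulU_succ, negAd_apply, negAd_apply, Pi.neg_apply, Pi.neg_apply, conv_apply, conv_apply,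
      Finset.Nat.sum_antidiagonal_succ]
    simp [mulU_zero, mulU_succ]

theorem act_mulU (br : M →ₗ[K] M →ₗ[K] M) {T : ℕ → M} (hT : T 0 = 0) (f : PowerSeries K)
    (X : ℕ → M) : act id (negAd br T) f (mulU X) = mulU (act id (negAd br T) f X) := by
  have hpow : ∀ k, (negAd br T ^ k) (mulU X) = mulU ((negAd br T ^ k) X) := by
    intro k
    induction k with
    | zero => rfl
    | succ k ih => rw [pow_succ', Module.End.mul_apply, Module.End.mul_apply, ih, negAd_mulU]
  have hlow := isLowering_negAd br hT
  ext n
  cases n with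
  | zero => rw [mulU_zero, hlow.act_eq_sum f _ (N := 0) le_rfl]; simp [mulU_zero]
  | succ n =>
    rw [mulU_succ, hlow.act_eq_sum f _ (N := n + 1) le_rfl,
      hlow.act_eq_sum f X (N := n + 1) (by simp)]
    simp only [hpow, mulU_succ]

end MulU

namespace DGLie

variable {K : Type*} [Field K] {G : Type*} [AddCommGroup G] [Module K G]
  {gr : ℤ → Submodule K G} [DirectSum.Decomposition gr] (L : DGLie K gr)
  {ι : ℕ → Type*} [∀ n, Fintype (ι n)]
  (b : ∀ n : ℕ, Module.Basis (ι n) K (gr (-((n : ℤ) + 1))))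

/-! ### The total differential -/

theorem tSeq_zero : tSeq (K := K) b 0 = 0 := toSeq_zero_apply b _

theorem dSeq_mem_gpart (n : ℕ) : L.dSeq b n ∈ gpart (Weil K ι) gr (1 - (n : ℤ)) := by
  by_cases hn : n = 1
  · subst hn
    have := L.td_mem_gpart wdeg (toSeq_mem_gpart b (t K) 1)
    rw [dSeq_one]
    exact this
  · rw [L.dSeq_of_ne b hn]
    exact zero_mem _

variable (q : (Σ n, ι n) ⊕ (Σ n, ι n) → Weil K ι)
  (hq : ∀ j, FreeGCA.HasParity wdeg (wdeg j + 1) (q j))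

/-- The differential `d + u Q` for a derivation `Q` of the Weil algebra. -/
abbrev totalDiff : (ℕ → Weil K ι ⊗[K] G) →ₗ[K] (ℕ → Weil K ι ⊗[K] G) :=
  shiftedDiff (L.td wdeg) ((FreeGCA.der wdeg q hq).rTensor G)

/-- From order two on, the summand -dT of `ceGen_eq` cancels the dT in DT. In order one no Q t
occurs, and dT itself supplies the constant term δT of the series. -/
theorem totalDiff_tSeq [CharZero K] {s : (Σ n, ι n) → Weil K ι}
    (hs : ∀ α, q (Sum.inl α) = L.ceGen b α + s α) :
    L.totalDiff q hq (tSeq b) =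
      act id (negAd (L.tbr wdeg) (tSeq b)) (bernSeries K) (L.dSeq b) + mulU (toSeq b s) := by
  have hlow := isLowering_negAd (L.tbr wdeg) (tSeq_zero (K := K) b)
  have hd : ∀ j < 1, L.dSeq b j = 0 := fun j hj => L.dSeq_of_ne b (by omega)
  ext n
  match n with
  | 0 =>
    rw [shiftedDiff_zero, tSeq_zero, map_zero, Pi.add_apply, mulU_zero,
      hlow.act_eq_sum _ _ (N := 0) le_rfl]
    simp [hd]
  | 1 =>
    rw [shiftedDiff_succ, tSeq_zero, map_zero, Pi.add_apply, mulU_succ, toSeq_zero_apply,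
      hlow.act_eq_sum _ _ (N := 1) le_rfl, Finset.sum_range_succ,
      hlow.pow_apply_eq_zero hd 1 (by simp)]
    simp [bernSeries, dSeq_one]
  | n + 2 =>
    rw [shiftedDiff_succ, Pi.add_apply, mulU_succ, tSeq, rTensor_toSeq]
    have h1 : ∀ α, FreeGCA.der wdeg q hq (t K α) = L.ceGen b α + s α := fun α =>
      (FreeGCA.der_gen wdeg q hq _).trans (hs α)
    have h2 : toSeq b (fun α => L.ceGen b α) (n + 1) =
        act id (negAd (L.tbr wdeg) (tSeq b)) (bernSeries K) (L.dSeq b) (n + 2) -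
          L.td wdeg (tSeq b (n + 2)) := by
      refine gpart_ext b (Nat.succ_pos n) (toSeq_mem_gpart b _ _) (sub_mem ?_ ?_) fun α hα => ?_
      · have := L.act_mem_gpart wdeg (toSeq_mem_gpart b (t K)) (L.dSeq_mem_gpart b)
          (bernSeries K) (n + 2)
        convert this using 2
        push_cast
        ring
      · have := L.td_mem_gpart wdeg (toSeq_mem_gpart b (t K) (n + 2))
        convert this using 2
        push_cast
        ring
      · have h3 := component_toSeq b (fun α => L.ceGen b α) α
        rw [L.ceGen_eq, hα] at h3
        exact h3
    have h4 : toSeq b (fun α => FreeGCA.der wdeg q hq (t K α)) =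
        toSeq b (fun α => L.ceGen b α) + toSeq b s := by
      rw [← map_add]
      congr 1
      funext α
      exact h1 α
    rw [h4, Pi.add_apply, h2]
    abel

theorem totalDiff_tSeq_mem_par (n : ℕ) : L.totalDiff q hq (tSeq b) n ∈ par wdeg gr 1 := by
  cases n with
  | zero => simpa [shiftedDiff_zero] using L.td_mem_par wdeg (tSeq_mem_par b 0)
  | succ n =>
    rw [shiftedDiff_succ]
    have h1 := L.td_mem_par wdeg (tSeq_mem_par (K := K) b (n + 1))
    have h2 := rTensor_der_mem_par wdeg q hq (tSeq_mem_par b n)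
    exact add_mem (by simpa using h1) (by simpa using h2)

theorem tensor_neg_one_smul {J : Type*} (p : J → ℕ) (X : FreeGCA K p ⊗[K] G) :
    (-1 : K) • X = -X :=
  neg_one_smul K X

theorem tensor_neg_smul {J : Type*} (p : J → ℕ) (r : K) (X : FreeGCA K p ⊗[K] G) :
    (-r) • X = -(r • X) :=
  neg_smul r X

theorem tbr_symm_of_odd {J : Type*} (p : J → ℕ) {X Y : FreeGCA K p ⊗[K] G}
    (hX : X ∈ par p gr 1) (hY : Y ∈ par p gr 1) : L.tbr p X Y = L.tbr p Y X := by
  rw [L.tbr_antisymm p hX hY]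
  simp [tensor_neg_one_smul]

/-- The curvature of the gauge transform of `d + u Q` by the universal element. -/
theorem curvature_totalDiff [CharZero K] :
    L.totalDiff q hq (act id (negAd (L.tbr wdeg) (tSeq b)) (expSeries K)
        (L.totalDiff q hq (tSeq b))) - (1 / 2 : K) • conv (L.tbr wdeg)
          (act id (negAd (L.tbr wdeg) (tSeq b)) (expSeries K) (L.totalDiff q hq (tSeq b)))
          (act id (negAd (L.tbr wdeg) (tSeq b)) (expSeries K) (L.totalDiff q hq (tSeq b))) =
      act id (negAd (L.tbr wdeg) (tSeq b)) (expSeries K)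
        (L.totalDiff q hq (L.totalDiff q hq (tSeq b))) := by
  have hmem : ∀ X ∈ par wdeg gr 1, ∀ n, L.tbr wdeg X (tSeq b n) ∈ par (K := K) wdeg gr 1 :=
    fun X hX n => by simpa using L.tbr_mem_par wdeg hX (tSeq_mem_par b n)
  refine curvature_act (L.tbr wdeg) (L.td wdeg) _ (par wdeg gr 1) (tSeq b) (tSeq_zero b)
    (L.totalDiff_tSeq_mem_par b q hq) hmem (fun X hX Y hY => L.tbr_symm_of_odd wdeg hX hY) ?_ ?_ ?_
  · intro X hX Z hZ n
    have h := L.tbr_jacobi wdeg hX hZ (tSeq_mem_par b n)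
    rw [h, L.tbr_symm_of_odd wdeg hZ (hmem X hX n)]
    simp [tensor_neg_one_smul]
  · intro X hX n
    rw [L.td_tbr wdeg hX (tSeq_mem_par b n), sub_eq_add_neg]
    simp [tensor_neg_one_smul]
  · intro X hX n
    rw [L.rTensor_der_tbr wdeg q hq hX (tSeq_mem_par b n), sub_eq_add_neg]
    simp [tensor_neg_one_smul]

/-- Since D² = u²Q², the order n + 2 of D²T collects the elements Q²t^α with |α| = n. -/
theorem totalDiff_totalDiff_tSeq_eq_zero_iff :
    L.totalDiff q hq (L.totalDiff q hq (tSeq b)) = 0 ↔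
      ∀ α, FreeGCA.der wdeg q hq (FreeGCA.der wdeg q hq (t K α)) = 0 := by
  have h2 : ∀ n, L.totalDiff q hq (L.totalDiff q hq (tSeq b)) (n + 2) =
      toSeq b (fun α => FreeGCA.der wdeg q hq (FreeGCA.der wdeg q hq (t K α))) n := by
    intro n
    rw [shiftedDiff_shiftedDiff_succ_succ (L.td_td wdeg) (L.td_rTensor_der wdeg q hq), tSeq,
      rTensor_toSeq, rTensor_toSeq]
  constructor
  · intro h α
    rw [← component_toSeq b (fun α => FreeGCA.der wdeg q hq (FreeGCA.der wdeg q hq (t K α))) α,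
      ← h2, h, Pi.zero_apply, map_zero]
  · intro h
    ext n
    match n with
    | 0 => exact shiftedDiff_shiftedDiff_zero (L.td_td wdeg) _
    | 1 => exact shiftedDiff_shiftedDiff_one (L.td_td wdeg) (L.td_rTensor_der wdeg q hq) _
    | n + 2 =>
      rw [h2, funext h]
      exact congrFun (map_zero (toSeq b)) n

/-! ### The Chevalley–Eilenberg and Weil differentials square to zero -/

theorem conv_dSeq_dSeq (n : ℕ) : conv (L.tbr wdeg) (L.dSeq b) (L.dSeq b) n =
    if n = 2 then L.tbr wdeg (L.dSeq b 1) (L.dSeq b 1) else 0 := by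
  rw [conv_apply]
  split_ifs with hn
  · subst hn
    rw [Finset.sum_eq_single (1, 1)]
    · rintro ⟨i, j⟩ hx hne
      have := mem_antidiagonal.mp hx
      rw [L.dSeq_of_ne b, map_zero, LinearMap.zero_apply]
      rintro rfl
      apply hne
      simp only at this ⊢
      congr 1
      omega
    · simp
  · refine Finset.sum_eq_zero fun x hx => ?_
    have := mem_antidiagonal.mp hx
    by_cases h1 : x.1 = 1
    · rw [L.dSeq_of_ne b (n := x.2) (by omega), map_zero]
    · rw [L.dSeq_of_ne b h1, map_zero, LinearMap.zero_apply]

/-- If `Q` restricts to the Chevalley–Eilenberg differential, then it squares to zero on the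
generators `t^α`. -/
theorem der_ceGen_eq_zero [CharZero K] (hs : ∀ α, q (Sum.inl α) = L.ceGen b α) (α : Σ n, ι n) :
    FreeGCA.der wdeg q hq (L.ceGen b α) = 0 := by
  have hlow := isLowering_negAd (L.tbr wdeg) (tSeq_zero (K := K) b)
  have hY : L.totalDiff q hq (tSeq b) =
      act id (negAd (L.tbr wdeg) (tSeq b)) (bernSeries K) (L.dSeq b) := by
    rw [L.totalDiff_tSeq b q hq (s := 0) (by simpa using hs), map_zero]
    ext n
    cases n <;> simp [mulU]
  have hΘ : act id (negAd (L.tbr wdeg) (tSeq b)) (expSeries K) (L.totalDiff q hq (tSeq b)) =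
      L.dSeq b := by
    rw [hY, hlow.act_act_of_mul_eq_one (expSeries_mul_bernSeries K)]
  have hodd1 : L.dSeq b 1 ∈ par wdeg gr 1 := by
    simpa [dSeq_one] using L.td_mem_par wdeg (tSeq_mem_par (K := K) b 1)
  -- Flatness of δT is checked order by order; order two is the only one where nonzero terms have to
  -- cancel.
  have hF : L.totalDiff q hq (L.dSeq b) -
      (1 / 2 : K) • conv (L.tbr wdeg) (L.dSeq b) (L.dSeq b) = 0 := by
    have h0 : L.dSeq b 0 = 0 := L.dSeq_of_ne b (by decide)
    have hd : ∀ j < 1, L.dSeq b j = 0 := fun j hj => L.dSeq_of_ne b (by omega)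
    ext n
    rw [Pi.sub_apply, Pi.smul_apply, conv_dSeq_dSeq]
    match n with
    | 0 => simp [shiftedDiff_zero, h0]
    | 1 => simp [shiftedDiff_succ, h0, dSeq_one, td_td]
    | 2 =>
      -- Order two reads dT₂ + QT₁ = -B₁[δT, T₁] = ½[δT, T₁]. Applying d gives Q(δT) = ½[δT, δT].
      have h2 := congrFun hY 2
      rw [shiftedDiff_succ, hlow.act_eq_sum _ _ (N := 2) le_rfl, Finset.sum_range_succ,
        hlow.pow_apply_eq_zero hd 2 (by simp),
        Finset.sum_range_succ, Finset.sum_range_one, pow_zero, pow_one, Module.End.one_apply,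
        L.dSeq_of_ne b (by decide : 2 ≠ 1), smul_zero, smul_zero, zero_add, add_zero, negAd_apply,
        Pi.neg_apply, conv_apply, Finset.sum_eq_single (1, 1)] at h2
      · have h3 := congrArg (L.td wdeg) h2
        rw [map_add, td_td, zero_add, map_smul, map_neg, L.td_tbr wdeg hodd1 (tSeq_mem_par b 1),
          td_rTensor_der, ← dSeq_one, dSeq_one, td_td, ← dSeq_one] at h3
        have h4 := neg_eq_iff_eq_neg.mp h3
        rw [shiftedDiff_succ, L.dSeq_of_ne b (by decide : 2 ≠ 1), map_zero, zero_add, h4, if_pos rfl,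
          map_zero, LinearMap.zero_apply, zero_add, zpow_one, tensor_neg_one_smul, neg_neg]
        have h5 : PowerSeries.coeff 1 (bernSeries K) = -(1 / 2 : K) := by
          simp [bernSeries]
          norm_num
        rw [h5, tensor_neg_smul, neg_neg, sub_self, Pi.zero_apply]
      · rintro ⟨i, j⟩ hx hne
        have := mem_antidiagonal.mp hx
        rw [L.dSeq_of_ne b, map_zero, LinearMap.zero_apply]
        rintro rfl
        apply hne
        simp only at this ⊢
        congr 1
        omega
      · simp
    | n + 3 =>
      rw [shiftedDiff_succ, L.dSeq_of_ne b (by omega), L.dSeq_of_ne b (by omega),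
        if_neg (by omega)]
      simp
  have hcurv := L.curvature_totalDiff b q hq
  rw [hΘ, hF] at hcurv
  -- The series (e^A - 1)/A is invertible, so vanishing curvature forces D²T = 0.
  have hzero : L.totalDiff q hq (L.totalDiff q hq (tSeq b)) = 0 := by
    rw [← hlow.act_act_of_mul_eq_one (bernSeries_mul_expSeries K)
      (L.totalDiff q hq (L.totalDiff q hq (tSeq b))), ← hcurv, map_zero]
  have h := (L.totalDiff_totalDiff_tSeq_eq_zero_iff b q hq).mp hzero α
  rwa [show FreeGCA.der wdeg q hq (t K α) = L.ceGen b α from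
    (FreeGCA.der_gen wdeg q hq _).trans (hs α)] at h

theorem ceGen_mem_homog (α : Σ n, ι n) :
    L.ceGen b α ∈ FreeGCA.homog (K := K) (wdeg (ι := ι)) (deg α + 1) := by
  refine neg_mem (sum_mem fun k _ => sum_mem fun β hβ => Submodule.smul_mem _ _ ?_)
  have h := FreeGCA.mon_mem_homog (K := K) (wdeg (ι := ι))
    (List.ofFn fun j => (Sum.inl (β j) : (Σ n, ι n) ⊕ (Σ n, ι n)))
  rw [List.map_ofFn, List.sum_ofFn] at h
  rw [tuples_eq, mem_tup] at hβ
  rw [← hβ]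
  exact h

theorem t_mem_homog (α : Σ n, ι n) : t K α ∈ FreeGCA.homog (wdeg (ι := ι)) (deg α) :=
  FreeGCA.gen_mem_homog wdeg (Sum.inl α)

theorem tHat_mem_homog (α : Σ n, ι n) : tHat K α ∈ FreeGCA.homog (wdeg (ι := ι)) (deg α + 1) :=
  FreeGCA.gen_mem_homog wdeg (Sum.inr α)

theorem shift_t (α : Σ n, ι n) : shift K ι (t K α) = tHat K α :=
  FreeGCA.der_gen wdeg _ _ (Sum.inl α)

theorem shift_tHat (α : Σ n, ι n) : shift K ι (tHat K α) = 0 :=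
  FreeGCA.der_gen wdeg _ _ _

theorem shift_shift [CharZero K] (w : Weil K ι) : shift K ι (shift K ι w) = 0 := by
  refine FreeGCA.der_der_eq_zero wdeg _ _ ?_ w
  rintro (α | α)
  · exact shift_tHat α
  · exact map_zero _

theorem shift_mem_homog {n : ℕ} {w : Weil K ι} (hw : w ∈ FreeGCA.homog wdeg n) :
    shift K ι w ∈ FreeGCA.homog wdeg (n + 1) := by
  refine FreeGCA.der_mem_homog wdeg _ _ ?_ hw
  rintro (α | α)
  · exact tHat_mem_homog α
  · exact zero_mem _

/-- The values on the generators of the extension of the Chevalley–Eilenberg differential to the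
Weil algebra which anticommutes with the shift derivation. -/
def ceExt : (Σ n, ι n) ⊕ (Σ n, ι n) → Weil K ι :=
  Sum.elim (fun α => L.ceGen b α) fun α => -shift K ι (L.ceGen b α)

theorem hasParity_ceExt (j : (Σ n, ι n) ⊕ (Σ n, ι n)) :
    FreeGCA.HasParity wdeg (wdeg j + 1) (L.ceExt b j) := by
  rcases j with α | α
  · exact L.hasParity_ceGen b α
  · exact FreeGCA.HasParity.neg _ (FreeGCA.HasParity.der _ _ _ (L.hasParity_ceGen b α))

/-- Q_W splits into two anticommuting odd derivations, so Q_W² = 0 reduces to the square of each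
summand. -/
theorem weilDiff_eq (w : Weil K ι) :
    L.weilDiff b w = FreeGCA.der wdeg (L.ceExt b) (L.hasParity_ceExt b) w + shift K ι w := by
  induction w using FreeGCA.induction wdeg with
  | halg r =>
    have h1 : L.weilDiff b (algebraMap K _ r) = 0 := FreeGCA.der_algebraMap wdeg _ _ r
    have h2 : shift K ι (algebraMap K _ r) = 0 := FreeGCA.der_algebraMap wdeg _ _ r
    rw [h1, h2, FreeGCA.der_algebraMap, add_zero]
  | hgen j =>
    rcases j with α | α
    · exact (FreeGCA.der_gen wdeg _ _ _).trans (congrArg₂ (· + ·)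
        (FreeGCA.der_gen wdeg (L.ceExt b) (L.hasParity_ceExt b) (Sum.inl α)).symm
        (shift_t α).symm)
    · have h1 := FreeGCA.der_gen wdeg (L.ceExt b) (L.hasParity_ceExt b) (Sum.inr α)
      have h2 := shift_tHat (K := K) α
      rw [tHat] at h2
      rw [h1, h2, add_zero]
      exact FreeGCA.der_gen wdeg _ _ _
  | hmul v w hv hw =>
    have h1 : L.weilDiff b (v * w) = L.weilDiff b v * w + FreeGCA.parity wdeg v * L.weilDiff b w :=
      FreeGCA.der_mul wdeg _ _ v w
    have h2 : shift K ι (v * w) = shift K ι v * w + FreeGCA.parity wdeg v * shift K ι w :=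
      FreeGCA.der_mul wdeg _ _ v w
    rw [h1, h2, FreeGCA.der_mul, hv, hw, add_mul, mul_add]
    abel
  | hadd v w hv hw =>
    rw [map_add, map_add, map_add, hv, hw]
    abel

theorem weilDiff_weilDiff [CharZero K] (w : Weil K ι) : L.weilDiff b (L.weilDiff b w) = 0 := by
  have hce := L.der_ceGen_eq_zero b (L.ceExt b) (L.hasParity_ceExt b) fun α => rfl
  have hanti : ∀ w, FreeGCA.der wdeg (L.ceExt b) (L.hasParity_ceExt b) (shift K ι w) +
      shift K ι (FreeGCA.der wdeg (L.ceExt b) (L.hasParity_ceExt b) w) = 0 := by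
    refine FreeGCA.der_der_add_eq_zero wdeg _ _ _ _ ?_
    rintro (α | α)
    · change FreeGCA.der wdeg (L.ceExt b) (L.hasParity_ceExt b) (tHat K α) +
        shift K ι (L.ceGen b α) = 0
      rw [tHat, FreeGCA.der_gen]
      simp [ceExt]
    · change FreeGCA.der wdeg (L.ceExt b) (L.hasParity_ceExt b) 0 +
        shift K ι (-shift K ι (L.ceGen b α)) = 0
      rw [map_zero, map_neg, shift_shift, neg_zero, add_zero]
  have hsq : ∀ w, FreeGCA.der wdeg (L.ceExt b) (L.hasParity_ceExt b)
      (FreeGCA.der wdeg (L.ceExt b) (L.hasParity_ceExt b) w) = 0 := by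
    refine FreeGCA.der_der_eq_zero wdeg _ _ ?_
    rintro (α | α)
    · exact hce α
    · change FreeGCA.der wdeg (L.ceExt b) (L.hasParity_ceExt b) (-shift K ι (L.ceGen b α)) = 0
      -- Anticommuting Q_CE past σ reduces the claim on t̂^α to Q_CE² t^α = 0.
      have := hanti (L.ceGen b α)
      rw [hce, map_zero, add_zero] at this
      rw [map_neg, this, neg_zero]
  rw [weilDiff_eq, weilDiff_eq, map_add, map_add, hsq, shift_shift, zero_add, add_zero, hanti]

theorem isDifferential_weilDiff [CharZero K] :
    FreeGCA.IsDifferential wdeg (L.weilDiff b) := by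
  refine FreeGCA.isDifferential_der wdeg _ _ ?_ ?_
  · rintro (α | α)
    · exact add_mem (L.ceGen_mem_homog b α) (tHat_mem_homog α)
    · exact neg_mem (shift_mem_homog (L.ceGen_mem_homog b α))
  · intro j
    have := L.weilDiff_weilDiff b (FreeGCA.gen wdeg j)
    rw [weilDiff, FreeGCA.der_gen] at this
    exact this

end DGLie

namespace DGLie

variable {K : Type*} [Field K] {G : Type*} [AddCommGroup G] [Module K G]
  {gr : ℤ → Submodule K G} [DirectSum.Decomposition gr] (L : DGLie K gr)
  {ι : ℕ → Type*} [∀ n, Fintype (ι n)]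
  (b : ∀ n : ℕ, Module.Basis (ι n) K (gr (-((n : ℤ) + 1))))

/-! ### The coordinate change -/

/-- One invariance principle for two purposes: homogeneity of the new generators, and the presence
of a t̂ in every added monomial. -/
theorem adjOp_mem {S : (Σ n, ι n) → Submodule K (Weil K ι)}
    (hS : ∀ α β γ, deg β + deg γ = deg α → ∀ w ∈ S β, w * t K γ ∈ S α)
    {X : (Σ n, ι n) → Weil K ι} (hX : ∀ α, X α ∈ S α) (α : Σ n, ι n) :
    L.adjOp b X α ∈ S α := by
  refine sum_mem fun β _ => sum_mem fun γ _ => ?_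
  by_cases h : deg β + deg γ = deg α
  · exact Submodule.smul_mem _ _ (hS α β γ h _ (hX β))
  · rw [L.adjData_eq_zero b h, zero_smul]
    exact zero_mem _

theorem adjOp_iterate_mem {S : (Σ n, ι n) → Submodule K (Weil K ι)}
    (hS : ∀ α β γ, deg β + deg γ = deg α → ∀ w ∈ S β, w * t K γ ∈ S α)
    {X : (Σ n, ι n) → Weil K ι} (hX : ∀ α, X α ∈ S α) (n : ℕ) (α : Σ n, ι n) :
    (L.adjOp b)^[n] X α ∈ S α := by
  induction n generalizing α with
  | zero => exact hX α
  | succ n ih =>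
    rw [Function.iterate_succ_apply']
    exact L.adjOp_mem b hS ih α

theorem two_smul_adjLin_pow (n : ℕ) (X : (Σ n, ι n) → Weil K ι) (α : Σ n, ι n) :
    (((2 : K) • L.adjLin b) ^ n) X α = (2 : K) ^ n • (L.adjOp b)^[n] X α := by
  rw [smul_pow, LinearMap.smul_apply, Pi.smul_apply, Module.End.pow_apply]
  rfl

/-- The images of the generators of the Weil algebra under the endomorphism defined by a power
series in the adjustment operator. -/
def adjGen (f : PowerSeries K) : (Σ n, ι n) ⊕ (Σ n, ι n) → Weil K ι :=
  Sum.elim (t K) (act Sigma.fst ((2 : K) • L.adjLin b) f (tHat K))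

theorem adjGen_mem_homog (f : PowerSeries K) (j : (Σ n, ι n) ⊕ (Σ n, ι n)) :
    L.adjGen b f j ∈ FreeGCA.homog wdeg (wdeg j) := by
  rcases j with α | α
  · exact t_mem_homog α
  · change ∑ n ∈ Finset.range (α.1 + 1), _ ∈ FreeGCA.homog wdeg (deg α + 1)
    refine sum_mem fun n _ => Submodule.smul_mem _ _ ?_
    rw [two_smul_adjLin_pow]
    refine Submodule.smul_mem _ _ (L.adjOp_iterate_mem b
      (S := fun α => FreeGCA.homog wdeg (deg α + 1)) ?_ tHat_mem_homog n α)
    intro α β γ h w hw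
    rw [← h, Nat.add_right_comm]
    exact FreeGCA.mul_mem_homog wdeg hw (t_mem_homog γ)

/-- The endomorphism of the Weil algebra fixing the `t^α` and acting on the `t̂^α` by a power
series in the adjustment operator. -/
def adjHom (f : PowerSeries K) : Weil K ι →ₐ[K] Weil K ι :=
  FreeGCA.lift wdeg (L.adjGen b f) fun i j =>
    (FreeGCA.hasParity_of_mem_homog wdeg (L.adjGen_mem_homog b f i)).mul_comm wdeg
      (FreeGCA.hasParity_of_mem_homog wdeg (L.adjGen_mem_homog b f j))

theorem adjHom_gen (f : PowerSeries K) (j : (Σ n, ι n) ⊕ (Σ n, ι n)) :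
    L.adjHom b f (FreeGCA.gen wdeg j) = L.adjGen b f j :=
  FreeGCA.lift_gen wdeg _ _ j

theorem adjHom_t (f : PowerSeries K) (α : Σ n, ι n) : L.adjHom b f (t K α) = t K α :=
  L.adjHom_gen b f (Sum.inl α)

theorem adjHom_tHat (f : PowerSeries K) (α : Σ n, ι n) :
    L.adjHom b f (tHat K α) = act Sigma.fst ((2 : K) • L.adjLin b) f (tHat K) α :=
  L.adjHom_gen b f (Sum.inr α)

theorem map_adjLin (φ : Weil K ι →ₐ[K] Weil K ι) (hφ : ∀ α, φ (t K α) = t K α) (c : K)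
    (X : (Σ n, ι n) → Weil K ι) :
    (fun α => φ ((c • L.adjLin b) X α)) = (c • L.adjLin b) fun α => φ (X α) := by
  ext α
  simp only [LinearMap.smul_apply, Pi.smul_apply, adjLin_apply, adjOp, map_smul, map_sum, map_mul,
    hφ]

/-- The endomorphism φ_g fixes the t^α and hence commutes with S. So φ_g(f(2S) t̂) = f(2S) φ_g(t̂) =
f(2S) g(2S) t̂ = t̂. -/
theorem adjHom_comp {f g : PowerSeries K} (h : f * g = 1) :
    (L.adjHom b g).comp (L.adjHom b f) = AlgHom.id K _ := by
  refine FreeGCA.hom_ext wdeg ?_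
  rintro (α | α)
  · change L.adjHom b g (L.adjHom b f (t K α)) = t K α
    rw [adjHom_t, adjHom_t]
  · change L.adjHom b g (L.adjHom b f (tHat K α)) = tHat K α
    have h1 := congrFun (act_comm_of_comm (w := Sigma.fst) (L.adjHom b g).toLinearMap
      (L.map_adjLin b (L.adjHom b g) (L.adjHom_t b g) 2) f (tHat K)) α
    have h2 : (fun α => (L.adjHom b g).toLinearMap (tHat K α)) =
        act Sigma.fst ((2 : K) • L.adjLin b) g (tHat K) := funext (L.adjHom_tHat b g)
    rw [h2, (L.isLowering_adjLin b 2).act_act_of_mul_eq_one h] at h1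
    rw [adjHom_tHat]
    exact h1

/-- The coordinate change given by the alternator. -/
def adjEquiv [CharZero K] : Weil K ι ≃ₐ[K] Weil K ι :=
  AlgEquiv.ofAlgHom (L.adjHom b (expSeries K)) (L.adjHom b (bernSeries K))
    (L.adjHom_comp b (bernSeries_mul_expSeries K)) (L.adjHom_comp b (expSeries_mul_bernSeries K))

theorem adjEquiv_t [CharZero K] (α : Σ n, ι n) : L.adjEquiv b (t K α) = t K α :=
  L.adjHom_t b _ α

theorem adjEquiv_tHat [CharZero K] (α : Σ n, ι n) : L.adjEquiv b (tHat K α) =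
    act Sigma.fst ((2 : K) • L.adjLin b) (expSeries K) (tHat K) α :=
  L.adjHom_tHat b _ α

theorem adjEquiv_tHat_eq [CharZero K] (α : Σ n, ι n) : L.adjEquiv b (tHat K α) =
    tHat K α + L.adjOp b (tHat K) α + ∑ n ∈ Finset.Ico 2 (deg α),
      ((2 : K) ^ n / ((n + 1).factorial : K)) • (L.adjOp b)^[n] (tHat K) α := by
  have h : ∀ n, PowerSeries.coeff n (expSeries K) • (((2 : K) • L.adjLin b) ^ n) (tHat K) α =
      ((2 : K) ^ n / ((n + 1).factorial : K)) • (L.adjOp b)^[n] (tHat K) α := by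
    intro n
    rw [two_smul_adjLin_pow, smul_smul, expSeries, PowerSeries.coeff_mk, one_div_mul_eq_div]
  rw [adjEquiv_tHat]
  change ∑ n ∈ Finset.range (deg α), _ = _
  rw [Finset.sum_congr rfl fun n _ => h n]
  -- For |α| = 1 the truncated series has only its constant term, so the linear term in the formula
  -- must vanish; it does because S is lowering.
  rcases (Nat.succ_le_of_lt (deg_pos α)).eq_or_lt with hα | hα
  · have h0 : L.adjOp b (tHat K) α = 0 := by
      have := L.isLowering_adjLin b 1 (tHat K) α fun β hβ => by
        simp only [deg] at hα
        omega
      rwa [one_smul] at this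
    rw [← hα, h0]
    simp
  · rw [Finset.range_eq_Ico, ← Finset.sum_Ico_consecutive _ (Nat.zero_le 2) hα]
    congr 1
    rw [← Finset.range_eq_Ico, Finset.sum_range_succ, Finset.sum_range_one]
    simp

theorem isCoordinateChange_adjEquiv [CharZero K] : IsCoordinateChange (L.adjEquiv b) where
  map_t := L.adjEquiv_t b
  map_tHat α := by
    have hS : ∀ n, (L.adjOp b)^[n] (tHat K) α ∈ Submodule.span K
        {w | ∃ l : List ((Σ n, ι n) ⊕ (Σ n, ι n)), (l.map wdeg).sum = deg α + 1 ∧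
          (∃ β, Sum.inr β ∈ l) ∧ w = FreeGCA.mon wdeg l} := fun n => by
      refine L.adjOp_iterate_mem b (S := fun α => Submodule.span K
        {w | ∃ l : List ((Σ n, ι n) ⊕ (Σ n, ι n)), (l.map wdeg).sum = deg α + 1 ∧
          (∃ β, Sum.inr β ∈ l) ∧ w = FreeGCA.mon wdeg l}) ?_ ?_ n α
      · intro α β γ h w hw
        induction hw using Submodule.span_induction with
        | mem w hw =>
          obtain ⟨l, hl, ⟨ε, hε⟩, rfl⟩ := hw
          refine Submodule.subset_span ⟨l ++ [Sum.inl γ], ?_, ⟨ε, by simp [hε]⟩, ?_⟩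
          · rw [List.map_append, List.sum_append, hl, List.map_singleton, List.sum_singleton]
            change deg β + 1 + deg γ = deg α + 1
            omega
          · rw [FreeGCA.mon_append]
            simp [FreeGCA.mon, t]
        | zero => simp
        | add v w _ _ hv hw => rw [add_mul]; exact add_mem hv hw
        | smul r w _ hw => rw [smul_mul_assoc]; exact Submodule.smul_mem _ _ hw
      · intro α
        exact Submodule.subset_span ⟨[Sum.inr α], by simp [wdeg], ⟨α, by simp⟩,
          by simp [FreeGCA.mon, tHat]⟩
    rw [adjEquiv_tHat_eq, add_assoc, add_sub_cancel_left]
    exact add_mem (hS 1) (sum_mem fun n _ => Submodule.smul_mem _ _ (hS n))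

/-! ### Firmness -/

theorem component_tbr_sum_mem {J : Type*} {p : J → ℕ} (S : Submodule K (FreeGCA K p))
    {I I' : Type*} {s : Finset I} {s' : Finset I'} {v : I → FreeGCA K p} {w : I' → FreeGCA K p}
    {x : I → G} (y : I' → G) {k : I → ℤ} {m : I' → ℕ} (hx : ∀ β ∈ s, x β ∈ gr (k β))
    (hw : ∀ γ ∈ s', FreeGCA.HasParity p (m γ) (w γ)) (h : ∀ β ∈ s, ∀ γ ∈ s', v β * w γ ∈ S)
    (α : Σ n, ι n) :
    component b _ α (L.tbr p (∑ β ∈ s, v β ⊗ₜ x β) (∑ γ ∈ s', w γ ⊗ₜ y γ)) ∈ S := by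
  simp only [map_sum, LinearMap.sum_apply]
  refine sum_mem fun γ hγ => sum_mem fun β hβ => ?_
  rw [L.tbr_tmul p (hw γ hγ) (hx β hβ), map_smul, component_tmul]
  exact Submodule.smul_mem _ _ (Submodule.smul_mem _ _ (h β hβ γ hγ))

/-- Flatness of Θ = δT + u t̂', which follows from Q² = 0 on the t^α. Its components are the
formulas for Q t̂'. -/
theorem totalDiff_adjusted [CharZero K] (q : (Σ n, ι n) ⊕ (Σ n, ι n) → Weil K ι)
    (hq : ∀ j, FreeGCA.HasParity wdeg (wdeg j + 1) (q j))
    (hs : ∀ α, q (Sum.inl α) = L.ceGen b α + tHat K α)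
    (hsq : ∀ α, FreeGCA.der wdeg q hq (FreeGCA.der wdeg q hq (t K α)) = 0) :
    L.totalDiff q hq (L.dSeq b + mulU (toSeq b fun α => L.adjEquiv b (tHat K α))) =
      (1 / 2 : K) • conv (L.tbr wdeg)
        (L.dSeq b + mulU (toSeq b fun α => L.adjEquiv b (tHat K α)))
        (L.dSeq b + mulU (toSeq b fun α => L.adjEquiv b (tHat K α))) := by
  have hlow := isLowering_negAd (L.tbr wdeg) (tSeq_zero (K := K) b)
  have h := L.curvature_totalDiff b q hq
  rw [(L.totalDiff_totalDiff_tSeq_eq_zero_iff b q hq).mpr hsq, map_zero, sub_eq_zero,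
    L.totalDiff_tSeq b q hq hs, map_add,
    hlow.act_act_of_mul_eq_one (expSeries_mul_bernSeries K), act_mulU _ (tSeq_zero b),
    ← toSeq_act] at h
  have h2 : act Sigma.fst ((2 : K) • L.adjLin b) (expSeries K) (tHat K) =
      fun α => L.adjEquiv b (tHat K α) := (funext (L.adjEquiv_tHat b)).symm
  rwa [h2] at h

/-- The span of the monomials which are allowed in a firm differential. -/
abbrev firmSpan (K : Type*) [Field K] (ι : ℕ → Type*) : Submodule K (Weil K ι) :=
  Submodule.span K {w | ∃ l : List ((Σ n, ι n) ⊕ (Σ n, ι n)),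
    (l.filter Sum.isLeft).length ≤ 1 ∧ (∀ β, Sum.inl β ∈ l → deg β = 1) ∧
      w = FreeGCA.mon wdeg l}

theorem tHat_mem_firmSpan (α : Σ n, ι n) : tHat K α ∈ firmSpan K ι :=
  Submodule.subset_span ⟨[Sum.inr α], by simp, by simp, by simp [FreeGCA.mon, tHat]⟩

theorem tHat_mul_tHat_mem_firmSpan (α β : Σ n, ι n) : tHat K α * tHat K β ∈ firmSpan K ι :=
  Submodule.subset_span ⟨[Sum.inr α, Sum.inr β], by simp, by simp, by simp [FreeGCA.mon, tHat]⟩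

theorem t_mul_tHat_mem_firmSpan {α : Σ n, ι n} (hα : deg α = 1) (β : Σ n, ι n) :
    t K α * tHat K β ∈ firmSpan K ι :=
  Submodule.subset_span ⟨[Sum.inl α, Sum.inr β], le_rfl, by simp [hα],
    by simp [FreeGCA.mon, t, tHat]⟩

theorem tHat_mul_t_mem_firmSpan {β : Σ n, ι n} (hβ : deg β = 1) (α : Σ n, ι n) :
    tHat K α * t K β ∈ firmSpan K ι :=
  Submodule.subset_span ⟨[Sum.inr α, Sum.inl β], le_rfl, by simp [hβ],
    by simp [FreeGCA.mon, t, tHat]⟩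

theorem hasParity_adjEquiv_tHat [CharZero K] (α : Σ n, ι n) :
    FreeGCA.HasParity wdeg (deg α + 1) (L.adjEquiv b (tHat K α)) := by
  have := FreeGCA.hasParity_of_mem_homog wdeg (L.adjGen_mem_homog b (expSeries K) (Sum.inr α))
  rw [← adjHom_gen] at this
  exact this

/-- The image of the firm span consists of the firm polynomials in t and t̂'. Order |α| + 2 of the
flatness equation contains Q t̂'^α, a multiple of d t̂' and the brackets of Θ with itself; each of
these terms is firm. -/
theorem weilDiff_adjEquiv_tHat_mem [CharZero K] (α : Σ n, ι n) :
    L.weilDiff b (L.adjEquiv b (tHat K α)) ∈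
      (firmSpan K ι).map (L.adjEquiv b).toLinearMap := by
  obtain ⟨q, hq, hQ, hs⟩ : ∃ q hq, L.weilDiff b = FreeGCA.der wdeg q hq ∧
    ∀ α, q (Sum.inl α) = L.ceGen b α + tHat K α := ⟨_, _, rfl, fun _ => rfl⟩
  have hsq : ∀ α, FreeGCA.der wdeg q hq (FreeGCA.der wdeg q hq (t K α)) = 0 := fun α => by
    rw [← hQ, weilDiff_weilDiff]
  have h := congrFun (L.totalDiff_adjusted b q hq hs hsq) (deg α + 2)
  set S := (firmSpan K ι).map (L.adjEquiv b).toLinearMap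
  have hS : ∀ w ∈ firmSpan K ι, L.adjEquiv b w ∈ S := fun w hw => ⟨w, hw, rfl⟩
  set X := fun α => L.adjEquiv b (tHat K α)
  have h1 : L.dSeq b 1 = ∑ β ∈ lvl ι 1, (-t K β) ⊗ₜ[K] L.delta (tau b β) := by
    rw [dSeq_eq, ← Finset.sum_neg_distrib]
    exact Finset.sum_congr rfl fun β _ => (TensorProduct.neg_tmul _ _).symm
  have hδ : ∀ β ∈ lvl ι 1, L.delta (tau b β) ∈ gr 0 := by
    intro β hβ
    have hm := tau_mem b β
    rw [mem_lvl.mp hβ] at hm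
    rw [L.delta_apply hm, if_pos (by simp)]
    simpa using L.d_mem _ _ hm
  have hΘ1 : (L.dSeq b + mulU (toSeq b X)) 1 = L.dSeq b 1 := by
    rw [Pi.add_apply, mulU_succ, toSeq_zero_apply, add_zero]
  have hΘ2 : ∀ n, (L.dSeq b + mulU (toSeq b X)) (n + 2) = toSeq b X (n + 1) := by
    intro n
    rw [Pi.add_apply, mulU_succ, L.dSeq_of_ne b (by omega), zero_add]
  have hΘ0 : (L.dSeq b + mulU (toSeq b X)) 0 = 0 := by
    rw [Pi.add_apply, mulU_zero, L.dSeq_of_ne b (by omega), zero_add]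
  have hd : deg α = α.1 + 1 := rfl
  rw [shiftedDiff_succ, hΘ2, hd, hΘ2, ← hd, rTensor_toSeq, Pi.smul_apply, conv_apply,
    ← eq_sub_iff_add_eq'] at h
  have h2 := congrArg (component b _ α) h
  rw [component_toSeq, map_sub, map_smul, map_sum] at h2
  rw [hQ]
  refine h2 ▸ sub_mem (Submodule.smul_mem _ _ (sum_mem fun x hx => ?_)) ?_
  · obtain ⟨i, j⟩ := x
    have hij : i + j = deg α + 2 := mem_antidiagonal.mp hx
    change component b _ α (L.tbr wdeg ((L.dSeq b + mulU (toSeq b X)) i)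
      ((L.dSeq b + mulU (toSeq b X)) j)) ∈ S
    match i, j, hij with
    | 0, j, _ => rw [hΘ0, map_zero, LinearMap.zero_apply, map_zero]; exact zero_mem _
    | i, 0, _ => rw [hΘ0, map_zero, map_zero]; exact zero_mem _
    -- The term [δT, δT], the only one quadratic in the t's, lives in order two, below |α| + 2.
    | 1, 1, hij => omega
    | 1, j + 2, _ =>
      rw [hΘ1, hΘ2, h1, toSeq_apply]
      refine L.component_tbr_sum_mem b S _ hδ (fun γ _ => L.hasParity_adjEquiv_tHat b γ) ?_ α
      intro β hβ γ _
      rw [neg_mul, ← L.adjEquiv_t b β, ← map_mul]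
      exact neg_mem (hS _ (t_mul_tHat_mem_firmSpan (mem_lvl.mp hβ) γ))
    | i + 2, 1, _ =>
      rw [hΘ1, hΘ2, h1, toSeq_apply]
      refine L.component_tbr_sum_mem b S _ (fun β _ => tau_mem b β)
        (fun γ _ => (hasParity_t γ).neg wdeg) ?_ α
      intro β _ γ hγ
      rw [mul_neg, ← L.adjEquiv_t b γ, ← map_mul]
      exact neg_mem (hS _ (tHat_mul_t_mem_firmSpan (mem_lvl.mp hγ) β))
    | i + 2, j + 2, _ =>
      rw [hΘ2, hΘ2, toSeq_apply, toSeq_apply]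
      refine L.component_tbr_sum_mem b S _ (fun β _ => tau_mem b β)
        (fun γ _ => L.hasParity_adjEquiv_tHat b γ) ?_ α
      intro β _ γ _
      rw [← map_mul]
      exact hS _ (tHat_mul_tHat_mem_firmSpan β γ)
  · rw [toSeq_apply, map_sum, map_sum]
    refine sum_mem fun β _ => ?_
    rw [L.td_tmul wdeg (L.hasParity_adjEquiv_tHat b β), map_smul, component_tmul]
    exact Submodule.smul_mem _ _ (Submodule.smul_mem _ _ (hS _ (tHat_mem_firmSpan β)))

theorem isFirmlyAdjusted_adjEquiv [CharZero K] :
    L.IsFirmlyAdjusted b (transport (L.weilDiff b) (L.adjEquiv b)) (L.adjEquiv b) where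
  coordinateChange := L.isCoordinateChange_adjEquiv b
  eq_transport := rfl
  isDifferential := (L.isDifferential_weilDiff b).conj wdeg (L.adjEquiv b)
    (fun j => (L.adjHom_gen b (expSeries K) j).symm ▸ L.adjGen_mem_homog b _ j)
    (fun j => (L.adjHom_gen b (bernSeries K) j).symm ▸ L.adjGen_mem_homog b _ j)
  firm α := by
    obtain ⟨w, hw, h⟩ := L.weilDiff_adjEquiv_tHat_mem b α
    change (L.adjEquiv b).symm (L.weilDiff b (L.adjEquiv b (tHat K α))) ∈ firmSpan K ι
    rw [← h]
    change (L.adjEquiv b).symm (L.adjEquiv b w) ∈ firmSpan K ι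
    rwa [AlgEquiv.symm_apply_apply]

/-! ### Vanishing nested alternators -/

/-- (2S)² is X ↦ [[X, T], T], whose coefficients involve only the nested brackets of basis vectors.
Passing through A avoids composing structure constants. -/
theorem adjOp_adjOp_eq_zero [CharZero K]
    (h : ∀ β γ ε : Σ n, ι n, L.alternator (L.alternator (tau b β) (tau b γ)) (tau b ε) = 0)
    (X : (Σ n, ι n) → Weil K ι) : L.adjOp b (L.adjOp b X) = 0 := by
  have hbr : ∀ β γ ε : Σ n, ι n, L.br (L.br (tau b β) (tau b γ)) (tau b ε) = 0 := by
    intro β γ ε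
    have h1 := h β γ ε
    rw [L.alternator_apply (tau_mem b β), map_smul, LinearMap.smul_apply,
      L.alternator_apply (L.br_tau_mem b β γ)] at h1
    have h0 : ∀ z : ℤ, (-1 : K) ^ z ≠ 0 := fun z => zpow_ne_zero z (by simp)
    exact (smul_eq_zero.mp ((smul_eq_zero.mp h1).resolve_left (h0 _))).resolve_left (h0 _)
  have hseq : toSeq b ((((2 : K) • L.adjLin b) ^ 2) X) = 0 := by
    ext n
    rw [toSeq_adjLin_pow, pow_two, Module.End.mul_apply, negAd_apply, negAd_apply, map_neg,
      LinearMap.neg_apply, neg_neg, conv_conv_left, Pi.zero_apply]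
    refine Finset.sum_eq_zero fun x _ => Finset.sum_eq_zero fun y _ => ?_
    simp only [tSeq, toSeq_apply, map_sum, LinearMap.sum_apply]
    refine Finset.sum_eq_zero fun ε _ => Finset.sum_eq_zero fun γ _ =>
      Finset.sum_eq_zero fun β _ => ?_
    rw [L.tbr_tmul wdeg (hasParity_t _) (tau_mem b _), map_smul, LinearMap.smul_apply,
      L.tbr_tmul wdeg (hasParity_t _) (L.br_tau_mem b _ _), hbr, TensorProduct.tmul_zero,
      smul_zero, smul_zero]
  ext α
  have h2 := component_toSeq b ((((2 : K) • L.adjLin b) ^ 2) X) α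
  rw [hseq, Pi.zero_apply, map_zero, two_smul_adjLin_pow] at h2
  exact (smul_eq_zero.mp h2.symm).resolve_left (by simp)

theorem adjEquiv_tHat_of_nested_eq_zero [CharZero K]
    (h : ∀ i j k : ℤ, i ≤ 0 → j ≤ 0 → k ≤ 0 →
      ∀ x ∈ gr (i - 1), ∀ y ∈ gr (j - 1), ∀ z ∈ gr (k - 1),
        L.alternator (L.alternator x y) z = 0) (α : Σ n, ι n) :
    L.adjEquiv b (tHat K α) = tHat K α + L.adjOp b (tHat K) α := by
  have hmem : ∀ β : Σ n, ι n, tau b β ∈ gr ((1 - (deg β : ℤ)) - 1) := fun β => by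
    convert tau_mem b β using 2
    ring
  have hle : ∀ β : Σ n, ι n, 1 - (deg β : ℤ) ≤ 0 := fun β => by
    have := deg_pos β
    omega
  have h2 := L.adjOp_adjOp_eq_zero b (fun β γ ε => h _ _ _ (hle β) (hle γ) (hle ε) _ (hmem β) _
    (hmem γ) _ (hmem ε)) (tHat K)
  rw [adjEquiv_tHat_eq, Finset.sum_eq_zero, add_zero]
  intro n hn
  -- Every term of the remaining sum contains S² = 0.
  obtain ⟨m, rfl⟩ : ∃ m, n = m + 2 := ⟨n - 2, by have := (Finset.mem_Ico.mp hn).1; omega⟩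
  have h3 : (L.adjOp b)^[m + 2] (tHat K) = 0 := by
    rw [Function.iterate_add_apply]
    change (L.adjLin b)^[m] (L.adjOp b (L.adjOp b (tHat K))) = 0
    rw [h2, ← Module.End.pow_apply, map_zero]
  rw [h3, Pi.zero_apply, smul_zero]

end DGLie

end

/-- Firmly adjusted Weil algebras from alternators.  The bound on the arity of the brackets is not
needed: the coordinate change works for all the Bernoulli brackets. -/
theorem mainTheorem5 {K : Type*} [Field K] [CharZero K] {G : Type*} [AddCommGroup G] [Module K G]
    {gr : ℤ → Submodule K G} [DirectSum.Decomposition gr] (L : DGLie K gr)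
    {ι : ℕ → Type*} [∀ n, Fintype (ι n)]
    (b : ∀ n : ℕ, Module.Basis (ι n) K (gr (-((n : ℤ) + 1))))
    (hternary : L.AtMostTernary) :
    FreeGCA.IsDifferential DGLie.wdeg (L.weilDiff b) ∧
    ∃ (Q' : DGLie.Weil K ι →ₗ[K] DGLie.Weil K ι) (Φ : DGLie.Weil K ι ≃ₐ[K] DGLie.Weil K ι),
      L.IsFirmlyAdjusted b Q' Φ ∧
      (∀ α, Φ (DGLie.tHat K α) =
        DGLie.tHat K α + L.adjOp b (DGLie.tHat K) α +
          ∑ n ∈ Finset.Ico 2 (DGLie.deg α),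
            ((2 : K) ^ n / ((n + 1).factorial : K)) • (L.adjOp b)^[n] (DGLie.tHat K) α) ∧
      ((∀ i j k : ℤ, i ≤ 0 → j ≤ 0 → k ≤ 0 →
          ∀ x ∈ gr (i - 1), ∀ y ∈ gr (j - 1), ∀ z ∈ gr (k - 1),
            L.alternator (L.alternator x y) z = 0) →
        ∀ α, Φ (DGLie.tHat K α) = DGLie.tHat K α +
          ∑ β ∈ DGLie.upTo ι (DGLie.deg α), ∑ γ ∈ DGLie.upTo ι (DGLie.deg α),
            L.adjData b α β γ • (DGLie.tHat K β * DGLie.t K γ)) := by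
  exact ⟨L.isDifferential_weilDiff b, _, L.adjEquiv b, L.isFirmlyAdjusted_adjEquiv b,
    L.adjEquiv_tHat_eq b, L.adjEquiv_tHat_of_nested_eq_zero b⟩
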